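/- **Setting.** Let $d\ge 1$, let $A\in\mathbb R^{d\times d}$, let $B:\mathbb R^d\times\mathbb R^d\to\mathbb R^d$ be bilinear, $f\in\mathbb R^d$, and let $H:\mathbb R^d\to\mathbb R^{d_o}$ be linear. Consider $\frac{d}{dt}x=-Ax-B(x,x)+f$, and assume that for some $R,\delta>0$, $\langle -Av-B(v,v)+f,v\rangle\le 0$ whenever $R\le\|v\|\le R+\delta$. Let $\mathcal B_R=\{v:\|v\|\le R\}$, let $\Psi_t(v)$, $t\ge 0$, be the solution at time $t$ started from $v$ (it exists for all $t\ge0$ for $v$ in a neighbourhood of $\mathcal B_R$), let $\Psi_{-t}:\Psi_t(\mathcal B_R)\to\mathcal B_R$ be the inverse of $\Psi_t|_{\mathcal B_R}$, and put $\Phi_t=H\Psi_t$. $J$ and $J^2$ denote first and second derivatives ($J\Phi_t(v)$ is the $d_o\times d$ Jacobian matrix). Fix $T>0$ and $u$ with $\|u\|<R$. For $h>0$ with $T=kh$, $k\in\mathbb N$, put $t_i=ih$ and observe $Y_i=\Phi_{t_i}(u)+Z_i$, $0\le i\le k$, where the $Z_i$ are i.i.d. in $\mathbb R^{d_o}$ with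 density $\eta$, the centred Gaussian density with i.i.d. components of variance $\sigma_Z^2$. *Assumption on $u$.* $h_{\max}>0$ and $c>0$ are such that for every $0<h\le h_{\max}$ with $T=kh$, $k\in\mathbb N$, and every $v\in\mathcal B_R$, $$\sum_{i=0}^k\|\Phi_{t_i}(v)-\Phi_{t_i}(u)\|^2\ge \frac{c}{h}\|u-v\|^2 .$$ *Assumption on the prior.* $q$ is a probability density on $\mathbb R^d$ that vanishes outside $\mathcal B_R$, is continuous and strictly positive on $\mathcal B_R$, is three times continuously differentiable on $\mathrm{int}\,\mathcal B_R$, and $\sup_{v\in\mathrm{int}\,\mathcal B_R}\|J^i\log q(v)\|<\infty$ for $i=1,2,3$. The filtering distribution $\mu^{\mathrm{fi}}(\cdot|Y_{0:k})$, for prior $q$ on the initial point, has the density $$\mu^{\mathrm{fi}}(v|Y_{0:k})=\frac1{Z^{\mathrm{fi}}_k}\Big[\prod_{i=0}^k\eta\big(Y_i-\Phi_{t_i-t_k}(v)\big)\Big]\,|\det J\Psi_{-t_k}(v)|\;q(\Psi_{-t_k}(v))\quad\text{for }v\in\Psi_{t_k}(\mathcal B_R),$$ and $0$ elsewhere, where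 $Z^{\mathrm{fi}}_k$ is the normalising constant. Let $$A_k=\sum_{i=0}^k\Big(J\Phi_{t_i}(u)'J\Phi_{t_i}(u)-J^2\Phi_{t_i}(u)[\cdot,\cdot,Z_i]\Big),\qquad B_k=\sum_{i=0}^kJ\Phi_{t_i}(u)'Z_i,$$ where $\big(J^2\Phi_{t}(u)[\cdot,\cdot,z]\big)_{ab}=\sum_l \partial_a\partial_b\Phi_{t}^l(u)\,z^l$. Let $u^{\mathcal G}=u+A_k^{-1}B_k$ if $A_k$ is positive definite, and $u^{\mathcal G}=0$ otherwise. If $A_k$ is positive definite and $u^{\mathcal G}\in\mathcal B_R$, let $\mu^{\mathrm{fi}}_{\mathcal G}$ be the Gaussian distribution with mean $\Psi_T(u^{\mathcal G})$ and precision matrix $\sigma_Z^{-2}\,(J^{-1})'A_kJ^{-1}$, where $J=J\Psi_T(u^{\mathcal G})$; otherwise let it be the standard normal distribution on $\mathbb R^d$. Let $\widehat M_1(T)=\sup_{v\in\mathcal B_R,\,0\le t\le T}\|J\Phi_t(v)\|$ and $C_{\|A\|}=\widehat M_1(T)^2(T+h_{\max})+\frac c2$. Let $d_{\mathrm{TV}}$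 denote the total variation distance (half the $L^1$ distance of the densities) and $d_{\mathrm W}$ the first Wasserstein distance for the Euclidean distance. $M\prec N$ means that $N-M$ is positive definite. **Theorem (Gaussian approximation of the filter).** Under these assumptions there are positive constants $D^{(1)}_{\mathrm{TV}},D^{(2)}_{\mathrm{TV}},D^{(1)}_{\mathrm W},D^{(2)}_{\mathrm W}$, which do not depend on $\sigma_Z$, $h$ and $\epsilon$, such that, with $$D_{\mathrm{TV}}(\epsilon)=D^{(1)}_{\mathrm{TV}}+D^{(2)}_{\mathrm{TV}}\Big(\log\frac1\epsilon\Big)^2,\qquad D_{\mathrm W}(\epsilon)=D^{(1)}_{\mathrm W}+D^{(2)}_{\mathrm W}\Big(\log\frac1\epsilon\Big)^2,$$ for all $0<\epsilon\le1$, $\sigma_Z>0$ and $0<h\le h_{\max}$ with $T=kh$, $k\in\mathbb N$, and $\sigma_Z\sqrt h\le\frac12D_{\mathrm{TV}}(\epsilon)^{-1}$, with probability at least $1-\epsilon$ (for the fixed initial point $u$, over the noise) all of the following hold: $$\frac{c}{2h}I_d\prec A_k\prec\frac{C_{\|A\|}}{h}I_d,\qquad u^{\mathcal G}\in\mathcal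 B_R,$$ $$d_{\mathrm{TV}}\big(\mu^{\mathrm{fi}}(\cdot|Y_{0:k}),\mu^{\mathrm{fi}}_{\mathcal G}\big)\le D_{\mathrm{TV}}(\epsilon)\,\sigma_Z\sqrt h,\qquad d_{\mathrm W}\big(\mu^{\mathrm{fi}}(\cdot|Y_{0:k}),\mu^{\mathrm{fi}}_{\mathcal G}\big)\le D_{\mathrm W}(\epsilon)\,\sigma_Z^2h .$$ -/

import Mathlib

noncomputable section

namespace GaussFilter

open MeasureTheory ProbabilityTheory

/-- Column vectors in `ℝⁿ`, with the Euclidean norm. -/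
abbrev Vec (n : ℕ) : Type := EuclideanSpace ℝ (Fin n)

/-- The data of a partially observed dynamical system `du/dt = -A u - B(u,u) + f` on `ℝ^d`, observed
through the linear operator `H`, together with the trapping ball assumption for the radius `R`. -/
structure Model (d dₒ : ℕ) where
  /-- the linear part of the dynamics -/
  A : Vec d →L[ℝ] Vec d
  /-- the bilinear part of the dynamics -/
  B : Vec d →L[ℝ] Vec d →L[ℝ] Vec d
  /-- the constant forcing -/
  f : Vec d
  /-- the observation operator -/
  H : Vec d →L[ℝ] Vec dₒ
  /-- the radius of the trapping ball -/
  R : ℝ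
  /-- the width of the shell on which the vector field does not point outwards -/
  δ : ℝ
  R_pos : 0 < R
  δ_pos : 0 < δ
  trapping : ∀ v : Vec d, R ≤ ‖v‖ → ‖v‖ ≤ R + δ → inner ℝ (-A v - B v v + f) v ≤ 0

namespace Model

variable {d dₒ : ℕ} (M : Model d dₒ)

/-- The right-hand side of the differential equation. -/
def field (v : Vec d) : Vec d := -M.A v - M.B v v + M.f

/-- The closed ball `B_R` (the trapping ball). -/
def ball : Set (Vec d) := Metric.closedBall 0 M.R

/-- `x` is a solution, for all times `t ≥ 0`, started from `v`. -/
def IsSolution (v : Vec d) (x : ℝ → Vec d) : Prop :=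
  x 0 = v ∧ ∀ t : ℝ, 0 ≤ t → HasDerivWithinAt x (M.field (x t)) (Set.Ici 0) t

open Classical in
/-- The solution semigroup for `t ≥ 0`: the position at time `t` of the (unique) solution started
from `v`. By the trapping ball assumption such a solution exists for every `v` with `‖v‖ < R + δ`,
hence in a neighbourhood of `B_R`; where there is no global solution the value is irrelevant. -/
def forward (t : ℝ) (v : Vec d) : Vec d :=
  if hx : ∃ x : ℝ → Vec d, M.IsSolution v x then hx.choose t else v

/-- `Ψ_t` for all real `t`: the solution semigroup for `t ≥ 0`, and for `t < 0` the inverse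
`Ψ_t : Ψ_{-t}(B_R) → B_R` of the one-to-one map `Ψ_{-t} : B_R → Ψ_{-t}(B_R)`. -/
def Ψ (t : ℝ) : Vec d → Vec d :=
  if 0 ≤ t then M.forward t else Function.invFunOn (M.forward (-t)) M.ball

/-- The observed part of the dynamics, `Φ_t = H Ψ_t`. -/
def Φ (t : ℝ) (v : Vec d) : Vec dₒ := M.H (M.Ψ t v)

/-- `M̂₁(T)`: the supremum of the operator norm of the Jacobian of `Φ_t` over `B_R` and
`0 ≤ t ≤ T`. -/
def Mhat₁ (T : ℝ) : ℝ :=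
  sSup {r : ℝ | ∃ v ∈ M.ball, ∃ t ∈ Set.Icc 0 T, r = ‖fderiv ℝ (M.Φ t) v‖}

/-- The assumption on the initial point `u`, the observation window `T` and the constants
`hmax = h_max(u,T)` and `c = c(u,T)`; here `h = T / k` and `t_i = i h`. -/
structure InitialAssumption (u : Vec d) (T hmax c : ℝ) : Prop where
  T_pos : 0 < T
  norm_lt : ‖u‖ < M.R
  hmax_pos : 0 < hmax
  c_pos : 0 < c
  lower : ∀ (k : ℕ) (h : ℝ), 0 < h → h ≤ hmax → T = k * h → ∀ v ∈ M.ball,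
    c / h * ‖u - v‖ ^ 2 ≤
      ∑ i ∈ Finset.range (k + 1), ‖M.Φ (i * h) v - M.Φ (i * h) u‖ ^ 2

/-- The assumption on the prior density `q`. -/
structure PriorAssumption (q : Vec d → ℝ) : Prop where
  integral_eq_one : ∫ v, q v = 1
  zero_outside : ∀ v ∉ M.ball, q v = 0
  pos : ∀ v ∈ M.ball, 0 < q v
  continuousOn : ContinuousOn q M.ball
  contDiffOn : ContDiffOn ℝ 3 q (Metric.ball 0 M.R)
  log_deriv_bounded : ∀ i ∈ Finset.Icc 1 3,
    BddAbove ((fun v => ‖iteratedFDeriv ℝ i (fun x => Real.log (q x)) v‖) '' Metric.ball 0 M.R)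

end Model

/-! ### Noise -/

/-- The density of the centred Gaussian on `ℝⁿ` with i.i.d. components of variance `σ²`. -/
def noiseDensity {n : ℕ} (σ : ℝ) (x : Vec n) : ℝ :=
  ∏ j, gaussianPDFReal 0 (σ ^ 2).toNNReal (x j)

/-- The centred Gaussian distribution on `ℝⁿ` with i.i.d. components of variance `σ²`. -/
def noiseLaw (n : ℕ) (σ : ℝ) : Measure (Vec n) :=
  (Measure.pi fun _ : Fin n => gaussianReal 0 (σ ^ 2).toNNReal).map (WithLp.toLp 2)

/-! ### Jacobians -/

/-- The Jacobian matrix of `g` at `v`, with entries `∂_j g_i (v)`. -/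
def jac {m n : ℕ} (g : Vec m → Vec n) (v : Vec m) : Matrix (Fin n) (Fin m) ℝ :=
  Matrix.of fun i j => fderiv ℝ g v (EuclideanSpace.single j 1) i

/-- The `m × m` matrix `J² g(v)[·,·,z]`, with entries `∑_l (∂_i ∂_j g_l)(v) z_l`. -/
def jac₂ {m n : ℕ} (g : Vec m → Vec n) (v : Vec m) (z : Vec n) : Matrix (Fin m) (Fin m) ℝ :=
  Matrix.of fun i j => ∑ l,
    fderiv ℝ (fderiv ℝ g) v (EuclideanSpace.single i 1) (EuclideanSpace.single j 1) l * z l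

/-! ### Distances between distributions -/

/-- The total variation distance of two distributions with densities `f` and `g`. -/
def dTV {n : ℕ} (f g : Vec n → ℝ) : ENNReal := (1 / 2) * ∫⁻ x, ‖f x - g x‖ₑ

/-- The distribution with density `f`. -/
def ofDensity {n : ℕ} (f : Vec n → ℝ) : Measure (Vec n) :=
  volume.withDensity fun x => ENNReal.ofReal (f x)

/-- The first Wasserstein distance with respect to the Euclidean distance. -/
def dW {n : ℕ} (μ ν : Measure (Vec n)) : ENNReal :=
  ⨅ γ ∈ {γ : Measure (Vec n × Vec n) | γ.map Prod.fst = μ ∧ γ.map Prod.snd = ν},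
    ∫⁻ p, edist p.1 p.2 ∂γ

/-- The strict positive definite order: `N - M` is positive definite. -/
def PosDefLT {n : ℕ} (M N : Matrix (Fin n) (Fin n) ℝ) : Prop := (N - M).PosDef

/-! ### The filtering distribution and its Gaussian approximation -/

namespace Model

variable {d dₒ : ℕ} (M : Model d dₒ)

open Classical in
/-- The filtering density up to its normalising constant, for observations `y₀, …, y_k` made at the
times `t_i = i h`. -/
def filterUnnormalized (q : Vec d → ℝ) (σ h : ℝ) (k : ℕ) (y : ℕ → Vec dₒ) (v : Vec d) : ℝ :=
  if v ∈ M.Ψ (k * h) '' M.ball then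
    (∏ i ∈ Finset.range (k + 1), noiseDensity σ (y i - M.Φ (i * h - k * h) v)) *
      |(fderivWithin ℝ (M.Ψ (-(k * h))) (M.Ψ (k * h) '' M.ball) v).det| *
      q (M.Ψ (-(k * h)) v)
  else 0

/-- The density `μ^fi(· | y₀, …, y_k)` of the filtering distribution, that is of the conditional
distribution of the position at time `t_k = k h` given the observations. -/
def filterDensity (q : Vec d → ℝ) (σ h : ℝ) (k : ℕ) (y : ℕ → Vec dₒ) (v : Vec d) : ℝ :=
  M.filterUnnormalized q σ h k y v / ∫ w, M.filterUnnormalized q σ h k y w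

/-- The observations `Y_i = H u(t_i) + Z_i` for the noise sequence `z`. -/
def obs (u : Vec d) (h : ℝ) (z : ℕ → Vec dₒ) (i : ℕ) : Vec dₒ := M.Φ (i * h) u + z i

/-- The matrix `A_k`: half the Hessian at `u` of the misfit `v ↦ ∑ ‖Y_i - Φ_{t_i}(v)‖²` for the
observations `Y_i = Φ_{t_i}(u) + z_i`. The signs in `A_k` and in the centre `u^G` are those that
belong to `Y_i = H u(t_i) + Z_i`. -/
def Ak (u : Vec d) (h : ℝ) (k : ℕ) (z : ℕ → Vec dₒ) : Matrix (Fin d) (Fin d) ℝ :=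
  ∑ i ∈ Finset.range (k + 1),
    ((jac (M.Φ (i * h)) u).transpose * jac (M.Φ (i * h)) u - jac₂ (M.Φ (i * h)) u (z i))

/-- The vector `B_k`: minus half the gradient at `u` of the same misfit. -/
def Bk (u : Vec d) (h : ℝ) (k : ℕ) (z : ℕ → Vec dₒ) : Fin d → ℝ :=
  ∑ i ∈ Finset.range (k + 1), (jac (M.Φ (i * h)) u).transpose.mulVec (z i).ofLp

open Classical in
/-- The centre `u^G = u + A_k⁻¹ B_k`, and `0` if `A_k` is not positive definite. -/
def center (u : Vec d) (h : ℝ) (k : ℕ) (z : ℕ → Vec dₒ) : Vec d :=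
  if (M.Ak u h k z).PosDef then
    u + WithLp.toLp 2 ((M.Ak u h k z)⁻¹.mulVec (M.Bk u h k z))
  else 0

open Classical in
/-- The density of the Gaussian approximation `μ^fi_G` of the filter at time `T = k h`; if `A_k` is
not positive definite or `u^G ∉ B_R`, it is by convention the standard normal density. -/
def filterGaussDensity (u : Vec d) (σ h : ℝ) (k : ℕ) (z : ℕ → Vec dₒ) (v : Vec d) : ℝ :=
  let a := M.Ak u h k z
  let uG := M.center u h k z
  let J := jac (M.Ψ (k * h)) uG
  let w : Fin d → ℝ := (v - M.Ψ (k * h) uG).ofLp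
  if a.PosDef ∧ uG ∈ M.ball then
    Real.sqrt a.det / |J.det| * (1 / ((2 * Real.pi) ^ ((d : ℝ) / 2) * σ ^ d)) *
      Real.exp (-(dotProduct w (((J⁻¹).transpose * a * J⁻¹).mulVec w)) / (2 * σ ^ 2))
  else
    1 / (2 * Real.pi) ^ ((d : ℝ) / 2) * Real.exp (-‖v‖ ^ 2 / 2)

/-- The constant `C_‖A‖ = M̂₁(T)² (T + h_max) + c / 2`. -/
def CA (T hmax c : ℝ) : ℝ := M.Mhat₁ T ^ 2 * (T + hmax) + c / 2

end Model

end GaussFilter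

end

/-! The natural length scale is `s = σ√h`. For an initial point `v`, the log-likelihood relative to
that of `u` is `-misfit v / (2σ²)`. Since the grid has about `T/h` points, `misfit v` equals
`⟨A_k(v-u), v-u⟩ - 2⟨B_k, v-u⟩` up to `O(‖v-u‖³/h)`; completing the square centres it at `u^G`.
Moving to time `T`, the filter density at `Ψ_T v` is a constant times `exp(-misfit v/(2σ²))
q(v)/|det JΨ_T(v)|`. The exponent of the Gaussian is the same quadratic form evaluated at `J⁻¹(Ψ_T v
- Ψ_T u^G)`, which is `v - u^G` up to a quadratic error, so the forms again differ by a cubic error.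
At distance of order `s` these cubic errors, divided by `σ²`, are of order `s`, and the prior factor
is `1 + O(s)`.

Away from the centre, the identifiability assumption bounds the misfit below by a quadratic of size
`1/h`, so both densities have Gaussian decay of width `s`. Together this gives a pointwise bound of
the difference by `s m³` times a Gaussian profile, where `m` measures the noise
(`exists_pointwise_bound`, resting on `exists_perturbation_bound`). Normalising and integrating
gives total variation of order `s m³`. In the Wasserstein bound the difference is weighted by the
distance to the centre, which contributes one more `s` (`exists_normalized_bounds`,
`dW_withDensity_le`).

The noise must be controlled uniformly in `v`, and this is done without chaining. The pair (initial
point, velocity path) is a `C³` function of `v` with values in a Banach space: the trajectory solves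
an integral equation whose linearisation is `1` minus a Volterra operator, hence invertible
(`contDiffAt_path`). Every observation is a bounded linear functional of this pair, so all noise
terms, in the misfit, in `A_k` and in `B_k`, are values of one linear functional `noiseFun`, and
only its norm matters. Because the velocity is part of the data, summation by parts bounds that norm
by norms of tail sums of the noise (`norm_noiseFun_le`), which are of order `σ√k` instead of `σk`. A
Chernoff bound (`measure_noiseSize_ge_le`) then gives, outside probability `ε`, a noise size at most
`s m/h` with `m` of order `1 + √(log(1/ε))` for small `ε`. The bound `m³ ≤ m⁴` produces the squared
logarithm in the theorem. -/

noncomputable section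
open MeasureTheory ProbabilityTheory
namespace GaussFilter
namespace Model
variable {d dₒ : ℕ} (M : Model d dₒ)

/-! ### The flow: trapping, global existence, two-sided exponential separation. -/

/-- The open neighbourhood of the trapping ball on which the flow is defined. -/
def dom : Set (Vec d) := Metric.ball 0 (M.R + M.δ)

/-- A Lipschitz constant of the vector field on `M.dom`. -/
def lip : ℝ := ‖M.A‖ + 2 * (M.R + M.δ) * ‖M.B‖

lemma lip_nonneg : 0 ≤ M.lip := by
  have := M.R_pos; have := M.δ_pos; unfold lip; positivity

lemma mem_dom {v : Vec d} : v ∈ M.dom ↔ ‖v‖ < M.R + M.δ := by simp [dom]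

lemma mem_ball {v : Vec d} : v ∈ M.ball ↔ ‖v‖ ≤ M.R := by simp [ball]

lemma ball_subset_dom : M.ball ⊆ M.dom := fun v hv => by
  have := M.δ_pos; rw [mem_ball] at hv; rw [mem_dom]; linarith

lemma isOpen_dom : IsOpen M.dom := Metric.isOpen_ball

lemma field_contDiff : ContDiff ℝ ⊤ M.field := by unfold field; fun_prop

/-- The field is quadratic, so its increment is exactly linear in `x - y`, with coefficients
depending on the endpoints. The same identity is used pointwise on paths. -/
lemma field_sub (x y : Vec d) :
    M.field x - M.field y = -M.A (x - y) - M.B (x - y) x - M.B y (x - y) := by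
  simp only [field, map_sub, sub_apply]; abel

lemma norm_field_sub_le {x y : Vec d} (hx : ‖x‖ ≤ M.R + M.δ) (hy : ‖y‖ ≤ M.R + M.δ) :
    ‖M.field x - M.field y‖ ≤ M.lip * ‖x - y‖ := by
  rw [field_sub]
  have h1 := M.A.le_opNorm (x - y)
  have h2 := M.B.le_opNorm₂ (x - y) x
  have h3 := M.B.le_opNorm₂ y (x - y)
  have h4 := norm_sub_le (-M.A (x - y) - M.B (x - y) x) (M.B y (x - y))
  have h5 := norm_sub_le (-M.A (x - y)) (M.B (x - y) x)
  rw [norm_neg] at h5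
  have h6 : ‖M.B‖ * ‖x - y‖ * ‖x‖ ≤ ‖M.B‖ * ‖x - y‖ * (M.R + M.δ) := by gcongr
  have h7 : ‖M.B‖ * ‖y‖ * ‖x - y‖ ≤ ‖M.B‖ * (M.R + M.δ) * ‖x - y‖ := by gcongr
  unfold lip
  nlinarith

/-- Trajectories of a field that agrees with `M.field` on the trapping region stay there. -/
lemma norm_le_of_trapping {g : Vec d → Vec d} (hg : ∀ y, ‖y‖ ≤ M.R + M.δ → g y = M.field y)
    {v : Vec d} (hv : v ∈ M.dom) {x : ℝ → Vec d} (h0 : x 0 = v)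
    (hx : ∀ t : ℝ, 0 ≤ t → HasDerivWithinAt x (g (x t)) (Set.Ici 0) t) {t : ℝ} (ht : 0 ≤ t) :
    ‖x t‖ ≤ max ‖v‖ M.R := by
  set r := max ‖v‖ M.R with hr
  have hR := M.R_pos
  have hδ := M.δ_pos
  have hr1 : r < M.R + M.δ := max_lt (M.mem_dom.1 hv) (by linarith)
  have hr0 : 0 < r := lt_of_lt_of_le hR (le_max_right _ _)
  have hrR : M.R ≤ r := le_max_right _ _
  -- The barrier `r² + εs` rises strictly and stays in the shell up to time `t`. At a contact the
  -- trapping condition makes the derivative of the squared norm nonpositive, below the slope `ε`.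
  -- Then `ε` tends to zero.
  have key : ∀ ε : ℝ, 0 < ε → ε * t ≤ (M.R + M.δ) ^ 2 - r ^ 2 → ‖x t‖ ^ 2 ≤ r ^ 2 + ε * t := by
    intro ε hε hεt
    refine image_le_of_deriv_right_lt_deriv_boundary (f := fun s => ‖x s‖ ^ 2)
      (f' := fun s => 2 * inner ℝ (x s) (g (x s))) (a := 0) (b := t)
      (B := fun s => r ^ 2 + ε * s) (B' := fun _ => ε) ?_ ?_ ?_ ?_ ?_ ⟨ht, le_rfl⟩
    · intro s hs
      exact ((hx s hs.1).continuousWithinAt.mono Set.Icc_subset_Ici_self).norm.pow 2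
    · intro s hs
      exact ((hx s hs.1).mono (Set.Ici_subset_Ici.2 hs.1)).norm_sq
    · simp only [h0, mul_zero, add_zero]
      gcongr
      exact le_max_left _ _
    · intro s
      simpa using ((hasDerivAt_id s).const_mul ε).const_add (r ^ 2)
    · intro s hs hfs
      have hs' : ε * s ≤ ε * t := by gcongr; exact hs.2.le
      have h1 : M.R ≤ ‖x s‖ := by
        have h2 : M.R ^ 2 ≤ ‖x s‖ ^ 2 := by
          rw [hfs]
          have : 0 ≤ ε * s := mul_nonneg hε.le hs.1
          nlinarith
        exact le_of_sq_le_sq h2 (norm_nonneg _)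
      have h2 : ‖x s‖ ≤ M.R + M.δ := by
        have h2 : ‖x s‖ ^ 2 ≤ (M.R + M.δ) ^ 2 := by rw [hfs]; linarith
        exact le_of_sq_le_sq h2 (by linarith)
      have h3 := M.trapping _ h1 h2
      rw [hg _ h2, real_inner_comm]
      simp only [field]
      linarith
  have h2 : ‖x t‖ ^ 2 ≤ r ^ 2 := by
    refine le_of_forall_pos_le_add fun η hη => ?_
    set D := (M.R + M.δ) ^ 2 - r ^ 2 with hD
    have hDpos : 0 < D := by nlinarith
    have hm : 0 < min η D := lt_min hη hDpos
    have h3 : min η D / (t + 1) * t ≤ min η D := by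
      rw [div_mul_eq_mul_div, div_le_iff₀ (by linarith)]
      nlinarith
    have := key (min η D / (t + 1)) (by positivity) (h3.trans (min_le_right _ _))
    have h4 := min_le_left η D
    linarith
  exact le_of_sq_le_sq h2 hr0.le

end Model

/-- Global forward existence for a bounded Lipschitz autonomous field. -/
lemma exists_global_solution {E : Type*} [NormedAddCommGroup E] [NormedSpace ℝ E] [CompleteSpace E]
    {g : E → E} {K : NNReal} (hK : LipschitzWith K g) {L : ℝ} (hL : ∀ y, ‖g y‖ ≤ L) (v : E) :
    ∃ x : ℝ → E, x 0 = v ∧ ∀ t : ℝ, 0 ≤ t → HasDerivWithinAt x (g (x t)) (Set.Ici 0) t := by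
  have hL0 : 0 ≤ L := (norm_nonneg _).trans (hL v)
  have loc : ∀ n : ℕ, ∃ α : ℝ → E, α 0 = v ∧ ∀ t ∈ Set.Icc (0 : ℝ) n,
      HasDerivWithinAt α (g (α t)) (Set.Icc 0 n) t := by
    intro n
    have hn : (0 : ℝ) ≤ n := n.cast_nonneg
    -- A field bounded by `L` cannot leave the ball of radius `L * n` within time `n`, so
    -- Picard–Lindelöf applies on the whole of `[0, n]`.
    have := IsPicardLindelof.of_time_independent (f := g) (tmin := 0) (tmax := n)
      (t₀ := ⟨0, le_rfl, hn⟩) (x₀ := v) (a := ⟨L * n, by positivity⟩) (r := 0) (L := ⟨L, hL0⟩)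
      (K := K) (fun x _ => hL x) hK.lipschitzOnWith (by simp [hn]; rfl)
    exact this.exists_eq_forall_mem_Icc_hasDerivWithinAt₀
  choose α hα0 hα using loc
  have agree : ∀ {m n : ℕ}, m ≤ n → Set.EqOn (α m) (α n) (Set.Icc 0 m) := by
    intro m n hmn
    have hmn' : (m : ℝ) ≤ n := by exact_mod_cast hmn
    have hsub : Set.Icc (0 : ℝ) m ⊆ Set.Icc 0 n := Set.Icc_subset_Icc_right hmn'
    refine ODE_solution_unique_of_mem_Icc_right (v := fun _ => g) (s := fun _ => Set.univ) (K := K)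
      (fun t _ => hK.lipschitzOnWith) (fun t ht => (hα m t ht).continuousWithinAt) ?_
      (fun _ _ => trivial) (fun t ht => ((hα n t (hsub ht)).mono hsub).continuousWithinAt) ?_
      (fun _ _ => trivial) (by rw [hα0, hα0])
    · intro t ht
      exact (hα m t ⟨ht.1, ht.2.le⟩).mono_of_mem_nhdsWithin
        (Icc_mem_nhdsGE_of_mem ht)
    · intro t ht
      exact (hα n t (hsub ⟨ht.1, ht.2.le⟩)).mono_of_mem_nhdsWithin
        (Icc_mem_nhdsGE_of_mem ⟨ht.1, ht.2.trans_le hmn'⟩)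
  -- The glued solution uses an index that varies with `t`; near any given time it can be replaced
  -- by a fixed `n`, so that differentiability is inherited.
  have eqn : ∀ (t : ℝ), 0 ≤ t → ∀ n : ℕ, t < n → α (⌈t⌉₊ + 1) t = α n t := by
    intro t ht n hn
    have h1 : t ≤ (⌈t⌉₊ : ℝ) := Nat.le_ceil t
    rcases le_total (⌈t⌉₊ + 1) n with h | h
    · exact agree h ⟨ht, by push_cast; linarith⟩
    · exact (agree h ⟨ht, hn.le⟩).symm
  refine ⟨fun t => α (⌈t⌉₊ + 1) t, ?_, fun t ht => ?_⟩
  · simp [hα0]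
  · obtain ⟨n, hn⟩ := exists_nat_gt t
    have h1 := hα n t ⟨ht, hn.le⟩
    beta_reduce
    rw [eqn t ht n hn]
    have hmem : Set.Icc (0 : ℝ) n ∈ nhdsWithin t (Set.Ici 0) := by
      have : Set.Iio (n : ℝ) ∈ nhdsWithin t (Set.Ici 0) :=
        mem_nhdsWithin_of_mem_nhds (Iio_mem_nhds hn)
      filter_upwards [this, self_mem_nhdsWithin] with s hs1 hs2
      exact ⟨hs2, (Set.mem_Iio.1 hs1).le⟩
    refine (h1.mono_of_mem_nhdsWithin hmem).congr_of_eventuallyEq ?_ (eqn t ht n hn)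
    have : Set.Iio (n : ℝ) ∈ nhdsWithin t (Set.Ici 0) :=
      mem_nhdsWithin_of_mem_nhds (Iio_mem_nhds hn)
    filter_upwards [this, self_mem_nhdsWithin] with s hs1 hs2
    exact eqn s hs2 n hs1

namespace Model
variable {d dₒ : ℕ} (M : Model d dₒ)

/-- Cutting the field off with a bump makes it bounded and globally Lipschitz. Trapping keeps the
trajectories of the modified field where the bump equals `1`, so they solve the original equation.
-/
lemma exists_isSolution {v : Vec d} (hv : v ∈ M.dom) : ∃ x, M.IsSolution v x := by
  have hR := M.R_pos
  have hδ := M.δ_pos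
  let χ : ContDiffBump (0 : Vec d) := ⟨M.R + M.δ, M.R + M.δ + 1, by linarith, by linarith⟩
  let g : Vec d → Vec d := fun y => χ y • M.field y
  have hg1 : ContDiff ℝ 1 g := (χ.contDiff.smul (M.field_contDiff.of_le le_top))
  have hg2 : HasCompactSupport g := χ.hasCompactSupport.smul_right
  obtain ⟨K, hK⟩ := hg1.lipschitzWith_of_hasCompactSupport hg2 one_ne_zero
  obtain ⟨L, hL⟩ := hg2.exists_bound_of_continuous hg1.continuous
  obtain ⟨x, hx0, hx⟩ := exists_global_solution hK hL v
  have hgf : ∀ y, ‖y‖ ≤ M.R + M.δ → g y = M.field y := by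
    intro y hy
    have : χ y = 1 := χ.one_of_mem_closedBall (by simpa using hy)
    simp [g, this]
  refine ⟨x, hx0, fun t ht => ?_⟩
  have hb := M.norm_le_of_trapping hgf hv hx0 hx ht
  have : max ‖v‖ M.R ≤ M.R + M.δ := max_le (M.mem_dom.1 hv).le (by linarith)
  rw [← hgf _ (hb.trans this)]
  exact hx t ht

variable {M}

lemma IsSolution.norm_le {v : Vec d} {x : ℝ → Vec d} (h : M.IsSolution v x) (hv : v ∈ M.dom)
    {t : ℝ} (ht : 0 ≤ t) : ‖x t‖ ≤ max ‖v‖ M.R :=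
  M.norm_le_of_trapping (fun _ _ => rfl) hv h.1 h.2 ht

lemma IsSolution.norm_lt {v : Vec d} {x : ℝ → Vec d} (h : M.IsSolution v x) (hv : v ∈ M.dom)
    {t : ℝ} (ht : 0 ≤ t) : ‖x t‖ < M.R + M.δ := by
  have := M.δ_pos
  exact (h.norm_le hv ht).trans_lt (max_lt (M.mem_dom.1 hv) (by linarith))

/-- Two trajectories separate at most exponentially fast and approach at most exponentially fast. -/
lemma IsSolution.norm_sub_bounds {v w : Vec d} {x y : ℝ → Vec d} (hx : M.IsSolution v x)
    (hy : M.IsSolution w y) (hv : v ∈ M.dom) (hw : w ∈ M.dom) {t : ℝ} (ht : 0 ≤ t) :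
    Real.exp (-(M.lip * t)) * ‖v - w‖ ≤ ‖x t - y t‖ ∧
      ‖x t - y t‖ ≤ Real.exp (M.lip * t) * ‖v - w‖ := by
  set K := M.lip
  have hder : ∀ s : ℝ, 0 ≤ s → HasDerivWithinAt (fun s => ‖x s - y s‖ ^ 2)
      (2 * inner ℝ (x s - y s) (M.field (x s) - M.field (y s))) (Set.Ici 0) s := fun s hs =>
    ((hx.2 s hs).sub (hy.2 s hs)).norm_sq
  have hin : ∀ s : ℝ, 0 ≤ s → |inner ℝ (x s - y s) (M.field (x s) - M.field (y s))| ≤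
      K * ‖x s - y s‖ ^ 2 := by
    intro s hs
    have h1 := abs_real_inner_le_norm (x s - y s) (M.field (x s) - M.field (y s))
    have h2 := M.norm_field_sub_le (hx.norm_lt hv hs).le (hy.norm_lt hw hs).le
    have h3 : ‖x s - y s‖ * ‖M.field (x s) - M.field (y s)‖ ≤
      ‖x s - y s‖ * (K * ‖x s - y s‖) := by gcongr
    nlinarith
  have hexp : ∀ (a s : ℝ), HasDerivAt (fun s => Real.exp (a * s)) (Real.exp (a * s) * a) s := by
    intro a s
    simpa using ((hasDerivAt_id s).const_mul a).exp
  -- With `a = 2K` the weighted squared distance is nondecreasing, with `a = -2K` nonincreasing;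
  -- these give the lower and the upper bound.
  have gen : ∀ a s : ℝ, 0 ≤ s → HasDerivWithinAt (fun s => Real.exp (a * s) * ‖x s - y s‖ ^ 2)
      (Real.exp (a * s) * (a * ‖x s - y s‖ ^ 2 +
        2 * inner ℝ (x s - y s) (M.field (x s) - M.field (y s)))) (Set.Ici 0) s := by
    intro a s hs
    refine ((hexp a s).hasDerivWithinAt.mul (hder s hs)).congr_deriv ?_
    ring
  have cont : ∀ a : ℝ, ContinuousOn (fun s => Real.exp (a * s) * ‖x s - y s‖ ^ 2) (Set.Ici 0) :=
    fun a s hs => (gen a s hs).continuousWithinAt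
  have lower : Real.exp (2 * K * 0) * ‖x 0 - y 0‖ ^ 2 ≤ Real.exp (2 * K * t) * ‖x t - y t‖ ^ 2 := by
    refine monotoneOn_of_hasDerivWithinAt_nonneg (D := Set.Ici (0:ℝ)) (convex_Ici 0) (cont (2 * K))
      (f' := fun s => Real.exp (2 * K * s) * (2 * K * ‖x s - y s‖ ^ 2 +
        2 * inner ℝ (x s - y s) (M.field (x s) - M.field (y s)))) ?_ ?_ (Set.self_mem_Ici) ht ht
    · intro s hs
      rw [interior_Ici] at hs ⊢
      exact (gen (2 * K) s (le_of_lt hs)).mono Set.Ioi_subset_Ici_self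
    · intro s hs
      rw [interior_Ici] at hs
      have := (abs_le.1 (hin s (le_of_lt hs))).1
      have := Real.exp_pos (2 * K * s)
      apply mul_nonneg this.le
      linarith
  have upper : Real.exp (-2 * K * t) * ‖x t - y t‖ ^ 2 ≤
      Real.exp (-2 * K * 0) * ‖x 0 - y 0‖ ^ 2 := by
    refine antitoneOn_of_hasDerivWithinAt_nonpos (D := Set.Ici (0:ℝ)) (convex_Ici 0) (cont (-2 * K))
      (f' := fun s => Real.exp (-2 * K * s) * (-2 * K * ‖x s - y s‖ ^ 2 +
        2 * inner ℝ (x s - y s) (M.field (x s) - M.field (y s)))) ?_ ?_ (Set.self_mem_Ici) ht ht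
    · intro s hs
      rw [interior_Ici] at hs ⊢
      exact (gen (-2 * K) s (le_of_lt hs)).mono Set.Ioi_subset_Ici_self
    · intro s hs
      rw [interior_Ici] at hs
      have := (abs_le.1 (hin s (le_of_lt hs))).2
      have := Real.exp_pos (-2 * K * s)
      apply mul_nonpos_of_nonneg_of_nonpos this.le
      linarith
  rw [hx.1, hy.1] at lower upper
  simp only [mul_zero, Real.exp_zero, one_mul] at lower upper
  have e1 : Real.exp (2 * K * t) = Real.exp (K * t) ^ 2 := by rw [sq, ← Real.exp_add]; ring_nf
  have e2 : Real.exp (-2 * K * t) = (Real.exp (K * t) ^ 2)⁻¹ := by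
    rw [← e1, ← Real.exp_neg]; ring_nf
  rw [e1, ← mul_pow] at lower
  rw [e2, inv_mul_le_iff₀ (by positivity), ← mul_pow] at upper
  constructor
  · rw [Real.exp_neg, inv_mul_le_iff₀ (by positivity)]
    exact le_of_sq_le_sq lower (by positivity)
  · exact le_of_sq_le_sq upper (by positivity)

lemma IsSolution.unique {v : Vec d} {x y : ℝ → Vec d} (hx : M.IsSolution v x)
    (hy : M.IsSolution v y) (hv : v ∈ M.dom) {t : ℝ} (ht : 0 ≤ t) : x t = y t := by
  have := (hx.norm_sub_bounds hy hv hv ht).2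
  rw [sub_self, norm_zero, mul_zero] at this
  exact sub_eq_zero.1 (norm_le_zero_iff.1 this)

variable (M)

lemma isSolution_forward {v : Vec d} (hv : v ∈ M.dom) : M.IsSolution v fun t => M.forward t v := by
  have h := M.exists_isSolution hv
  have : (fun t => M.forward t v) = h.choose := by funext t; simp [forward, h]
  rw [this]
  exact h.choose_spec

lemma norm_forward_le {v : Vec d} (hv : v ∈ M.dom) {t : ℝ} (ht : 0 ≤ t) :
    ‖M.forward t v‖ ≤ max ‖v‖ M.R := (M.isSolution_forward hv).norm_le hv ht

lemma forward_mem_dom {v : Vec d} (hv : v ∈ M.dom) {t : ℝ} (ht : 0 ≤ t) :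
    M.forward t v ∈ M.dom := M.mem_dom.2 ((M.isSolution_forward hv).norm_lt hv ht)

lemma forward_mem_ball {v : Vec d} (hv : v ∈ M.ball) {t : ℝ} (ht : 0 ≤ t) :
    M.forward t v ∈ M.ball := by
  have := M.norm_forward_le (M.ball_subset_dom hv) ht
  rw [max_eq_right (M.mem_ball.1 hv)] at this
  exact M.mem_ball.2 this

lemma forward_zero {v : Vec d} (hv : v ∈ M.dom) : M.forward 0 v = v := (M.isSolution_forward hv).1

lemma forward_add {v : Vec d} (hv : v ∈ M.dom) {s t : ℝ} (hs : 0 ≤ s) (ht : 0 ≤ t) :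
    M.forward (s + t) v = M.forward t (M.forward s v) := by
  have h1 := M.isSolution_forward hv
  have h2 : M.IsSolution (M.forward s v) fun t => M.forward (s + t) v := by
    refine ⟨by simp, fun t ht => ?_⟩
    have h3 := h1.2 (s + t) (by positivity)
    have h4 : HasDerivWithinAt (fun r : ℝ => s + r) 1 (Set.Ici 0) t :=
      (hasDerivWithinAt_id t _).const_add s
    have h5 := HasDerivWithinAt.scomp t h3 h4 (fun r hr => by
      simp only [Set.mem_Ici] at hr ⊢; positivity)
    simpa [Function.comp_def] using h5
  exact h2.unique (M.isSolution_forward (M.forward_mem_dom hv hs)) (M.forward_mem_dom hv hs) ht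

lemma le_norm_forward_sub {v w : Vec d} (hv : v ∈ M.dom) (hw : w ∈ M.dom) {t : ℝ} (ht : 0 ≤ t) :
    Real.exp (-(M.lip * t)) * ‖v - w‖ ≤ ‖M.forward t v - M.forward t w‖ :=
  ((M.isSolution_forward hv).norm_sub_bounds (M.isSolution_forward hw) hv hw ht).1

lemma norm_forward_sub_le {v w : Vec d} (hv : v ∈ M.dom) (hw : w ∈ M.dom) {t : ℝ} (ht : 0 ≤ t) :
    ‖M.forward t v - M.forward t w‖ ≤ Real.exp (M.lip * t) * ‖v - w‖ :=
  ((M.isSolution_forward hv).norm_sub_bounds (M.isSolution_forward hw) hv hw ht).2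

lemma forward_injOn {t : ℝ} (ht : 0 ≤ t) : Set.InjOn (M.forward t) M.dom := by
  intro v hv w hw h
  have := M.le_norm_forward_sub hv hw ht
  rw [h, sub_self, norm_zero] at this
  have h2 := Real.exp_pos (-(M.lip * t))
  have h3 : ‖v - w‖ ≤ 0 := by nlinarith [norm_nonneg (v - w)]
  exact sub_eq_zero.1 (norm_le_zero_iff.1 h3)

lemma Psi_of_nonneg {t : ℝ} (ht : 0 ≤ t) : M.Ψ t = M.forward t := by simp [Ψ, ht]

/-- Strict positivity of `t` matters: it selects the inverse branch in the definition of `Ψ`. -/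
lemma Psi_neg_forward {t : ℝ} (ht : 0 < t) {v : Vec d} (hv : v ∈ M.ball) :
    M.Ψ (-t) (M.forward t v) = v := by
  have : ¬ (0 ≤ -t) := by linarith
  simp only [Ψ, this, if_false, neg_neg]
  exact ((M.forward_injOn ht.le).mono M.ball_subset_dom).leftInvOn_invFunOn hv

/-- Going back from the final time to an intermediate time. -/
lemma Psi_sub_forward {s t : ℝ} (hs : 0 ≤ s) (hst : s ≤ t) {v : Vec d} (hv : v ∈ M.ball) :
    M.Ψ (s - t) (M.forward t v) = M.forward s v := by
  have hvd := M.ball_subset_dom hv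
  rcases hst.eq_or_lt with rfl | hlt
  · rw [sub_self, M.Psi_of_nonneg le_rfl, M.forward_zero (M.forward_mem_dom hvd hs)]
  · have h1 : M.forward t v = M.forward (t - s) (M.forward s v) := by
      rw [← M.forward_add hvd hs (by linarith)]; congr 1; ring
    rw [h1, show s - t = -(t - s) by ring]
    exact M.Psi_neg_forward (by linarith) (M.forward_mem_ball hv hs)

end Model
end GaussFilter
end

/-! ### Smooth dependence on the initial point, in the space of continuous paths. -/

noncomputable section
open MeasureTheory ProbabilityTheory
namespace GaussFilter

section PathSpace
variable {E : Type*} [NormedAddCommGroup E] [NormedSpace ℝ E] {T : ℝ}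

/-- The primitive vanishing at `0`, as an operator on continuous paths. -/
def integ (hT : 0 ≤ T) : C(Set.Icc (0 : ℝ) T, E) →L[ℝ] C(Set.Icc (0 : ℝ) T, E) :=
  LinearMap.mkContinuous
    { toFun := fun x => ⟨fun t => ∫ s in (0 : ℝ)..t, Set.IccExtend hT x s,
        (intervalIntegral.continuous_primitive
          (fun a b => (x.continuous.Icc_extend' (h := hT)).intervalIntegrable a b) 0).comp
          continuous_subtype_val⟩
      map_add' := fun x y => by
        ext t
        exact intervalIntegral.integral_add
          ((x.continuous.Icc_extend' (h := hT)).intervalIntegrable 0 t)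
          ((y.continuous.Icc_extend' (h := hT)).intervalIntegrable 0 t)
      map_smul' := fun c x => by
        ext t
        exact intervalIntegral.integral_smul c _ } T fun x => by
    refine (ContinuousMap.norm_le _ (by positivity)).2 fun t => ?_
    have h1 : ‖∫ s in (0 : ℝ)..t, Set.IccExtend hT x s‖ ≤ ‖x‖ * |(t : ℝ) - 0| :=
      intervalIntegral.norm_integral_le_of_norm_le_const fun s _ => x.norm_coe_le_norm _
    rw [sub_zero, abs_of_nonneg t.2.1] at h1
    refine h1.trans ?_
    rw [mul_comm]
    gcongr
    exact t.2.2

lemma integ_apply (hT : 0 ≤ T) (x : C(Set.Icc (0 : ℝ) T, E)) (t : Set.Icc (0 : ℝ) T) :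
    integ hT x t = ∫ s in (0 : ℝ)..t, Set.IccExtend hT x s := rfl

/-- The hypothesis on `L` is pointwise in time, so each integration raises the power of `t` and the
factorial accumulates. -/
lemma norm_integ_comp_pow_apply_le (hT : 0 ≤ T)
    (L : C(Set.Icc (0 : ℝ) T, E) →L[ℝ] C(Set.Icc (0 : ℝ) T, E)) {c : ℝ} (hc : 0 ≤ c)
    (hL : ∀ y t, ‖L y t‖ ≤ c * ‖y t‖) (n : ℕ) (y : C(Set.Icc (0 : ℝ) T, E))
    (t : Set.Icc (0 : ℝ) T) :
    ‖((integ hT ∘L L) ^ n) y t‖ ≤ (c * t) ^ n / n.factorial * ‖y‖ := by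
  induction n generalizing t with
  | zero => simpa using y.norm_coe_le_norm t
  | succ n ih =>
    rw [pow_succ', mul_apply_eq_comp, ContinuousLinearMap.comp_apply, integ_apply]
    set w := ((integ hT ∘L L) ^ n) y
    have h1 : ‖∫ s in (0 : ℝ)..t, Set.IccExtend hT (L w) s‖ ≤
        ∫ s in (0 : ℝ)..t, c * ((c * s) ^ n / n.factorial * ‖y‖) := by
      refine intervalIntegral.norm_integral_le_of_norm_le t.2.1 ?_ ?_
      · refine Filter.Eventually.of_forall fun s hs => ?_
        have hs' : s ∈ Set.Icc (0 : ℝ) T := ⟨hs.1.le, hs.2.trans t.2.2⟩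
        rw [Set.IccExtend_of_mem hT _ hs']
        refine (hL _ _).trans ?_
        gcongr
        exact ih ⟨s, hs'⟩
      · exact Continuous.intervalIntegrable (by fun_prop) _ _
    refine h1.trans (le_of_eq ?_)
    have h2 : (fun s : ℝ => c * ((c * s) ^ n / n.factorial * ‖y‖)) =
        fun s => (c ^ (n + 1) / n.factorial * ‖y‖) * s ^ n := by
      funext s; rw [mul_pow]; ring
    rw [h2, intervalIntegral.integral_const_mul, integral_pow, Nat.factorial_succ]
    push_cast
    have : (n.factorial : ℝ) ≠ 0 := by positivity
    field_simp
    ring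

/-- A Volterra operator is quasi-nilpotent, so `1` minus it is invertible. -/
lemma isUnit_one_sub_integ_comp [CompleteSpace E] (hT : 0 ≤ T)
    (L : C(Set.Icc (0 : ℝ) T, E) →L[ℝ] C(Set.Icc (0 : ℝ) T, E)) {c : ℝ} (hc : 0 ≤ c)
    (hL : ∀ y t, ‖L y t‖ ≤ c * ‖y t‖) : IsUnit (1 - integ hT ∘L L) := by
  set K := integ hT ∘L L with hK
  have hlim := FloorSemiring.tendsto_pow_div_factorial_atTop (c * T)
  obtain ⟨n, hn⟩ := ((tendsto_order.1 hlim).2 1 one_pos).exists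
  have hnorm : ‖K ^ n‖ < 1 := by
    refine lt_of_le_of_lt ?_ hn
    refine ContinuousLinearMap.opNorm_le_bound _ (by positivity) fun y => ?_
    refine (ContinuousMap.norm_le _ (by positivity)).2 fun t => ?_
    refine (norm_integ_comp_pow_apply_le hT L hc hL n y t).trans ?_
    have := t.2.1
    gcongr
    exact t.2.2
  have h1 : IsUnit (1 - K ^ n) := isUnit_one_sub_of_norm_lt_one
    (R := C(Set.Icc (0 : ℝ) T, E) →L[ℝ] C(Set.Icc (0 : ℝ) T, E)) hnorm
  -- Some power of `K` has norm below `1`, and `1 - K ^ n` factors as `1 - K` times a commuting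
  -- geometric sum; a commuting factor of a unit is a unit.
  rw [← mul_neg_geom_sum K n] at h1
  have hcomm : Commute (1 - K) (∑ i ∈ Finset.range n, K ^ i) := by
    refine Commute.sum_right _ _ _ fun i _ => ?_
    exact ((Commute.one_left K).sub_left (Commute.refl K)).pow_right i
  exact (hcomm.isUnit_mul_iff.1 h1).1

/-- Constant paths, as a continuous linear map. -/
def constPath (T : ℝ) (E : Type*) [NormedAddCommGroup E] [NormedSpace ℝ E] :
    E →L[ℝ] C(Set.Icc (0 : ℝ) T, E) :=
  LinearMap.mkContinuous
    { toFun := fun v => ContinuousMap.const _ v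
      map_add' := fun _ _ => rfl
      map_smul' := fun _ _ => rfl } 1 fun v => by
    rw [one_mul]
    exact (ContinuousMap.norm_le _ (norm_nonneg _)).2 fun t => le_rfl

@[simp] lemma constPath_apply (v : E) (t : Set.Icc (0 : ℝ) T) : constPath T E v t = v := rfl

/-- A bounded bilinear map applied pointwise to paths. -/
def bilinPath (T : ℝ) (B : E →L[ℝ] E →L[ℝ] E) :
    C(Set.Icc (0 : ℝ) T, E) →L[ℝ] C(Set.Icc (0 : ℝ) T, E) →L[ℝ] C(Set.Icc (0 : ℝ) T, E) :=
  LinearMap.mkContinuous₂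
    (LinearMap.mk₂ ℝ
      (fun x y : C(Set.Icc (0 : ℝ) T, E) =>
        (⟨fun t => B (x t) (y t), by fun_prop⟩ : C(Set.Icc (0 : ℝ) T, E)))
      (fun _ _ _ => by ext t; simp) (fun _ _ _ => by ext t; simp)
      (fun _ _ _ => by ext t; simp) (fun _ _ _ => by ext t; simp)) ‖B‖ fun x y => by
    refine (ContinuousMap.norm_le _ (by positivity)).2 fun t => ?_
    refine (B.le_opNorm₂ _ _).trans ?_
    gcongr
    · exact x.norm_coe_le_norm t
    · exact y.norm_coe_le_norm t

@[simp] lemma bilinPath_apply (B : E →L[ℝ] E →L[ℝ] E) (x y : C(Set.Icc (0 : ℝ) T, E))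
    (t : Set.Icc (0 : ℝ) T) : bilinPath T B x y t = B (x t) (y t) := rfl

end PathSpace

namespace Model
variable {d dₒ : ℕ} (M : Model d dₒ) {T : ℝ}

/-- The vector field applied pointwise to paths. -/
def fieldPath (T : ℝ) (x : C(Set.Icc (0 : ℝ) T, Vec d)) : C(Set.Icc (0 : ℝ) T, Vec d) :=
  -(M.A.compLeftContinuous ℝ (Set.Icc (0 : ℝ) T)) x - bilinPath T M.B x x + constPath T _ M.f

/-- The difference quotient operator of `fieldPath` between `x` and `y`. -/
def fieldPathSlope (T : ℝ) (x y : C(Set.Icc (0 : ℝ) T, Vec d)) :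
    C(Set.Icc (0 : ℝ) T, Vec d) →L[ℝ] C(Set.Icc (0 : ℝ) T, Vec d) :=
  -(M.A.compLeftContinuous ℝ (Set.Icc (0 : ℝ) T)) - (bilinPath T M.B).flip x - bilinPath T M.B y

@[simp] lemma compLeft_apply (x : C(Set.Icc (0 : ℝ) T, Vec d)) (t : Set.Icc (0 : ℝ) T) :
    (M.A.compLeftContinuous ℝ (Set.Icc (0 : ℝ) T)) x t = M.A (x t) := rfl

lemma fieldPath_apply (x : C(Set.Icc (0 : ℝ) T, Vec d)) (t : Set.Icc (0 : ℝ) T) :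
    M.fieldPath T x t = M.field (x t) := by
  simp [fieldPath, field, -ContinuousLinearMap.compLeftContinuous_apply]

lemma fieldPath_sub (x y : C(Set.Icc (0 : ℝ) T, Vec d)) :
    M.fieldPath T x - M.fieldPath T y = M.fieldPathSlope T x y (x - y) := by
  ext1 t
  rw [ContinuousMap.sub_apply, fieldPath_apply, fieldPath_apply, field_sub]
  simp [fieldPathSlope, -ContinuousLinearMap.compLeftContinuous_apply]

lemma fieldPathSlope_apply_le (x y w : C(Set.Icc (0 : ℝ) T, Vec d)) (t : Set.Icc (0 : ℝ) T) :
    ‖M.fieldPathSlope T x y w t‖ ≤ (‖M.A‖ + ‖M.B‖ * ‖x‖ + ‖M.B‖ * ‖y‖) * ‖w t‖ := by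
  have h : M.fieldPathSlope T x y w t = -M.A (w t) - M.B (w t) (x t) - M.B (y t) (w t) := by
    simp [fieldPathSlope, -ContinuousLinearMap.compLeftContinuous_apply]
  rw [h]
  have h1 := M.A.le_opNorm (w t)
  have h2 := M.B.le_opNorm₂ (w t) (x t)
  have h3 := M.B.le_opNorm₂ (y t) (w t)
  have h4 := norm_sub_le (-M.A (w t) - M.B (w t) (x t)) (M.B (y t) (w t))
  have h5 := norm_sub_le (-M.A (w t)) (M.B (w t) (x t))
  rw [norm_neg] at h5
  have h6 : ‖M.B‖ * ‖w t‖ * ‖x t‖ ≤ ‖M.B‖ * ‖w t‖ * ‖x‖ := by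
    gcongr; exact x.norm_coe_le_norm t
  have h7 : ‖M.B‖ * ‖y t‖ * ‖w t‖ ≤ ‖M.B‖ * ‖y‖ * ‖w t‖ := by
    gcongr; exact y.norm_coe_le_norm t
  nlinarith

lemma contDiff_fieldPath : ContDiff ℝ 3 (M.fieldPath T) := by
  unfold fieldPath; fun_prop

lemma hasFDerivAt_fieldPath (x : C(Set.Icc (0 : ℝ) T, Vec d)) :
    HasFDerivAt (M.fieldPath T) (M.fieldPathSlope T x x) x := by
  have h1 := ((M.A.compLeftContinuous ℝ (Set.Icc (0 : ℝ) T)).hasFDerivAt (x := x)).neg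
  have h2 := (bilinPath T M.B).hasFDerivAt_of_bilinear (hasFDerivAt_id x) (hasFDerivAt_id x)
  refine ((h1.sub h2).add_const (constPath T _ M.f)).congr_fderiv ?_
  ext1 w
  simp [fieldPathSlope, -ContinuousLinearMap.compLeftContinuous_apply]
  abel

lemma isUnit_one_sub_slope (hT : 0 ≤ T) (x y : C(Set.Icc (0 : ℝ) T, Vec d)) :
    IsUnit (1 - integ hT ∘L M.fieldPathSlope T x y) :=
  isUnit_one_sub_integ_comp hT _ (by positivity) (M.fieldPathSlope_apply_le x y)

/-- The map whose value is the constant path `v` exactly on the trajectory started from `v`. -/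
def defect (hT : 0 ≤ T) (x : C(Set.Icc (0 : ℝ) T, Vec d)) : C(Set.Icc (0 : ℝ) T, Vec d) :=
  x - integ hT (M.fieldPath T x)

/-- By the exact increment formula, the difference of two paths with equal defect lies in the kernel
of `1` minus a Volterra operator. This global injectivity later identifies the local inverse of
`defect` with the true trajectory. -/
lemma defect_injective (hT : 0 ≤ T) : Function.Injective (M.defect hT) := by
  intro x y h
  have h1 : (1 - integ hT ∘L M.fieldPathSlope T x y) (x - y) = 0 := by
    have : (integ hT) (M.fieldPathSlope T x y (x - y)) =
        integ hT (M.fieldPath T x) - integ hT (M.fieldPath T y) := by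
      rw [← fieldPath_sub, map_sub]
    simp only [defect] at h
    simp only [sub_apply, one_apply_eq_self,
      ContinuousLinearMap.comp_apply, this]
    rw [sub_sub_sub_comm, h, sub_self]
  obtain ⟨a, ha⟩ := M.isUnit_one_sub_slope hT x y
  have h2 : (↑a⁻¹ * (1 - integ hT ∘L M.fieldPathSlope T x y)) (x - y) = 0 := by
    rw [mul_apply_eq_comp, h1, map_zero]
  rw [← ha, Units.inv_mul, one_apply_eq_self] at h2
  exact sub_eq_zero.1 h2

lemma contDiff_defect (hT : 0 ≤ T) : ContDiff ℝ 3 (M.defect hT) := by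
  have := M.contDiff_fieldPath (T := T)
  unfold defect; fun_prop

lemma hasFDerivAt_defect (hT : 0 ≤ T) (x : C(Set.Icc (0 : ℝ) T, Vec d)) :
    HasFDerivAt (M.defect hT) (1 - integ hT ∘L M.fieldPathSlope T x x) x :=
  (hasFDerivAt_id x).sub (HasFDerivAt.comp (g := integ hT) x (integ (E := Vec d) hT).hasFDerivAt
    (M.hasFDerivAt_fieldPath x))

open Classical in
/-- The trajectory on `[0, T]` started from `v`. -/
def path (T : ℝ) (v : Vec d) : C(Set.Icc (0 : ℝ) T, Vec d) :=
  if hv : v ∈ M.dom then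
    ⟨fun t => M.forward t v, by
      have h : ContinuousOn (fun t => M.forward t v) (Set.Ici 0) :=
        fun t ht => ((M.isSolution_forward hv).2 t ht).continuousWithinAt
      exact h.comp_continuous continuous_subtype_val fun t => t.2.1⟩
  else 0

lemma path_apply {v : Vec d} (hv : v ∈ M.dom) (t : Set.Icc (0 : ℝ) T) :
    M.path T v t = M.forward t v := by simp [path, hv]

/-- This is the integral form of the differential equation. -/
lemma defect_path (hT : 0 ≤ T) {v : Vec d} (hv : v ∈ M.dom) :
    M.defect hT (M.path T v) = constPath T _ v := by
  ext1 t
  have hsol := M.isSolution_forward hv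
  have hcont : ContinuousOn (fun t => M.forward t v) (Set.Ici 0) :=
    fun t ht => (hsol.2 t ht).continuousWithinAt
  have key : ∫ s in (0 : ℝ)..t, Set.IccExtend hT (M.fieldPath T (M.path T v)) s =
      M.forward t v - M.forward 0 v := by
    refine intervalIntegral.integral_eq_sub_of_hasDeriv_right (f := fun s => M.forward s v)
      ?_ ?_ ?_
    · rw [Set.uIcc_of_le t.2.1]
      exact hcont.mono Set.Icc_subset_Ici_self
    · intro s hs
      rw [min_eq_left t.2.1, max_eq_right t.2.1] at hs
      have hs' : s ∈ Set.Icc (0 : ℝ) T := ⟨hs.1.le, hs.2.le.trans t.2.2⟩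
      rw [Set.IccExtend_of_mem hT _ hs', fieldPath_apply, path_apply _ hv]
      exact (hsol.2 s hs.1.le).mono fun r hr => hs.1.le.trans (le_of_lt hr)
    · exact ((M.fieldPath T (M.path T v)).continuous.Icc_extend' (h := hT)).intervalIntegrable _ _
  simp only [defect, ContinuousMap.sub_apply, integ_apply, key, path_apply _ hv, constPath_apply,
    M.forward_zero hv, sub_sub_cancel]

/-- The trajectory depends smoothly on the initial point, uniformly in time. -/
lemma contDiffAt_path (hT : 0 ≤ T) {v : Vec d} (hv : v ∈ M.dom) :
    ContDiffAt ℝ 3 (M.path T) v := by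
  -- Inverse function theorem for `defect`: its derivative is invertible, so the local inverse
  -- applied to constant paths is `C³`.
  obtain ⟨a, ha⟩ := M.isUnit_one_sub_slope hT (M.path T v) (M.path T v)
  let e := ContinuousLinearEquiv.unitsEquiv ℝ (C(Set.Icc (0 : ℝ) T, Vec d)) a
  have he : HasFDerivAt (M.defect hT)
      (e : C(Set.Icc (0 : ℝ) T, Vec d) →L[ℝ] C(Set.Icc (0 : ℝ) T, Vec d)) (M.path T v) := by
    have : (e : C(Set.Icc (0 : ℝ) T, Vec d) →L[ℝ] C(Set.Icc (0 : ℝ) T, Vec d)) = a.1 := by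
      ext1 w; rfl
    rw [this, ha]
    exact M.hasFDerivAt_defect hT _
  have hcd : ContDiffAt ℝ 3 (M.defect hT) (M.path T v) := (M.contDiff_defect hT).contDiffAt
  have hloc := hcd.to_localInverse he (by norm_num)
  rw [M.defect_path hT hv] at hloc
  have hcomp : ContDiffAt ℝ 3 (fun w => hcd.localInverse he (by norm_num) (constPath T _ w)) v :=
    hloc.comp v (constPath T (Vec d)).contDiff.contDiffAt
  -- Near `v` the local inverse and `path` have the same defect, a constant path, and so agree by
  -- injectivity.
  refine hcomp.congr_of_eventuallyEq ?_
  have hst := hcd.hasStrictFDerivAt' he (by norm_num)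
  have hr := hst.eventually_right_inverse
  rw [M.defect_path hT hv] at hr
  have hr' := (constPath T (Vec d)).continuous.continuousAt.eventually hr
  filter_upwards [hr', M.isOpen_dom.mem_nhds hv] with w hw hwd
  apply M.defect_injective hT
  rw [M.defect_path hT hwd]
  exact hw.symm

lemma contDiffOn_path (hT : 0 ≤ T) : ContDiffOn ℝ 3 (M.path T) M.dom :=
  fun _ hv => (M.contDiffAt_path hT hv).contDiffWithinAt

/-- The trajectory is recovered linearly from its initial point and its velocity. -/
def initVelocity (T : ℝ) (v : Vec d) : Vec d × C(Set.Icc (0 : ℝ) T, Vec d) :=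
  (v, M.fieldPath T (M.path T v))

lemma contDiffOn_initVelocity (hT : 0 ≤ T) : ContDiffOn ℝ 3 (M.initVelocity T) M.dom :=
  contDiffOn_id.prodMk (M.contDiff_fieldPath.comp_contDiffOn (M.contDiffOn_path hT))

end Model

/-- The path with given initial point and velocity. -/
def pathOfVelocity {E : Type*} [NormedAddCommGroup E] [NormedSpace ℝ E] {T : ℝ} (hT : 0 ≤ T) :
    E × C(Set.Icc (0 : ℝ) T, E) →L[ℝ] C(Set.Icc (0 : ℝ) T, E) :=
  (constPath T E).coprod (integ hT)

lemma Model.pathOfVelocity_initVelocity {d dₒ : ℕ} (M : Model d dₒ) {T : ℝ} (hT : 0 ≤ T)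
    {v : Vec d} (hv : v ∈ M.dom) :
    pathOfVelocity hT (M.initVelocity T v) = M.path T v := by
  have := M.defect_path hT hv
  simp only [Model.defect] at this
  simp only [pathOfVelocity, Model.initVelocity, ContinuousLinearMap.coprod_apply, ← this]
  abel

end GaussFilter
end

/-! ### Taylor estimates and the dictionary between Jacobian matrices and derivatives. -/

noncomputable section
open MeasureTheory ProbabilityTheory
namespace GaussFilter

section Calculus
variable {E F : Type*} [NormedAddCommGroup E] [NormedSpace ℝ E] [NormedAddCommGroup F]
  [NormedSpace ℝ F]

lemma exists_norm_fderiv_le {g : E → F} {U K : Set E} (hU : IsOpen U) (hg : ContDiffOn ℝ 1 g U)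
    (hK : IsCompact K) (hKU : K ⊆ U) : ∃ C, 0 ≤ C ∧ ∀ v ∈ K, ‖fderiv ℝ g v‖ ≤ C := by
  have h1 : ContinuousOn (fun v => ‖fderiv ℝ g v‖) K :=
    ((hg.continuousOn_fderiv_of_isOpen hU le_rfl).mono hKU).norm
  obtain ⟨C, hC⟩ := hK.bddAbove_image h1
  exact ⟨max C 0, le_max_right _ _, fun v hv => (hC ⟨v, hv, rfl⟩).trans (le_max_left _ _)⟩

lemma exists_lipschitz {g : E → F} {U K : Set E} (hU : IsOpen U) (hg : ContDiffOn ℝ 1 g U)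
    (hK : IsCompact K) (hKc : Convex ℝ K) (hKU : K ⊆ U) :
    ∃ C, 0 ≤ C ∧ ∀ v ∈ K, ∀ w ∈ K, ‖g v - g w‖ ≤ C * ‖v - w‖ := by
  obtain ⟨C, hC0, hC⟩ := exists_norm_fderiv_le hU hg hK hKU
  refine ⟨C, hC0, fun v hv w hw => ?_⟩
  refine Convex.norm_image_sub_le_of_norm_hasFDerivWithin_le (f' := fderiv ℝ g) (fun x hx => ?_)
    hC hKc hw hv
  exact ((hg.contDiffAt (hU.mem_nhds (hKU hx))).differentiableAt
    one_ne_zero).hasFDerivAt.hasFDerivWithinAt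

lemma exists_taylor_one {g : E → F} {U K : Set E} (hU : IsOpen U) (hg : ContDiffOn ℝ 2 g U)
    (hK : IsCompact K) (hKc : Convex ℝ K) (hKU : K ⊆ U) :
    ∃ C, 0 ≤ C ∧ ∀ v ∈ K, ∀ w ∈ K, ‖g v - g w - fderiv ℝ g w (v - w)‖ ≤ C * ‖v - w‖ ^ 2 := by
  obtain ⟨C, hC0, hC⟩ := exists_lipschitz hU (hg.fderiv_of_isOpen hU (m := 1) (by norm_num))
    hK hKc hKU
  refine ⟨C, hC0, fun v hv w hw => ?_⟩
  have hseg : segment ℝ w v ⊆ K := hKc.segment_subset hw hv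
  have := Convex.norm_image_sub_le_of_norm_hasFDerivWithin_le' (f := g) (f' := fderiv ℝ g)
    (φ := fderiv ℝ g w) (C := C * ‖v - w‖) (s := segment ℝ w v) (x := w) (y := v)
    (fun x hx => ?_) (fun x hx => ?_) (convex_segment w v) (left_mem_segment ℝ w v)
    (right_mem_segment ℝ w v)
  · linarith
  · exact ((hg.contDiffAt (hU.mem_nhds (hKU (hseg hx)))).differentiableAt
      two_ne_zero).hasFDerivAt.hasFDerivWithinAt
  · refine (hC x (hseg hx) w hw).trans ?_
    gcongr
    exact norm_sub_le_of_mem_segment hx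

lemma exists_taylor_two {g : E → F} {U K : Set E} (hU : IsOpen U) (hg : ContDiffOn ℝ 3 g U)
    (hK : IsCompact K) (hKc : Convex ℝ K) (hKU : K ⊆ U) :
    ∃ C, 0 ≤ C ∧ ∀ v ∈ K, ∀ w ∈ K,
      ‖g v - g w - fderiv ℝ g w (v - w) - (1 / 2 : ℝ) • fderiv ℝ (fderiv ℝ g) w (v - w) (v - w)‖ ≤
        C * ‖v - w‖ ^ 3 := by
  obtain ⟨C, hC0, hC⟩ := exists_taylor_one hU (hg.fderiv_of_isOpen hU (m := 2) (by norm_num))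
    hK hKc hKU
  refine ⟨C, hC0, fun v hv w hw => ?_⟩
  have hseg : segment ℝ w v ⊆ K := hKc.segment_subset hw hv
  set D := fderiv ℝ (fderiv ℝ g) w with hD
  have hsymm : ∀ a b, D a b = D b a :=
    (hg.contDiffAt (hU.mem_nhds (hKU hw))).isSymmSndFDerivAt (by simp; norm_num)
  -- Subtracting half the second-order form leaves a function whose derivative is `fderiv ℝ g x - D
  -- (x - w)`, by symmetry of `D`. The first-order Taylor bound for `fderiv ℝ g` makes this
  -- quadratically close to `fderiv ℝ g w`, and the mean value inequality gives one more power.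
  have hder : ∀ x ∈ segment ℝ w v,
      HasFDerivAt (fun y => g y - (1 / 2 : ℝ) • D (y - w) (y - w))
        (fderiv ℝ g x - D (x - w)) x := by
    intro x hx
    have h1 : HasFDerivAt g (fderiv ℝ g x) x :=
      ((hg.contDiffAt (hU.mem_nhds (hKU (hseg hx)))).differentiableAt three_ne_zero).hasFDerivAt
    have hid : HasFDerivAt (fun y => y - w) (ContinuousLinearMap.id ℝ E) x :=
      (hasFDerivAt_id x).sub_const w
    have h2 := D.hasFDerivAt_of_bilinear hid hid
    refine (h1.sub (h2.const_smul (1 / 2 : ℝ))).congr_fderiv ?_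
    ext a
    simp only [sub_apply, smul_apply, add_apply, ContinuousLinearMap.precompR_apply,
      ContinuousLinearMap.precompL_apply, ContinuousLinearMap.id_apply,
      ContinuousLinearMap.compL_apply, ContinuousLinearMap.comp_apply]
    rw [hsymm a (x - w), ← two_smul ℝ, smul_smul]
    norm_num
  have := Convex.norm_image_sub_le_of_norm_hasFDerivWithin_le'
    (φ := fderiv ℝ g w) (C := C * ‖v - w‖ ^ 2) (s := segment ℝ w v) (x := w) (y := v)
    (fun x hx => (hder x hx).hasFDerivWithinAt) (fun x hx => ?_) (convex_segment w v)
    (left_mem_segment ℝ w v) (right_mem_segment ℝ w v)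
  · simp only [sub_self, map_zero, smul_zero, sub_zero] at this
    rw [show g v - g w - fderiv ℝ g w (v - w) - (1 / 2 : ℝ) • D (v - w) (v - w) =
      g v - (1 / 2 : ℝ) • D (v - w) (v - w) - g w - fderiv ℝ g w (v - w) by abel]
    linarith
  · have h1 := hC x (hseg hx) w hw
    rw [show fderiv ℝ g x - D (x - w) - fderiv ℝ g w = fderiv ℝ g x - fderiv ℝ g w - D (x - w) by
      abel]
    refine h1.trans ?_
    gcongr
    exact norm_sub_le_of_mem_segment hx

lemma fderiv_clm_comp {X Y : Type*} [NormedAddCommGroup X] [NormedSpace ℝ X] [NormedAddCommGroup Y]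
    [NormedSpace ℝ Y] (L : X →L[ℝ] Y) {g : E → X} {v : E} (hg : DifferentiableAt ℝ g v) :
    fderiv ℝ (fun w => L (g w)) v = L ∘L fderiv ℝ g v :=
  (L.hasFDerivAt.comp v hg.hasFDerivAt).fderiv

lemma fderiv_fderiv_clm_comp {X Y : Type*} [NormedAddCommGroup X] [NormedSpace ℝ X]
    [NormedAddCommGroup Y] [NormedSpace ℝ Y] (L : X →L[ℝ] Y) {g : E → X} {v : E}
    (hg : ContDiffAt ℝ 2 g v) (a b : E) :
    fderiv ℝ (fderiv ℝ fun w => L (g w)) v a b = L (fderiv ℝ (fderiv ℝ g) v a b) := by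
  have h1 : fderiv ℝ (fun w => L (g w)) =ᶠ[nhds v] fun w => L ∘L fderiv ℝ g w := by
    filter_upwards [hg.eventually (by simp)] with w hw
    exact fderiv_clm_comp L (hw.differentiableAt two_ne_zero)
  rw [h1.fderiv_eq]
  have h2 : DifferentiableAt ℝ (fderiv ℝ g) v :=
    (hg.fderiv_right (m := 1) (by norm_num)).differentiableAt one_ne_zero
  have h3 := fderiv_clm_comp (ContinuousLinearMap.compL ℝ E X Y L) h2
  have h4 : (fun w => L ∘L fderiv ℝ g w) =
      fun w => (ContinuousLinearMap.compL ℝ E X Y L) (fderiv ℝ g w) := rfl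
  rw [h4, h3]
  rfl

end Calculus

section Jacobians
variable {m n : ℕ}

lemma sum_ofLp_smul_single (x : Vec m) : ∑ j, x j • EuclideanSpace.single j (1 : ℝ) = x := by
  have := (EuclideanSpace.basisFun (Fin m) ℝ).sum_repr x
  simpa using this

lemma jac_mulVec (g : Vec m → Vec n) (v y : Vec m) :
    (jac g v).mulVec y.ofLp = (fderiv ℝ g v y).ofLp := by
  funext i
  conv_rhs => rw [← sum_ofLp_smul_single y]
  simp [jac, Matrix.mulVec, dotProduct, mul_comm]

lemma inner_eq_dotProduct (x y : Vec m) : inner ℝ x y = dotProduct x.ofLp y.ofLp := by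
  rw [EuclideanSpace.inner_eq_star_dotProduct, dotProduct_comm]
  simp

/-- With this and the next lemma, all estimates on `Ak` and `Bk` can be made on bilinear and linear
forms of Fréchet derivatives. -/
lemma dotProduct_jac₂_mulVec (g : Vec m → Vec n) (v : Vec m) (z : Vec n) (x y : Vec m) :
    dotProduct x.ofLp ((jac₂ g v z).mulVec y.ofLp) =
      inner ℝ (fderiv ℝ (fderiv ℝ g) v x y) z := by
  have h : fderiv ℝ (fderiv ℝ g) v x y = ∑ i, ∑ j, (x i * y j) •
      fderiv ℝ (fderiv ℝ g) v (EuclideanSpace.single i 1) (EuclideanSpace.single j 1) := by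
    conv_lhs => rw [← sum_ofLp_smul_single x, ← sum_ofLp_smul_single y]
    simp only [map_sum, map_smul, sum_apply, smul_apply, Finset.smul_sum, smul_smul]
    rw [Finset.sum_comm]
    simp only [mul_comm]
  rw [h, sum_inner]
  simp only [sum_inner, inner_smul_left, inner_eq_dotProduct]
  simp only [dotProduct, Matrix.mulVec, jac₂, Matrix.of_apply, Finset.mul_sum, Finset.sum_mul]
  refine Finset.sum_congr rfl fun i _ => Finset.sum_congr rfl fun j _ =>
    Finset.sum_congr rfl fun l _ => ?_
  simp
  ring

lemma dotProduct_jac_transpose_mulVec (g : Vec m → Vec n) (v x : Vec m) (z : Vec n) :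
    dotProduct x.ofLp ((jac g v).transpose.mulVec z.ofLp) = inner ℝ (fderiv ℝ g v x) z := by
  rw [inner_eq_dotProduct, ← jac_mulVec, Matrix.dotProduct_mulVec, Matrix.vecMul_transpose]

end Jacobians

/-! ### Observations and noise as linear functionals of initial point and velocity. -/

namespace Model
variable {d dₒ : ℕ} (M : Model d dₒ) {T : ℝ}

/-- Observation at time `t`, as a linear functional of initial point and velocity. -/
def obsAt (hT : 0 ≤ T) (t : ℝ) : Vec d × C(Set.Icc (0 : ℝ) T, Vec d) →L[ℝ] Vec dₒ :=
  M.H ∘L ContinuousMap.evalCLM ℝ (Set.projIcc 0 T hT t) ∘L pathOfVelocity hT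

/-- All nonlinearity sits in one map independent of `t`; the time enters through a linear functional
of uniformly bounded norm. Hence derivative and Taylor bounds hold uniformly over the grid. -/
lemma Phi_eq_obsAt (hT : 0 ≤ T) {t : ℝ} (ht : t ∈ Set.Icc 0 T) {v : Vec d} (hv : v ∈ M.dom) :
    M.Φ t v = M.obsAt hT t (M.initVelocity T v) := by
  simp only [obsAt, ContinuousLinearMap.comp_apply, M.pathOfVelocity_initVelocity hT hv, Φ,
    M.Psi_of_nonneg ht.1, ContinuousMap.evalCLM_apply, M.path_apply hv, Set.projIcc_of_mem hT ht]

lemma Psi_eq_eval {t : ℝ} (ht : t ∈ Set.Icc 0 T) {v : Vec d} (hv : v ∈ M.dom) :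
    M.Ψ t v = ContinuousMap.evalCLM ℝ (⟨t, ht⟩ : Set.Icc 0 T) (M.path T v) := by
  rw [M.Psi_of_nonneg ht.1, ContinuousMap.evalCLM_apply, M.path_apply hv]

lemma contDiffOn_Psi (hT : 0 ≤ T) : ContDiffOn ℝ 3 (M.Ψ T) M.dom :=
  (ContDiff.comp_contDiffOn (g := ContinuousMap.evalCLM ℝ (⟨T, hT, le_rfl⟩ : Set.Icc 0 T))
    (ContinuousLinearMap.contDiff _) (M.contDiffOn_path hT)).congr fun _ hv =>
      M.Psi_eq_eval ⟨hT, le_rfl⟩ hv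

lemma norm_obsAt_le (hT : 0 ≤ T) (t : ℝ) :
    ‖M.obsAt hT t‖ ≤ ‖M.H‖ * ‖pathOfVelocity (E := Vec d) hT‖ := by
  refine ContinuousLinearMap.opNorm_le_bound _ (by positivity) fun x => ?_
  refine (M.H.le_opNorm _).trans ?_
  rw [mul_assoc]
  gcongr
  exact ((pathOfVelocity hT x).norm_coe_le_norm _).trans ((pathOfVelocity hT).le_opNorm x)

lemma contDiffAt_initVelocity (hT : 0 ≤ T) {v : Vec d} (hv : v ∈ M.dom) :
    ContDiffAt ℝ 3 (M.initVelocity T) v :=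
  (M.contDiffOn_initVelocity hT).contDiffAt (M.isOpen_dom.mem_nhds hv)

lemma Phi_eventuallyEq (hT : 0 ≤ T) {t : ℝ} (ht : t ∈ Set.Icc 0 T) {v : Vec d} (hv : v ∈ M.dom) :
    M.Φ t =ᶠ[nhds v] fun w => M.obsAt hT t (M.initVelocity T w) := by
  filter_upwards [M.isOpen_dom.mem_nhds hv] with w hw using M.Phi_eq_obsAt hT ht hw

lemma fderiv_Phi (hT : 0 ≤ T) {t : ℝ} (ht : t ∈ Set.Icc 0 T) {v : Vec d} (hv : v ∈ M.dom) :
    fderiv ℝ (M.Φ t) v = M.obsAt hT t ∘L fderiv ℝ (M.initVelocity T) v := by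
  rw [(M.Phi_eventuallyEq hT ht hv).fderiv_eq]
  exact fderiv_clm_comp _ ((M.contDiffAt_initVelocity hT hv).differentiableAt three_ne_zero)

lemma fderiv_fderiv_Phi (hT : 0 ≤ T) {t : ℝ} (ht : t ∈ Set.Icc 0 T) {v : Vec d} (hv : v ∈ M.dom)
    (a b : Vec d) : fderiv ℝ (fderiv ℝ (M.Φ t)) v a b =
      M.obsAt hT t (fderiv ℝ (fderiv ℝ (M.initVelocity T)) v a b) := by
  rw [(M.Phi_eventuallyEq hT ht hv).fderiv.fderiv_eq]
  exact fderiv_fderiv_clm_comp _ ((M.contDiffAt_initVelocity hT hv).of_le (by norm_num)) a b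

/-- The pairing of the observed trajectory with the noise, as a functional of initial point and
velocity. -/
def noiseFun (hT : 0 ≤ T) (h : ℝ) (k : ℕ) (z : ℕ → Vec dₒ) :
    Vec d × C(Set.Icc (0 : ℝ) T, Vec d) →L[ℝ] ℝ :=
  ∑ i ∈ Finset.range (k + 1), innerSL ℝ (z i) ∘L M.obsAt hT (i * h)

lemma noiseFun_apply (hT : 0 ≤ T) (h : ℝ) (k : ℕ) (z : ℕ → Vec dₒ)
    (x : Vec d × C(Set.Icc (0 : ℝ) T, Vec d)) :
    M.noiseFun hT h k z x = ∑ i ∈ Finset.range (k + 1), inner ℝ (z i) (M.obsAt hT (i * h) x) := by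
  simp [noiseFun]

lemma grid_mem {h : ℝ} {k i : ℕ} (hh : 0 < h) (hk : T = k * h) (hi : i ∈ Finset.range (k + 1)) :
    (i : ℝ) * h ∈ Set.Icc 0 T := by
  have : (i : ℝ) ≤ k := by exact_mod_cast Nat.lt_succ_iff.1 (Finset.mem_range.1 hi)
  exact ⟨by positivity, by rw [hk]; gcongr⟩

variable {h : ℝ} {k : ℕ} {z : ℕ → Vec dₒ}

/-- The random part of `Ak` is the noise functional evaluated at a second derivative, so no separate
concentration bound for a random matrix is needed. -/
lemma dotProduct_Ak_mulVec (hT : 0 ≤ T) (hh : 0 < h) (hk : T = k * h) {u : Vec d} (hu : u ∈ M.dom)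
    (x y : Vec d) :
    dotProduct x.ofLp ((M.Ak u h k z).mulVec y.ofLp) =
      ∑ i ∈ Finset.range (k + 1), inner ℝ (M.obsAt hT (i * h) (fderiv ℝ (M.initVelocity T) u x))
        (M.obsAt hT (i * h) (fderiv ℝ (M.initVelocity T) u y)) -
      M.noiseFun hT h k z (fderiv ℝ (fderiv ℝ (M.initVelocity T)) u x y) := by
  rw [Ak, Matrix.sum_mulVec, dotProduct_sum, noiseFun_apply, ← Finset.sum_sub_distrib]
  refine Finset.sum_congr rfl fun i hi => ?_
  have ht := grid_mem hh hk hi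
  rw [Matrix.sub_mulVec, dotProduct_sub, dotProduct_jac₂_mulVec, ← Matrix.mulVec_mulVec, jac_mulVec,
    dotProduct_jac_transpose_mulVec, M.fderiv_fderiv_Phi hT ht hu, M.fderiv_Phi hT ht hu,
    real_inner_comm (z i)]
  rfl

lemma dotProduct_Bk (hT : 0 ≤ T) (hh : 0 < h) (hk : T = k * h) {u : Vec d} (hu : u ∈ M.dom)
    (x : Vec d) :
    dotProduct x.ofLp (M.Bk u h k z) = M.noiseFun hT h k z (fderiv ℝ (M.initVelocity T) u x) := by
  rw [Bk, dotProduct_sum, noiseFun_apply]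
  refine Finset.sum_congr rfl fun i hi => ?_
  have ht := grid_mem hh hk hi
  rw [dotProduct_jac_transpose_mulVec, M.fderiv_Phi hT ht hu, real_inner_comm]
  rfl

/-- The sum of the noise from time index `j` on. -/
def tailSum (k : ℕ) (z : ℕ → Vec dₒ) (j : ℕ) : Vec dₒ := ∑ i ∈ Finset.Ico j (k + 1), z i

/-- The size of the noise that controls `noiseFun`. -/
def noiseSize (k : ℕ) (z : ℕ → Vec dₒ) : ℝ :=
  ‖tailSum k z 0‖ + (k : ℝ)⁻¹ * ∑ j ∈ Finset.range k, ‖tailSum k z (j + 1)‖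

lemma noiseSize_nonneg : 0 ≤ noiseSize k z := by unfold noiseSize; positivity

/-- Writing the path as its initial value plus increments over grid cells prepares the summation by
parts; each increment is of size `h`. -/
lemma obsAt_apply_eq_sum (hT : 0 ≤ T) (hh : 0 < h) (hk : T = k * h)
    (x : Vec d × C(Set.Icc (0 : ℝ) T, Vec d)) {i : ℕ} (hi : i ∈ Finset.range (k + 1)) :
    M.obsAt hT (i * h) x = M.H x.1 + ∑ j ∈ Finset.range i,
      M.H (∫ s in ((j : ℕ) * h : ℝ)..((j + 1 : ℕ) * h : ℝ), Set.IccExtend hT x.2 s) := by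
  have ht := grid_mem hh hk hi
  have h1 : (pathOfVelocity hT x) (Set.projIcc 0 T hT (i * h)) =
      x.1 + ∫ s in (0 : ℝ)..(i * h : ℝ), Set.IccExtend hT x.2 s := by
    simp [pathOfVelocity, integ_apply, Set.projIcc_of_mem hT ht]
  simp only [obsAt, ContinuousLinearMap.comp_apply, ContinuousMap.evalCLM_apply]
  rw [h1, map_add, ← map_sum]
  congr 2
  have := intervalIntegral.sum_integral_adjacent_intervals (f := Set.IccExtend hT x.2)
    (μ := volume) (a := fun j : ℕ => (j : ℝ) * h) (n := i)
    (fun j _ => (x.2.continuous.Icc_extend' (h := hT)).intervalIntegrable _ _)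
  simp only [Nat.cast_zero, zero_mul] at this
  rw [← this]

/-- Summation by parts: the noise functional is controlled by the tail sums of the noise. -/
lemma norm_noiseFun_le (hT : 0 ≤ T) (hh : 0 < h) (hk : T = k * h) :
    ‖M.noiseFun hT h k z‖ ≤ ‖M.H‖ * (1 + T) * noiseSize k z := by
  have hns := noiseSize_nonneg (k := k) (z := z)
  refine ContinuousLinearMap.opNorm_le_bound _ (by positivity) fun x => ?_
  set J : ℕ → Vec d := fun j =>
    ∫ s in ((j : ℕ) * h : ℝ)..((j + 1 : ℕ) * h : ℝ), Set.IccExtend hT x.2 s with hJ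
  have hJn : ∀ j, ‖J j‖ ≤ h * ‖x.2‖ := by
    intro j
    have h1 : ‖J j‖ ≤ ‖x.2‖ * |((j + 1 : ℕ) * h : ℝ) - (j : ℕ) * h| :=
      intervalIntegral.norm_integral_le_of_norm_le_const fun s _ => x.2.norm_coe_le_norm _
    rw [show ((j + 1 : ℕ) * h : ℝ) - (j : ℕ) * h = h by push_cast; ring, abs_of_pos hh] at h1
    linarith
  -- The increment over cell `j` is seen by exactly the observations `i ≥ j + 1`, so after
  -- exchanging the sums it is paired with the tail from `j + 1`.
  have e : M.noiseFun hT h k z x = inner ℝ (tailSum k z 0) (M.H x.1) +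
      ∑ j ∈ Finset.range k, inner ℝ (tailSum k z (j + 1)) (M.H (J j)) := by
    rw [noiseFun_apply, Finset.sum_congr rfl fun i hi => by
      rw [M.obsAt_apply_eq_sum hT hh hk x hi, inner_add_right, inner_sum]]
    rw [Finset.sum_add_distrib]
    congr 1
    · rw [tailSum, sum_inner, Nat.Ico_zero_eq_range]
    · simp only [tailSum, sum_inner]
      refine Finset.sum_comm' fun i j => ?_
      simp only [Finset.mem_range, Finset.mem_Ico]
      omega
  rw [e]
  have b1 : ‖(inner ℝ (tailSum k z 0) (M.H x.1) : ℝ)‖ ≤ ‖tailSum k z 0‖ * (‖M.H‖ * ‖x‖) := by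
    refine (norm_inner_le_norm _ _).trans ?_
    gcongr
    exact (M.H.le_opNorm _).trans (by gcongr; exact norm_fst_le x)
  have b2 : ‖∑ j ∈ Finset.range k, (inner ℝ (tailSum k z (j + 1)) (M.H (J j)) : ℝ)‖ ≤
      ∑ j ∈ Finset.range k, ‖tailSum k z (j + 1)‖ * (‖M.H‖ * (h * ‖x‖)) := by
    refine norm_sum_le_of_le _ fun j _ => (norm_inner_le_norm _ _).trans ?_
    gcongr
    refine (M.H.le_opNorm _).trans ?_
    gcongr
    refine (hJn j).trans ?_
    gcongr
    exact norm_snd_le x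
  rw [← Finset.sum_mul] at b2
  refine (norm_add_le _ _).trans ((add_le_add b1 b2).trans ?_)
  rw [noiseSize]
  set S := ∑ j ∈ Finset.range k, ‖tailSum k z (j + 1)‖ with hS
  have hS0 : 0 ≤ S := by positivity
  rcases Nat.eq_zero_or_pos k with rfl | hkpos
  · simp only [hS, Finset.range_zero, Finset.sum_empty, zero_mul, mul_zero, add_zero]
    have : 0 ≤ T * (‖tailSum 0 z 0‖ * (‖M.H‖ * ‖x‖)) := by positivity
    nlinarith
  · have hkR : (0 : ℝ) < k := by exact_mod_cast hkpos
    have hh' : h = T * (k : ℝ)⁻¹ := by rw [hk]; field_simp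
    rw [hh']
    have q1 : 0 ≤ T * ‖tailSum k z 0‖ * (‖M.H‖ * ‖x‖) := by positivity
    have q2 : 0 ≤ (k : ℝ)⁻¹ * S * (‖M.H‖ * ‖x‖) := by positivity
    nlinarith

end Model
end GaussFilter
end

/-! ### Gaussian tails of the noise size. -/

noncomputable section
open MeasureTheory ProbabilityTheory
namespace GaussFilter

section Noise
variable {n : ℕ}

/-- The sum is at most `n` times its largest term. Only one-coordinate exponentials remain, and the
summand `1` covers `n = 0`. -/
lemma exp_sum_le (a : Fin n → ℝ) : Real.exp (∑ l, a l) ≤ 1 + ∑ l, Real.exp (n * a l) := by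
  rcases isEmpty_or_nonempty (Fin n) with hn | hn
  · simp
  · obtain ⟨l, -, hl⟩ := Finset.exists_max_image Finset.univ a Finset.univ_nonempty
    have h1 : ∑ j, a j ≤ n * a l := by
      have := Finset.sum_le_card_nsmul Finset.univ a (a l) hl
      simpa using this
    have h2 : Real.exp (n * a l) ≤ ∑ j, Real.exp (n * a j) :=
      Finset.single_le_sum (f := fun j => Real.exp (n * a j)) (fun j _ => (Real.exp_pos _).le)
        (Finset.mem_univ l)
    linarith [Real.exp_le_exp.2 h1]

lemma norm_le_sum_abs (x : Vec n) : ‖x‖ ≤ ∑ l, |x l| := by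
  conv_lhs => rw [← sum_ofLp_smul_single x]
  refine (norm_sum_le _ _).trans (le_of_eq ?_)
  simp [norm_smul]

/-- An exponential majorant of `exp (t ‖x‖)` with explicit Gaussian integrals. -/
def expMajorant (t : ℝ) (x : Vec n) : ℝ :=
  1 + ∑ l, (Real.exp (n * t * x l) + Real.exp (-(n * t) * x l))

lemma expMajorant_nonneg (t : ℝ) (x : Vec n) : 0 ≤ expMajorant t x := by
  unfold expMajorant; positivity

lemma exp_mul_norm_le {t : ℝ} (ht : 0 ≤ t) (x : Vec n) :
    Real.exp (t * ‖x‖) ≤ expMajorant t x := by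
  have h1 : t * ‖x‖ ≤ ∑ l, t * |x l| := by
    rw [← Finset.mul_sum]; gcongr; exact norm_le_sum_abs x
  refine (Real.exp_le_exp.2 h1).trans ((exp_sum_le _).trans ?_)
  unfold expMajorant
  gcongr with l
  rcases abs_cases (x l) with ⟨h, -⟩ | ⟨h, -⟩
  · rw [h, ← mul_assoc]; linarith [Real.exp_pos (-(n * t) * x l)]
  · rw [h, show (n : ℝ) * (t * -x l) = -(n * t) * x l by ring]
    linarith [Real.exp_pos (n * t * x l)]

/-- Jensen's inequality. The tail sums are dependent, but after this only their individual
exponential moments matter. -/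
lemma exp_average_le {k : ℕ} (hk : 0 < k) (a : ℕ → ℝ) :
    Real.exp ((k : ℝ)⁻¹ * ∑ j ∈ Finset.range k, a j) ≤
      (k : ℝ)⁻¹ * ∑ j ∈ Finset.range k, Real.exp (a j) := by
  have := convexOn_exp.map_sum_le (t := Finset.range k) (w := fun _ => (k : ℝ)⁻¹) (p := a)
    (fun _ _ => by positivity) (by simp; field_simp) (fun _ _ => trivial)
  simpa [Finset.mul_sum] using this

lemma exp_add_le (a b : ℝ) : Real.exp (a + b) ≤ Real.exp (2 * a) + Real.exp (2 * b) := by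
  have h1 : Real.exp (2 * a) = Real.exp a ^ 2 := by rw [sq, ← Real.exp_add]; ring_nf
  have h2 : Real.exp (2 * b) = Real.exp b ^ 2 := by rw [sq, ← Real.exp_add]; ring_nf
  rw [Real.exp_add, h1, h2]
  nlinarith [sq_nonneg (Real.exp a - Real.exp b), sq_nonneg (Real.exp a), sq_nonneg (Real.exp b)]

variable {Ω : Type*} [MeasurableSpace Ω] {P : Measure Ω} {Z : ℕ → Ω → Vec n} {σ : ℝ}

lemma hasSubgaussianMGF_coord {X : Ω → Vec n} (hX : HasLaw X (noiseLaw n σ) P) (l : Fin n) :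
    HasSubgaussianMGF (fun ω => X ω l) (σ ^ 2).toNNReal P := by
  have h1 : MeasurePreserving (fun x : Vec n => x l) (noiseLaw n σ)
      (gaussianReal 0 (σ ^ 2).toNNReal) := by
    refine ⟨by fun_prop, ?_⟩
    rw [noiseLaw, Measure.map_map (by fun_prop) (by fun_prop)]
    exact (measurePreserving_eval (fun _ : Fin n => gaussianReal 0 (σ ^ 2).toNNReal) l).map_eq
  have h2 : HasLaw (fun ω => X ω l) (gaussianReal 0 (σ ^ 2).toNNReal) P := h1.hasLaw.comp hX
  refine ⟨fun t => ?_, fun t => ?_⟩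
  · have h3 : Integrable (fun x => Real.exp (t * x)) (gaussianReal 0 (σ ^ 2).toNNReal) :=
      integrable_exp_mul_gaussianReal t
    rw [← h2.map_eq] at h3
    exact h3.comp_aemeasurable h2.aemeasurable
  · rw [mgf_gaussianReal h2.map_eq, zero_mul, zero_add]

lemma hasSubgaussianMGF_tailSum_coord (hi : iIndepFun Z P)
    (hZ : ∀ i, HasLaw (Z i) (noiseLaw n σ) P) (k j : ℕ) (l : Fin n) :
    HasSubgaussianMGF (fun ω => Model.tailSum k (fun i => Z i ω) j l)
      (∑ _i ∈ Finset.Ico j (k + 1), (σ ^ 2).toNNReal) P := by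
  have h1 : iIndepFun (fun i ω => Z i ω l) P :=
    hi.comp (fun _ (x : Vec n) => x l) fun _ => by fun_prop
  have h2 := HasSubgaussianMGF.sum_of_iIndepFun h1 (s := Finset.Ico j (k + 1))
    fun i _ => hasSubgaussianMGF_coord (hZ i) l
  refine h2.congr (Filter.Eventually.of_forall fun ω => ?_)
  simp [Model.tailSum]

/-- Each coordinate of a tail sum adds at most `k + 1` independent Gaussians, so `σ² (k + 1)` is a
variance proxy for every starting index `j`. -/
lemma integral_expMajorant_tailSum [IsProbabilityMeasure P] (hi : iIndepFun Z P)
    (hZ : ∀ i, HasLaw (Z i) (noiseLaw n σ) P) (k j : ℕ) (t : ℝ) :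
    Integrable (fun ω => expMajorant t (Model.tailSum k (fun i => Z i ω) j)) P ∧
    ∫ ω, expMajorant t (Model.tailSum k (fun i => Z i ω) j) ∂P ≤
      (1 + 2 * n) * Real.exp ((n * t) ^ 2 * (σ ^ 2 * (k + 1)) / 2) := by
  have hsub := fun l => hasSubgaussianMGF_tailSum_coord hi hZ k j l
  have hI : ∀ (c : ℝ) (l : Fin n), Integrable
      (fun ω => Real.exp (c * Model.tailSum k (fun i => Z i ω) j l)) P :=
    fun c l => (hsub l).integrable_exp_mul c
  have hB : ∀ (c : ℝ) (l : Fin n), c ^ 2 = (n * t) ^ 2 →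
      ∫ ω, Real.exp (c * Model.tailSum k (fun i => Z i ω) j l) ∂P ≤
        Real.exp ((n * t) ^ 2 * (σ ^ 2 * (k + 1)) / 2) := by
    intro c l hc
    refine ((hsub l).mgf_le c).trans (Real.exp_le_exp.2 ?_)
    rw [hc]
    have : ((∑ _i ∈ Finset.Ico j (k + 1), (σ ^ 2).toNNReal : NNReal) : ℝ) ≤ σ ^ 2 * (k + 1) := by
      rw [Finset.sum_const, Nat.card_Ico, nsmul_eq_mul]
      push_cast
      rw [Real.coe_toNNReal _ (sq_nonneg σ), mul_comm]
      gcongr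
      exact_mod_cast Nat.sub_le (k + 1) j
    nlinarith [sq_nonneg (n * t : ℝ)]
  have hI2 : ∀ l : Fin n, Integrable (fun ω =>
      Real.exp (n * t * Model.tailSum k (fun i => Z i ω) j l) +
      Real.exp (-(n * t) * Model.tailSum k (fun i => Z i ω) j l)) P :=
    fun l => (hI _ l).add (hI _ l)
  have hS := integrable_finsetSum Finset.univ fun l _ => hI2 l
  refine ⟨(integrable_const 1).add hS, ?_⟩
  unfold expMajorant
  rw [integral_add (integrable_const 1) hS, integral_finsetSum _ fun l _ => hI2 l]
  simp only [integral_const, probReal_univ, smul_eq_mul, one_mul]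
  set G := Real.exp ((n * t) ^ 2 * (σ ^ 2 * (k + 1)) / 2) with hG
  have hG1 : 1 ≤ G := Real.one_le_exp (by positivity)
  have h3 : ∀ l ∈ (Finset.univ : Finset (Fin n)), ∫ ω,
      (Real.exp (n * t * Model.tailSum k (fun i => Z i ω) j l) +
      Real.exp (-(n * t) * Model.tailSum k (fun i => Z i ω) j l)) ∂P ≤ 2 * G := by
    intro l _
    rw [integral_add (hI _ l) (hI _ l)]
    have h4 := hB (n * t) l rfl
    have h5 := hB (-(n * t)) l (by ring)
    linarith
  have h6 := Finset.sum_le_card_nsmul _ _ _ h3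
  simp only [Finset.card_univ, Fintype.card_fin, nsmul_eq_mul] at h6
  linarith

/-- Gaussian tails of the noise size. -/
lemma measure_noiseSize_ge_le [IsProbabilityMeasure P] (hi : iIndepFun Z P)
    (hZ : ∀ i, HasLaw (Z i) (noiseLaw n σ) P) (hσ : 0 < σ) {k : ℕ} (hk : 0 < k) {ε : ℝ}
    (hε : 0 < ε) (hε1 : ε ≤ 1) :
    P {ω | (n + 1) * σ * √(k + 1) * √(8 * Real.log ((2 + 4 * n) / ε)) ≤
      Model.noiseSize k fun i => Z i ω} ≤ ENNReal.ofReal ε := by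
  set a : ℝ := (n + 1) ^ 2 * (σ ^ 2 * (k + 1)) with ha
  set ℓ := Real.log ((2 + 4 * n) / ε) with hℓ
  have ha0 : 0 < a := by positivity
  have hC1 : (1 : ℝ) ≤ (2 + 4 * n) / ε := by
    rw [le_div_iff₀ hε]
    have : (0 : ℝ) ≤ n := n.cast_nonneg
    linarith
  have hℓ0 : 0 ≤ ℓ := Real.log_nonneg hC1
  set s := (n + 1) * σ * √(k + 1) * √(8 * ℓ) with hs
  have hs0 : 0 ≤ s := by positivity
  have hs2 : s ^ 2 = 8 * a * ℓ := by
    rw [hs, ha]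
    have e1 := Real.sq_sqrt (show (0 : ℝ) ≤ k + 1 by positivity)
    have e2 := Real.sq_sqrt (show (0 : ℝ) ≤ 8 * ℓ by positivity)
    rw [mul_pow, mul_pow, mul_pow, e1, e2]; ring
  -- The Chernoff parameter minimising `2 a t² - s t`. The minimum is `-s² / (8 a) = -ℓ`, and `ℓ` is
  -- chosen so that `(2 + 4 n) exp (-ℓ) = ε`.
  set t := s / (4 * a) with ht
  have ht0 : 0 ≤ t := by positivity
  let X : ℕ → Ω → Vec n := fun j ω => Model.tailSum k (fun i => Z i ω) j
  let Rf : Ω → ℝ := fun ω => expMajorant (2 * t) (X 0 ω) +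
    (k : ℝ)⁻¹ * ∑ j ∈ Finset.range k, expMajorant (2 * t) (X (j + 1) ω)
  have hX := fun j => integral_expMajorant_tailSum hi hZ k j (2 * t)
  have hsumI : Integrable (fun ω => ∑ j ∈ Finset.range k, expMajorant (2 * t) (X (j + 1) ω)) P :=
    integrable_finsetSum _ fun j _ => (hX (j + 1)).1
  have hRI : Integrable Rf P := (hX 0).1.add (hsumI.const_mul _)
  have hR0 : ∀ ω, 0 ≤ Rf ω := fun ω =>
    add_nonneg (expMajorant_nonneg _ _) (mul_nonneg (by positivity)
      (Finset.sum_nonneg fun _ _ => expMajorant_nonneg _ _))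
  set G := (1 + 2 * n) * Real.exp ((n * (2 * t)) ^ 2 * (σ ^ 2 * (k + 1)) / 2) with hG
  have hkR : (0 : ℝ) < k := by exact_mod_cast hk
  have hRint : ∫ ω, Rf ω ∂P ≤ 2 * G := by
    simp only [Rf]
    rw [integral_add (hX 0).1 (hsumI.const_mul _), integral_const_mul,
      integral_finsetSum _ fun j _ => (hX (j + 1)).1]
    have h1 := Finset.sum_le_card_nsmul (Finset.range k) _ G fun j _ => (hX (j + 1)).2
    rw [Finset.card_range, nsmul_eq_mul] at h1
    have h2 : (k : ℝ)⁻¹ * ∑ j ∈ Finset.range k, ∫ ω, expMajorant (2 * t) (X (j + 1) ω) ∂P ≤ G := by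
      rw [inv_mul_le_iff₀ hkR]; exact h1
    linarith [(hX 0).2]
  have hmaj : ∀ ω, Real.exp (t * Model.noiseSize k fun i => Z i ω) ≤ Rf ω := by
    intro ω
    rw [Model.noiseSize, mul_add]
    refine (exp_add_le _ _).trans (add_le_add ?_ ?_)
    · rw [← mul_assoc]; exact exp_mul_norm_le (by positivity) _
    · rw [show 2 * (t * ((k : ℝ)⁻¹ * ∑ j ∈ Finset.range k,
          ‖Model.tailSum k (fun i => Z i ω) (j + 1)‖)) =
          (k : ℝ)⁻¹ * ∑ j ∈ Finset.range k, (2 * t) * ‖X (j + 1) ω‖ by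
        rw [← Finset.mul_sum]; ring]
      refine (exp_average_le hk _).trans ?_
      gcongr with j
      exact exp_mul_norm_le (by positivity) _
  have hmono : {ω | s ≤ Model.noiseSize k fun i => Z i ω} ⊆ {ω | Real.exp (t * s) ≤ Rf ω} := by
    intro ω hω
    refine (Real.exp_le_exp.2 ?_).trans (hmaj ω)
    exact mul_le_mul_of_nonneg_left hω ht0
  have hmk := mul_meas_ge_le_integral_of_nonneg (Filter.Eventually.of_forall hR0) hRI
    (Real.exp (t * s))
  have hGle : G ≤ (1 + 2 * n) * Real.exp (s ^ 2 / (8 * a)) := by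
    rw [hG]
    refine mul_le_mul_of_nonneg_left (Real.exp_le_exp.2 ?_) (by positivity)
    have : ((n : ℝ) * (2 * t)) ^ 2 * (σ ^ 2 * (k + 1)) ≤ 4 * t ^ 2 * a := by
      rw [ha]
      have hn : (n : ℝ) ^ 2 ≤ (n + 1) ^ 2 := by
        have : (0 : ℝ) ≤ n := n.cast_nonneg
        nlinarith
      have q : 0 ≤ 4 * t ^ 2 * (σ ^ 2 * (k + 1)) := by positivity
      nlinarith
    have e : s ^ 2 / (8 * a) = 4 * t ^ 2 * a / 2 := by rw [ht]; field_simp; ring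
    rw [e]
    linarith
  have e1 : t * s = 2 * ℓ := by
    rw [ht, div_mul_eq_mul_div, ← sq, hs2]; field_simp; ring
  have e2 : s ^ 2 / (8 * a) = ℓ := by rw [hs2]; field_simp
  rw [e2] at hGle
  have hexp : Real.exp ℓ = (2 + 4 * n) / ε := Real.exp_log (by positivity)
  rw [e1, two_mul, Real.exp_add] at hmk
  have hfin : P.real {ω | Real.exp (t * s) ≤ Rf ω} ≤ ε := by
    rw [e1, two_mul, Real.exp_add]
    have h3 : Real.exp ℓ * (Real.exp ℓ * P.real {ω | Real.exp ℓ * Real.exp ℓ ≤ Rf ω}) ≤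
        Real.exp ℓ * (2 + 4 * n) := by
      rw [← mul_assoc]
      refine hmk.trans (hRint.trans ?_)
      linarith
    have h4 := le_of_mul_le_mul_left h3 (Real.exp_pos ℓ)
    rw [hexp, div_mul_eq_mul_div, div_le_iff₀ hε] at h4
    rw [hexp]
    exact le_of_mul_le_mul_left h4 (by positivity)
  refine (measure_mono hmono).trans ?_
  rw [← ENNReal.ofReal_toReal (measure_ne_top P {ω | Real.exp (t * s) ≤ Rf ω})]
  exact ENNReal.ofReal_le_ofReal hfin

end Noise
end GaussFilter
end

/-! ### Wasserstein coupling and Gaussian integrals. -/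

noncomputable section
open MeasureTheory ProbabilityTheory
namespace GaussFilter

section Coupling
variable {n : ℕ}

/-- Keeping the common mass in place and coupling the excess masses independently. -/
lemma dW_withDensity_le {F G : Vec n → ENNReal} (hF : Measurable F) (hG : Measurable G)
    (hF1 : ∫⁻ x, F x = 1) (hG1 : ∫⁻ x, G x = 1) (x₀ : Vec n) :
    dW (volume.withDensity F) (volume.withDensity G) ≤
      ∫⁻ x, edist x x₀ * ((F x - G x) + (G x - F x)) := by
  set m : Vec n → ENNReal := fun x => min (F x) (G x) with hm
  set a : Vec n → ENNReal := fun x => F x - G x with ha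
  set b : Vec n → ENNReal := fun x => G x - F x with hb
  have hmm : Measurable m := hF.min hG
  have ham : Measurable a := hF.sub hG
  have hbm : Measurable b := hG.sub hF
  have hFe : F = a + m := by funext x; exact tsub_add_min.symm
  have hGe : G = b + m := by
    funext x; simp only [hb, hm, Pi.add_apply]; rw [min_comm]; exact tsub_add_min.symm
  have hmfin : ∫⁻ x, m x ≠ ⊤ :=
    ne_top_of_le_ne_top (by rw [hF1]; exact ENNReal.one_ne_top)
      (lintegral_mono fun x => min_le_left _ _)
  have hsumA : (∫⁻ x, a x) + ∫⁻ x, m x = 1 := by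
    rw [← hF1, hFe, ← lintegral_add_left ham]; rfl
  have hsumB : (∫⁻ x, b x) + ∫⁻ x, m x = 1 := by
    rw [← hG1, hGe, ← lintegral_add_left hbm]; rfl
  have hab : ∫⁻ x, b x = ∫⁻ x, a x := by
    rw [← hsumA] at hsumB
    exact (ENNReal.add_left_inj hmfin).1 hsumB
  set τ := ∫⁻ x, a x with hτ
  have hτfin : τ ≠ ⊤ := by
    intro h; rw [h] at hsumA; simp at hsumA
  set μa := volume.withDensity a with hμa
  set μb := volume.withDensity b with hμb
  set μm := volume.withDensity m with hμm
  have hμaU : μa Set.univ = τ := by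
    rw [hμa, withDensity_apply _ MeasurableSet.univ, setLIntegral_univ]
  have hμbU : μb Set.univ = τ := by
    rw [hμb, withDensity_apply _ MeasurableSet.univ, setLIntegral_univ, hab]
  have : IsFiniteMeasure μa := ⟨by rw [hμaU]; exact hτfin.lt_top⟩
  have : IsFiniteMeasure μb := ⟨by rw [hμbU]; exact hτfin.lt_top⟩
  -- If `τ = 0` then `τ⁻¹ = ∞`, but the excess measures vanish, so the coupling below needs no
  -- separate case.
  have hscale : ∀ μ : Measure (Vec n), μ Set.univ = τ → τ⁻¹ • (τ • μ) = μ := by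
    intro μ hμ
    by_cases h0 : τ = 0
    · rw [h0] at hμ
      rw [Measure.measure_univ_eq_zero.1 hμ]; simp
    · rw [smul_smul, ENNReal.inv_mul_cancel h0 hτfin, one_smul]
  have hdiag : Measurable fun x : Vec n => (x, x) := measurable_id.prodMk measurable_id
  set γ : Measure (Vec n × Vec n) := τ⁻¹ • μa.prod μb + μm.map fun x => (x, x) with hγ
  have hfst : γ.map Prod.fst = volume.withDensity F := by
    rw [hγ, Measure.map_add _ _ measurable_fst, Measure.map_smul, Measure.map_fst_prod, hμbU,
      hscale _ hμaU, Measure.map_map measurable_fst hdiag, hFe, withDensity_add_left ham]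
    congr 1
    exact Measure.map_id
  have hsnd : γ.map Prod.snd = volume.withDensity G := by
    rw [hγ, Measure.map_add _ _ measurable_snd, Measure.map_smul, Measure.map_snd_prod, hμaU,
      hscale _ hμbU, Measure.map_map measurable_snd hdiag, hGe, withDensity_add_left hbm]
    congr 1
    exact Measure.map_id
  refine (iInf₂_le γ ⟨hfst, hsnd⟩).trans ?_
  have hed : Measurable fun p : Vec n × Vec n => edist p.1 p.2 := measurable_edist
  have hed0 : Measurable fun x : Vec n => edist x x₀ := measurable_edist_left
  rw [hγ, lintegral_add_measure, lintegral_smul_measure, lintegral_map hed hdiag]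
  simp only [edist_self, lintegral_zero, add_zero]
  have hcost : ∫⁻ p, edist p.1 p.2 ∂(μa.prod μb) ≤ τ * ∫⁻ x, edist x x₀ * (a x + b x) := by
    calc ∫⁻ p, edist p.1 p.2 ∂(μa.prod μb)
        ≤ ∫⁻ p, (edist p.1 x₀ + edist p.2 x₀) ∂(μa.prod μb) :=
          lintegral_mono fun p => by
            have := edist_triangle p.1 x₀ p.2
            rwa [edist_comm x₀] at this
      _ = ∫⁻ x, ∫⁻ y, (edist x x₀ + edist y x₀) ∂μb ∂μa := by
          rw [lintegral_prod]
          exact ((hed0.comp measurable_fst).add (hed0.comp measurable_snd)).aemeasurable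
      _ = ∫⁻ x, (edist x x₀ * τ + ∫⁻ y, edist y x₀ ∂μb) ∂μa := by
          refine lintegral_congr fun x => ?_
          rw [lintegral_add_left measurable_const, lintegral_const, hμbU]
      _ = (∫⁻ x, edist x x₀ ∂μa) * τ + (∫⁻ y, edist y x₀ ∂μb) * τ := by
          rw [lintegral_add_right _ measurable_const, lintegral_mul_const _ hed0, lintegral_const,
            hμaU]
      _ = τ * ∫⁻ x, edist x x₀ * (a x + b x) := by
          rw [hμa, hμb, lintegral_withDensity_eq_lintegral_mul _ ham hed0,
            lintegral_withDensity_eq_lintegral_mul _ hbm hed0, ← add_mul, mul_comm τ,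
            ← lintegral_add_left (ham.mul hed0)]
          congr 1
          refine lintegral_congr fun x => ?_
          simp only [Pi.mul_apply]
          ring
  calc τ⁻¹ • ∫⁻ p, edist p.1 p.2 ∂(μa.prod μb)
      ≤ τ⁻¹ * (τ * ∫⁻ x, edist x x₀ * (a x + b x)) := by
        rw [smul_eq_mul]; gcongr
    _ ≤ ∫⁻ x, edist x x₀ * (a x + b x) := by
        rw [← mul_assoc]
        exact mul_le_of_le_one_left' (ENNReal.inv_mul_le_one τ)

lemma dW_ofDensity_le {f g : Vec n → ℝ} (hf : AEStronglyMeasurable f) (hg : AEStronglyMeasurable g)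
    (hf1 : ∫⁻ x, ENNReal.ofReal (f x) = 1) (hg1 : ∫⁻ x, ENNReal.ofReal (g x) = 1) (x₀ : Vec n) :
    dW (ofDensity f) (ofDensity g) ≤ ∫⁻ x, ENNReal.ofReal (‖x - x₀‖ * |f x - g x|) := by
  have hF := hf.aemeasurable.ennreal_ofReal
  have hG := hg.aemeasurable.ennreal_ofReal
  have e1 := hF.ae_eq_mk
  have e2 := hG.ae_eq_mk
  rw [ofDensity, ofDensity, withDensity_congr_ae e1, withDensity_congr_ae e2]
  rw [lintegral_congr_ae e1] at hf1
  rw [lintegral_congr_ae e2] at hg1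
  refine (dW_withDensity_le hF.measurable_mk hG.measurable_mk hf1 hg1 x₀).trans ?_
  refine lintegral_mono_ae ?_
  filter_upwards [e1, e2] with x h1 h2
  rw [← h1, ← h2, ENNReal.ofReal_mul (norm_nonneg _), edist_dist, dist_eq_norm]
  gcongr
  rcases le_total (f x) (g x) with h | h
  · rw [tsub_eq_zero_of_le (ENNReal.ofReal_le_ofReal h), zero_add, abs_sub_comm,
      abs_of_nonneg (sub_nonneg.2 h)]
    rw [tsub_le_iff_right]
    refine (ENNReal.ofReal_le_ofReal (by linarith)).trans ENNReal.ofReal_add_le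
  · rw [tsub_eq_zero_of_le (ENNReal.ofReal_le_ofReal h), add_zero,
      abs_of_nonneg (sub_nonneg.2 h)]
    rw [tsub_le_iff_right]
    refine (ENNReal.ofReal_le_ofReal (by linarith)).trans ENNReal.ofReal_add_le

end Coupling

section Gaussian
variable {n : ℕ}

/-- The isotropic Gaussian profile of width `s` around `x₀`. -/
def bell (α s : ℝ) (x₀ x : Vec n) : ℝ := Real.exp (-(α * (‖x - x₀‖ / s) ^ 2))

lemma bell_pos (α s : ℝ) (x₀ x : Vec n) : 0 < bell α s x₀ x := Real.exp_pos _

lemma integral_bell {α s : ℝ} (hα : 0 < α) (hs : 0 < s) (x₀ : Vec n) :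
    Integrable (bell α s x₀) ∧ ∫ x, bell α s x₀ x = (Real.pi / α) ^ ((n : ℝ) / 2) * s ^ n := by
  have h1 : ∫ x, bell α s x₀ x = (Real.pi / α) ^ ((n : ℝ) / 2) * s ^ n := by
    have e : bell α s x₀ = fun x : Vec n =>
        (fun y => Real.exp (-(α / s ^ 2) * ‖y‖ ^ 2)) (x - x₀) := by
      funext x; simp only [bell]; congr 1; field_simp
    rw [e, integral_sub_right_eq_self (fun y : Vec n => Real.exp (-(α / s ^ 2) * ‖y‖ ^ 2)) x₀,
      GaussianFourier.integral_rexp_neg_mul_sq_norm (by positivity)]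
    simp only [finrank_euclideanSpace, Fintype.card_fin]
    rw [show Real.pi / (α / s ^ 2) = (Real.pi / α) * s ^ 2 by field_simp,
      Real.mul_rpow (by positivity) (by positivity)]
    congr 1
    rw [← Real.rpow_natCast s 2, ← Real.rpow_mul hs.le, ← Real.rpow_natCast s n]
    congr 1
    push_cast
    ring
  refine ⟨?_, h1⟩
  -- A non-integrable function would have Bochner integral `0`, so the positive value just computed
  -- proves integrability.
  refine Integrable.of_integral_ne_zero ?_
  rw [h1]
  positivity

/-- Factoring `N = yᵀ y`, the linear substitution by `y` reduces to the isotropic profile with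
Jacobian `|det y| = √(det N)`. -/
lemma integral_exp_neg_posDef {N : Matrix (Fin n) (Fin n) ℝ} (hN : N.PosDef) {σ : ℝ} (hσ : 0 < σ)
    (x₀ : Vec n) :
    ∫ v : Vec n, Real.exp (-(dotProduct (v - x₀).ofLp (N.mulVec (v - x₀).ofLp)) / (2 * σ ^ 2)) =
      (2 * Real.pi) ^ ((n : ℝ) / 2) * σ ^ n / √N.det := by
  obtain ⟨y, hy⟩ : ∃ y, N = star y * y := by
    open scoped MatrixOrder in
    exact CStarAlgebra.nonneg_iff_eq_star_mul_self.mp hN.posSemidef.nonneg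
  have hdet : √N.det = |y.det| := by
    rw [hy, Matrix.det_mul, Matrix.star_eq_conjTranspose, Matrix.det_conjTranspose, star_trivial,
      ← sq, Real.sqrt_sq_eq_abs]
  have hdetN := hN.det_pos
  have hy0 : y.det ≠ 0 := by
    intro h
    rw [h, abs_zero] at hdet
    have := Real.sqrt_pos.2 hdetN
    linarith
  set f : Vec n →ₗ[ℝ] Vec n := Matrix.toLpLin 2 2 y with hf
  have hfd : LinearMap.det f = y.det := LinearMap.det_toLpLin 2 y
  have hquad : ∀ w : Vec n, dotProduct w.ofLp (N.mulVec w.ofLp) = ‖f w‖ ^ 2 := by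
    intro w
    rw [← real_inner_self_eq_norm_sq, inner_eq_dotProduct, hf, Matrix.toLpLin_apply, hy,
      ← Matrix.mulVec_mulVec, Matrix.dotProduct_mulVec]
    simp [Matrix.star_eq_conjTranspose, Matrix.vecMul_transpose]
  simp only [hquad]
  rw [integral_sub_right_eq_self (fun w : Vec n => Real.exp (-‖f w‖ ^ 2 / (2 * σ ^ 2))) x₀]
  have hmap := Measure.map_linearMap_addHaar_eq_smul_addHaar (volume : Measure (Vec n))
    (f := f) (by rw [hfd]; exact hy0)
  have hfc : Continuous f := f.continuous_of_finiteDimensional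
  have h1 := integral_map (μ := (volume : Measure (Vec n))) hfc.aemeasurable
    (f := fun x : Vec n => Real.exp (-‖x‖ ^ 2 / (2 * σ ^ 2)))
    (by fun_prop)
  rw [← h1, hmap, integral_smul_measure, hfd, hdet, ENNReal.toReal_ofReal (abs_nonneg _), abs_inv]
  have h2 : (fun x : Vec n => Real.exp (-‖x‖ ^ 2 / (2 * σ ^ 2))) = bell (1 / 2) σ 0 := by
    funext x; simp only [bell, sub_zero]; congr 1; field_simp
  rw [h2, (integral_bell (by norm_num) hσ 0).2, smul_eq_mul,
    show Real.pi / (1 / 2) = 2 * Real.pi by ring]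
  field_simp

end Gaussian

/-! ### Comparing a density with a Gaussian before and after normalisation. -/

section Comparison

lemma abs_exp_sub_one_le_mul (x : ℝ) : |Real.exp x - 1| ≤ |x| * Real.exp |x| := by
  rcases le_total 0 x with h | h
  · rw [abs_of_nonneg h, abs_of_nonneg (by linarith [Real.add_one_le_exp x])]
    have h1 := Real.add_one_le_exp (-x)
    have h2 : Real.exp (-x) * Real.exp x = 1 := by rw [← Real.exp_add]; simp
    nlinarith [Real.exp_pos x]
  · have h3 : Real.exp x ≤ 1 := Real.exp_le_one_iff.2 h
    rw [abs_of_nonpos h, abs_of_nonpos (by linarith)]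
    have h1 := Real.add_one_le_exp x
    have h2 := Real.add_one_le_exp (-x)
    nlinarith

/-- Polynomial factors in the rescaled distance are absorbed by giving up part of the Gaussian
exponent. -/
lemma exists_poly_le_exp {α : ℝ} (hα : 0 < α) :
    ∃ K, 0 < K ∧ ∀ y : ℝ, 0 ≤ y → 1 + y + y ^ 3 ≤ K * Real.exp (α * y ^ 2) := by
  refine ⟨3 + 4 / α ^ 2, by positivity, fun y hy => ?_⟩
  have h1 := Real.pow_div_factorial_le_exp (α * y ^ 2) (by positivity) 2
  have h2 : 1 ≤ Real.exp (α * y ^ 2) := Real.one_le_exp (by positivity)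
  have h3 : y ^ 4 ≤ 2 / α ^ 2 * Real.exp (α * y ^ 2) := by
    rw [div_mul_eq_mul_div, le_div_iff₀ (by positivity)]
    rw [Nat.factorial_two] at h1
    push_cast at h1
    nlinarith
  have h4 : y ≤ 1 + y ^ 4 := by
    nlinarith [sq_nonneg (y ^ 2 - 1), sq_nonneg (y - 1), sq_nonneg (y ^ 2)]
  have h5 : y ^ 3 ≤ 1 + y ^ 4 := by
    nlinarith [sq_nonneg (y ^ 2 - 1), sq_nonneg (y - 1), sq_nonneg (y ^ 2 - y), sq_nonneg y]
  have e : (4 : ℝ) / α ^ 2 = 2 * (2 / α ^ 2) := by ring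
  rw [e]
  nlinarith

/-- A Gaussian factor `exp (-a)` against a perturbation that is close to it near the centre and
dominated by a Gaussian away from it. -/
lemma exists_perturbation_bound {α C ρ : ℝ} (hα : 0 < α) (hC : 0 < C) (hρ : 0 < ρ)
    (hCρ : C * ρ ≤ α / 2) :
    ∃ D, 0 < D ∧ ∀ s θ r a X : ℝ, 0 < s → 0 ≤ θ → θ ≤ 1 → 0 ≤ r → α * (r / s) ^ 2 ≤ a → 0 ≤ X →
      (r ≤ ρ → ∃ κ e : ℝ, X = κ * Real.exp (-(a + e)) ∧ |κ - 1| ≤ C * r ∧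
        |e| ≤ C * (r ^ 3 / s ^ 2 + θ)) →
      (ρ < r → X ≤ C * Real.exp (-(α * (r / s) ^ 2))) →
      |X - Real.exp (-a)| ≤ D * (s + θ) * Real.exp (-(α / 4 * (r / s) ^ 2)) := by
  obtain ⟨K, hK0, hK⟩ := exists_poly_le_exp (show 0 < α / 4 by positivity)
  refine ⟨Real.exp C * C * K + (C + 1) / ρ * K, by positivity, ?_⟩
  intro s θ r a X hs hθ hθ1 hr ha hX near far
  set y := r / s with hy
  have hy0 : 0 ≤ y := by positivity
  have hry : r = s * y := by rw [hy]; field_simp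
  have hKy := hK y hy0
  have hsplit : Real.exp (α / 4 * y ^ 2) * Real.exp (-(α / 2 * y ^ 2)) =
      Real.exp (-(α / 4 * y ^ 2)) := by rw [← Real.exp_add]; ring_nf
  have hsplit2 : Real.exp (-(α * y ^ 2)) ≤ Real.exp (-(α / 2 * y ^ 2)) := by
    apply Real.exp_le_exp.2; nlinarith [sq_nonneg y]
  set g := Real.exp (-(α / 4 * y ^ 2)) with hg
  have hg0 : 0 < g := Real.exp_pos _
  have hpoly : (1 + y + y ^ 3) * Real.exp (-(α / 2 * y ^ 2)) ≤ K * g := by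
    rw [← hsplit, ← mul_assoc]; gcongr
  rcases le_or_gt r ρ with hrρ | hrρ
  · obtain ⟨κ, e, hXe, hκ, he⟩ := near hrρ
    -- Since `r ≤ ρ` and `C * ρ ≤ α / 2`, the cubic error uses at most half of the Gaussian
    -- exponent.
    have he1 : |e| ≤ α / 2 * y ^ 2 + C := by
      refine he.trans ?_
      have h1 : r ^ 3 / s ^ 2 = r * y ^ 2 := by rw [hy]; field_simp
      rw [h1]
      have h2 : C * (r * y ^ 2) ≤ C * (ρ * y ^ 2) := by gcongr
      nlinarith [sq_nonneg y]
    have he2 : |e| ≤ C * (s * y ^ 3 + θ) := by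
      refine he.trans (le_of_eq ?_)
      rw [hry]; field_simp
    have h3 : X - Real.exp (-a) =
        Real.exp (-a) * ((κ - 1) * Real.exp (-e) + (Real.exp (-e) - 1)) := by
      rw [hXe, neg_add, Real.exp_add]; ring
    have h4 : |(κ - 1) * Real.exp (-e) + (Real.exp (-e) - 1)| ≤ (C * r + |e|) * Real.exp |e| := by
      have h5 := abs_exp_sub_one_le_mul (-e)
      rw [abs_neg] at h5
      have h6 : |(κ - 1) * Real.exp (-e)| ≤ C * r * Real.exp |e| := by
        rw [abs_mul, Real.abs_exp]
        gcongr
        exact neg_le_abs e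
      refine (abs_add_le _ _).trans ?_
      linarith
    rw [h3, abs_mul, Real.abs_exp]
    have h7 : Real.exp (-a) * Real.exp |e| ≤ Real.exp C * Real.exp (-(α / 2 * y ^ 2)) := by
      rw [← Real.exp_add, ← Real.exp_add]
      apply Real.exp_le_exp.2
      linarith
    have h8 : C * r + |e| ≤ C * (s + θ) * (1 + y + y ^ 3) := by
      rw [hry]
      have : 0 ≤ θ * (y + y ^ 3) := by positivity
      nlinarith
    calc Real.exp (-a) * |(κ - 1) * Real.exp (-e) + (Real.exp (-e) - 1)|
        ≤ Real.exp (-a) * ((C * r + |e|) * Real.exp |e|) := by gcongr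
      _ = (C * r + |e|) * (Real.exp (-a) * Real.exp |e|) := by ring
      _ ≤ (C * (s + θ) * (1 + y + y ^ 3)) * (Real.exp C * Real.exp (-(α / 2 * y ^ 2))) := by gcongr
      _ = C * (s + θ) * Real.exp C * ((1 + y + y ^ 3) * Real.exp (-(α / 2 * y ^ 2))) := by ring
      _ ≤ C * (s + θ) * Real.exp C * (K * g) := by gcongr
      _ ≤ _ := by
        have : 0 ≤ (C + 1) / ρ * K * (s + θ) * g := by positivity
        nlinarith
  · have h1 := far hrρ
    have h2 : Real.exp (-a) ≤ Real.exp (-(α * y ^ 2)) := Real.exp_le_exp.2 (by linarith)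
    have h3 : |X - Real.exp (-a)| ≤ (C + 1) * Real.exp (-(α * y ^ 2)) := by
      have := Real.exp_pos (-a)
      rw [abs_le]
      constructor <;> nlinarith
    -- Far from the centre there is no cancellation; the required factor `s` comes from `r = s * y >
    -- ρ`, and `y` is absorbed by the exponential.
    have h4 : 1 ≤ s * y / ρ := by rw [le_div_iff₀ hρ, ← hry]; linarith
    calc |X - Real.exp (-a)| ≤ (C + 1) * Real.exp (-(α / 2 * y ^ 2)) * 1 := by
          rw [mul_one]; exact h3.trans (by gcongr)
      _ ≤ (C + 1) * Real.exp (-(α / 2 * y ^ 2)) * (s * y / ρ) := by gcongr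
      _ = (C + 1) / ρ * s * (y * Real.exp (-(α / 2 * y ^ 2))) := by ring
      _ ≤ (C + 1) / ρ * s * (K * g) := by
          refine mul_le_mul_of_nonneg_left (le_trans ?_ hpoly) (by positivity)
          gcongr
          linarith [pow_nonneg hy0 3]
      _ ≤ _ := by
        have q1 : 0 ≤ Real.exp C * C * K * (s + θ) * g := by positivity
        have q2 : 0 ≤ (C + 1) / ρ * K * θ * g := by positivity
        nlinarith

variable {n : ℕ}

/-- Normalizing two nearby unnormalized densities, one of them Gaussian-like. -/
lemma exists_normalized_bounds (n : ℕ) {α C c : ℝ} (hα : 0 < α) (hC : 0 < C) (hc : 0 < c) :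
    ∃ D θ₀, 0 < D ∧ 0 < θ₀ ∧ ∀ (s θ κ : ℝ) (x₀ : Vec n) (F Γ : Vec n → ℝ), 0 < s → 0 ≤ θ → θ ≤ θ₀ →
      0 < κ → AEStronglyMeasurable F → (∀ x, 0 ≤ F x) → Continuous Γ → (∀ x, 0 ≤ Γ x) →
      (∀ x, Γ x ≤ C * bell α s x₀ x) → c * s ^ n ≤ ∫ x, Γ x →
      (∀ᵐ x, |F x / κ - Γ x| ≤ C * θ * bell α s x₀ x) →
      dTV (fun x => F x / ∫ w, F w) (fun x => Γ x / ∫ w, Γ w) ≤ ENNReal.ofReal (D * θ) ∧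
      dW (ofDensity fun x => F x / ∫ w, F w) (ofDensity fun x => Γ x / ∫ w, Γ w) ≤
        ENNReal.ofReal (D * θ * s) := by
  set E := (Real.pi / α) ^ ((n : ℝ) / 2) with hE
  set E' := (Real.pi / (α / 2)) ^ ((n : ℝ) / 2) with hE'
  have hE0 : 0 < E := by positivity
  have hE'0 : 0 < E' := by positivity
  set D₀ := 2 * C / c + 2 * C ^ 2 * E / c ^ 2 with hD₀
  have hD₀0 : 0 < D₀ := by positivity
  obtain ⟨K, hK0, hK⟩ := exists_poly_le_exp (show 0 < α / 2 by positivity)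
  -- The threshold on `θ` keeps the normaliser of `F / κ` above half the lower bound `c * s ^ n`.
  -- The terms `E` and `K * E'` serve the total variation and the Wasserstein bound respectively.
  refine ⟨D₀ * (E + K * E'), c / (2 * C * E), by positivity, by positivity, ?_⟩
  intro s θ κ x₀ F Γ hs hθ hθ₀ hκ hFm hF0 hΓc hΓ0 hΓle hΓint hclose
  obtain ⟨hbI, hbint⟩ := integral_bell (n := n) hα hs x₀
  set Zγ := ∫ x, Γ x with hZγ
  have hsn : 0 < s ^ n := by positivity
  have hZγ0 : 0 < Zγ := lt_of_lt_of_le (by positivity) hΓint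
  have hΓI : Integrable Γ := by
    refine (hbI.const_mul C).mono' hΓc.aestronglyMeasurable
      (Filter.Eventually.of_forall fun x => ?_)
    rw [Real.norm_of_nonneg (hΓ0 x)]; exact hΓle x
  have hdm : AEStronglyMeasurable (fun x => F x / κ) :=
    (hFm.aemeasurable.div_const κ).aestronglyMeasurable
  have hdI : Integrable (fun x => F x / κ - Γ x) :=
    (hbI.const_mul (C * θ)).mono' (hdm.sub hΓc.aestronglyMeasurable) hclose
  have hFκI : Integrable (fun x => F x / κ) := by
    have := hdI.add hΓI
    refine this.congr (Filter.Eventually.of_forall fun x => ?_)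
    simp
  set Zx := ∫ x, F x / κ with hZx
  have hZdiff : |Zx - Zγ| ≤ C * θ * (E * s ^ n) := by
    rw [hZx, hZγ, ← integral_sub hFκI hΓI, ← hbint, ← integral_const_mul]
    exact norm_integral_le_of_norm_le (f := fun x => F x / κ - Γ x) (hbI.const_mul (C * θ)) hclose
  have hZhalf : C * θ * (E * s ^ n) ≤ c * s ^ n / 2 := by
    rw [le_div_iff₀ (by positivity)] at hθ₀
    nlinarith
  have hZx2 : c * s ^ n / 2 ≤ Zx := by
    have := (abs_le.1 hZdiff).1
    linarith
  have hZx0 : 0 < Zx := lt_of_lt_of_le (by positivity) hZx2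
  have hFZ : ∀ x, F x / ∫ w, F w = (F x / κ) / Zx := by
    intro x
    rw [hZx, integral_div]
    field_simp
  set f : Vec n → ℝ := fun x => (F x / κ) / Zx with hf
  set g : Vec n → ℝ := fun x => Γ x / Zγ with hg
  have hfe : (fun x => F x / ∫ w, F w) = f := funext hFZ
  rw [hfe]
  have hpt : ∀ᵐ x, |f x - g x| ≤ D₀ * θ / s ^ n * bell α s x₀ x := by
    filter_upwards [hclose] with x hx
    have hb := bell_pos α s x₀ x
    -- The error splits into the change of the unnormalised density and the change of the
    -- normaliser.
    have e : f x - g x = (F x / κ - Γ x) / Zx + Γ x * (Zγ - Zx) / (Zx * Zγ) := by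
      simp only [hf, hg]; field_simp; ring
    rw [e]
    have h1 : |(F x / κ - Γ x) / Zx| ≤ C * θ * bell α s x₀ x / (c * s ^ n / 2) := by
      rw [abs_div, abs_of_pos hZx0]; gcongr
    have h2 : |Γ x * (Zγ - Zx) / (Zx * Zγ)| ≤
        (C * bell α s x₀ x) * (C * θ * (E * s ^ n)) / ((c * s ^ n / 2) * (c * s ^ n)) := by
      rw [abs_div, abs_mul, abs_of_nonneg (hΓ0 x), abs_sub_comm, abs_of_pos (mul_pos hZx0 hZγ0)]
      gcongr
      exact hΓle x
    refine (abs_add_le _ _).trans ((add_le_add h1 h2).trans (le_of_eq ?_))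
    rw [hD₀]; field_simp
  have hfm : AEStronglyMeasurable f := (hdm.aemeasurable.div_const Zx).aestronglyMeasurable
  have hgm : AEStronglyMeasurable g := (hΓc.div_const Zγ).aestronglyMeasurable
  have hf1 : ∫⁻ x, ENNReal.ofReal (f x) = 1 := by
    rw [← ofReal_integral_eq_lintegral_ofReal (hFκI.div_const Zx)
      (Filter.Eventually.of_forall fun x => by
        have := hF0 x; simp only [Pi.zero_apply]; positivity), integral_div, div_self hZx0.ne',
      ENNReal.ofReal_one]
  have hg1 : ∫⁻ x, ENNReal.ofReal (g x) = 1 := by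
    rw [← ofReal_integral_eq_lintegral_ofReal (hΓI.div_const Zγ)
      (Filter.Eventually.of_forall fun x => by
        have := hΓ0 x; simp only [Pi.zero_apply]; positivity), integral_div, div_self hZγ0.ne',
      ENNReal.ofReal_one]
  have hD₀θ : 0 ≤ D₀ * θ := by positivity
  have lint : ∀ (β A : ℝ), 0 < β → 0 ≤ A →
      ∫⁻ x : Vec n, ENNReal.ofReal (A / s ^ n * bell β s x₀ x) =
        ENNReal.ofReal (A * (Real.pi / β) ^ ((n : ℝ) / 2)) := by
    intro β A hβ hA
    obtain ⟨hI, hint⟩ := integral_bell (n := n) hβ hs x₀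
    rw [← ofReal_integral_eq_lintegral_ofReal (hI.const_mul _)
      (Filter.Eventually.of_forall fun x => by
        have := bell_pos β s x₀ x; simp only [Pi.zero_apply]; positivity), integral_const_mul, hint]
    congr 1
    field_simp
  constructor
  · rw [dTV]
    calc (1 / 2 : ENNReal) * ∫⁻ x, ‖f x - g x‖ₑ ≤ 1 * ∫⁻ x, ‖f x - g x‖ₑ := by
          gcongr; rw [one_div]; exact ENNReal.inv_le_one.2 (by norm_num)
      _ ≤ ∫⁻ x, ENNReal.ofReal (D₀ * θ / s ^ n * bell α s x₀ x) := by
          rw [one_mul]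
          refine lintegral_mono_ae ?_
          filter_upwards [hpt] with x hx
          rw [← ofReal_norm]
          exact ENNReal.ofReal_le_ofReal hx
      _ = ENNReal.ofReal (D₀ * θ * E) := lint α _ hα hD₀θ
      _ ≤ _ := by
          apply ENNReal.ofReal_le_ofReal
          have : 0 ≤ D₀ * θ * (K * E') := by positivity
          linarith
  · refine (dW_ofDensity_le hfm hgm hf1 hg1 x₀).trans ?_
    calc ∫⁻ x, ENNReal.ofReal (‖x - x₀‖ * |f x - g x|)
        ≤ ∫⁻ x, ENNReal.ofReal (D₀ * θ * s * K / s ^ n * bell (α / 2) s x₀ x) := by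
          refine lintegral_mono_ae ?_
          filter_upwards [hpt] with x hx
          apply ENNReal.ofReal_le_ofReal
          -- The transport distance is `s * y`: the factor `s` is the gain over total variation, and
          -- `y` is absorbed into a wider bell.
          set y := ‖x - x₀‖ / s with hy
          have hy0 : 0 ≤ y := by positivity
          have hxy : ‖x - x₀‖ = s * y := by rw [hy]; field_simp
          have h1 : y ≤ K * Real.exp (α / 2 * y ^ 2) := by
            have := hK y hy0
            have : 0 ≤ y ^ 3 := by positivity
            linarith
          have h2 : bell α s x₀ x * Real.exp (α / 2 * y ^ 2) = bell (α / 2) s x₀ x := by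
            simp only [bell, ← hy]
            rw [← Real.exp_add]; ring_nf
          have hb := bell_pos α s x₀ x
          calc ‖x - x₀‖ * |f x - g x| ≤ (s * (K * Real.exp (α / 2 * y ^ 2))) *
                (D₀ * θ / s ^ n * bell α s x₀ x) := by rw [hxy]; gcongr
            _ = D₀ * θ * s * K / s ^ n * (bell α s x₀ x * Real.exp (α / 2 * y ^ 2)) := by ring
            _ = _ := by rw [h2]
      _ = ENNReal.ofReal (D₀ * θ * s * K * E') := lint (α / 2) _ (by positivity) (by positivity)
      _ ≤ _ := by
          apply ENNReal.ofReal_le_ofReal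
          have : 0 ≤ D₀ * θ * E * s := by positivity
          linarith

end Comparison
end GaussFilter
end

/-! ### The filter density in terms of the initial point. -/

noncomputable section
open MeasureTheory ProbabilityTheory
namespace GaussFilter

lemma det_eq_det_of {n : ℕ} (f : Vec n →L[ℝ] Vec n) :
    f.det = (Matrix.of fun i j => f (EuclideanSpace.single j 1) i).det := by
  rw [ContinuousLinearMap.det, ← LinearMap.det_toMatrix (EuclideanSpace.basisFun (Fin n) ℝ).toBasis]
  congr 1

lemma contDiff_det {n : ℕ} {N : WithTop ℕ∞} :
    ContDiff ℝ N fun f : Vec n →L[ℝ] Vec n => f.det := by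
  have h : (fun f : Vec n →L[ℝ] Vec n => f.det) = fun f => ∑ τ : Equiv.Perm (Fin n),
      ((Equiv.Perm.sign τ : ℤ) : ℝ) * ∏ i, f (EuclideanSpace.single i 1) (τ i) := by
    funext f
    rw [det_eq_det_of, Matrix.det_apply']
    rfl
  rw [h]
  refine ContDiff.sum fun τ _ => contDiff_const.mul (contDiff_prod fun i _ => ?_)
  have : ContDiff ℝ N fun f : Vec n →L[ℝ] Vec n => f (EuclideanSpace.single i 1) := by fun_prop
  exact (EuclideanSpace.proj (𝕜 := ℝ) (τ i)).contDiff.comp this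

lemma noiseDensity_pos {n : ℕ} {σ : ℝ} (hσ : 0 < σ) (x : Vec n) : 0 < noiseDensity σ x :=
  Finset.prod_pos fun j _ => gaussianPDFReal_pos _ _ _ (by
    have := Real.toNNReal_pos.2 (show 0 < σ ^ 2 by positivity)
    exact this.ne')

/-- The factor at the actual noise `z` does not depend on the point `v`, so it disappears on
normalising and only misfit differences remain. -/
lemma noiseDensity_sub {n : ℕ} {σ : ℝ} (z w : Vec n) :
    noiseDensity σ (z - w) =
      noiseDensity σ z * Real.exp (-(‖w‖ ^ 2 - 2 * inner ℝ z w) / (2 * σ ^ 2)) := by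
  have h : -(‖w‖ ^ 2 - 2 * inner ℝ z w) / (2 * σ ^ 2) =
      ∑ j, -((w j) ^ 2 - 2 * (z j * w j)) / (2 * σ ^ 2) := by
    rw [← Finset.sum_div, Finset.sum_neg_distrib, Finset.sum_sub_distrib, ← Finset.mul_sum,
      EuclideanSpace.real_norm_sq_eq, inner_eq_dotProduct]
    rfl
  rw [h, Real.exp_sum, noiseDensity, noiseDensity, ← Finset.prod_mul_distrib]
  refine Finset.prod_congr rfl fun j _ => ?_
  rw [gaussianPDFReal, gaussianPDFReal, mul_assoc _ (Real.exp _), ← Real.exp_add,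
    Real.coe_toNNReal _ (sq_nonneg σ)]
  congr 2
  simp only [PiLp.sub_apply, sub_zero]
  ring

/-- A lower Lipschitz bound survives the limit of difference quotients. For the flow it makes the
derivative injective with controlled inverse. -/
lemma norm_fderiv_apply_ge {E F : Type*} [NormedAddCommGroup E] [NormedSpace ℝ E]
    [NormedAddCommGroup F] [NormedSpace ℝ F] {g : E → F} {v : E} (hg : DifferentiableAt ℝ g v)
    {κ : ℝ} (hκ : ∀ᶠ w in nhds v, κ * ‖w - v‖ ≤ ‖g w - g v‖) (y : E) :
    κ * ‖y‖ ≤ ‖fderiv ℝ g v y‖ := by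
  have h1 := (hg.hasFDerivAt.hasLineDerivAt y).tendsto_slope_zero.norm
  refine ge_of_tendsto h1 ?_
  have hlim : Filter.Tendsto (fun t : ℝ => v + t • y) (nhds 0) (nhds v) := by
    have : Continuous fun t : ℝ => v + t • y := by fun_prop
    simpa using this.tendsto 0
  filter_upwards [(hlim.mono_left nhdsWithin_le_nhds).eventually hκ, self_mem_nhdsWithin]
    with t ht ht0
  have ht0' : t ≠ 0 := ht0
  rw [add_sub_cancel_left, norm_smul] at ht
  rw [norm_smul, norm_inv]
  rw [← div_eq_inv_mul, le_div_iff₀ (norm_pos_iff.2 ht0')]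
  linarith

namespace Model
variable {d dₒ : ℕ} (M : Model d dₒ) {T : ℝ}

/-- The least contraction rate of the flow up to time `T`. -/
def rate (T : ℝ) : ℝ := Real.exp (-(M.lip * T))

lemma rate_pos : 0 < M.rate T := Real.exp_pos _

lemma rate_mul_norm_le (hT : 0 ≤ T) {v w : Vec d} (hv : v ∈ M.dom) (hw : w ∈ M.dom) :
    M.rate T * ‖v - w‖ ≤ ‖M.Ψ T v - M.Ψ T w‖ := by
  rw [M.Psi_of_nonneg hT]; exact M.le_norm_forward_sub hv hw hT

lemma rate_mul_norm_Psi_sub_le (hT : 0 ≤ T) {v w : Vec d} (hv : v ∈ M.dom) (hw : w ∈ M.dom) :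
    M.rate T * ‖M.Ψ T v - M.Ψ T w‖ ≤ ‖v - w‖ := by
  rw [M.Psi_of_nonneg hT, rate, Real.exp_neg, inv_mul_le_iff₀ (Real.exp_pos _)]
  exact M.norm_forward_sub_le hv hw hT

lemma differentiableAt_Psi (hT : 0 ≤ T) {v : Vec d} (hv : v ∈ M.dom) :
    DifferentiableAt ℝ (M.Ψ T) v :=
  ((M.contDiffOn_Psi hT).contDiffAt (M.isOpen_dom.mem_nhds hv)).differentiableAt three_ne_zero

lemma rate_mul_norm_le_fderiv (hT : 0 ≤ T) {v : Vec d} (hv : v ∈ M.dom) (y : Vec d) :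
    M.rate T * ‖y‖ ≤ ‖fderiv ℝ (M.Ψ T) v y‖ := by
  refine norm_fderiv_apply_ge (M.differentiableAt_Psi hT hv) ?_ y
  filter_upwards [M.isOpen_dom.mem_nhds hv] with w hw using M.rate_mul_norm_le hT hw hv

lemma rate_mul_norm_fderiv_le (hT : 0 ≤ T) {v : Vec d} (hv : v ∈ M.dom) (y : Vec d) :
    M.rate T * ‖fderiv ℝ (M.Ψ T) v y‖ ≤ ‖y‖ := by
  have h1 : ‖fderiv ℝ (M.Ψ T) v‖ ≤ (M.rate T)⁻¹ := by
    refine (M.differentiableAt_Psi hT hv).hasFDerivAt.le_of_lip' (inv_nonneg.2 M.rate_pos.le) ?_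
    filter_upwards [M.isOpen_dom.mem_nhds hv] with w hw
    rw [le_inv_mul_iff₀ M.rate_pos]
    exact M.rate_mul_norm_Psi_sub_le hT hw hv
  have h2 := ContinuousLinearMap.le_of_opNorm_le _ h1 y
  rwa [le_inv_mul_iff₀ M.rate_pos] at h2

lemma det_fderiv_Psi_ne_zero (hT : 0 ≤ T) {v : Vec d} (hv : v ∈ M.dom) :
    (fderiv ℝ (M.Ψ T) v).det ≠ 0 := by
  have hinj : Function.Injective (fderiv ℝ (M.Ψ T) v : Vec d →ₗ[ℝ] Vec d) := by
    refine (injective_iff_map_eq_zero _).2 fun y hy => ?_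
    have h := M.rate_mul_norm_le_fderiv hT hv y
    have hy' : fderiv ℝ (M.Ψ T) v y = 0 := hy
    rw [hy', norm_zero] at h
    have := M.rate_pos (T := T)
    exact norm_le_zero_iff.1 (by nlinarith [norm_nonneg y])
  have := (LinearEquiv.ofInjectiveEndo _ hinj).isUnit_det'
  exact this.ne_zero

/-- The derivative of the flow as an equivalence. -/
def derivEquiv (hT : 0 ≤ T) {v : Vec d} (hv : v ∈ M.dom) : Vec d ≃L[ℝ] Vec d :=
  (fderiv ℝ (M.Ψ T) v).toContinuousLinearEquivOfDetNeZero (M.det_fderiv_Psi_ne_zero hT hv)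

lemma coe_derivEquiv (hT : 0 ≤ T) {v : Vec d} (hv : v ∈ M.dom) :
    (M.derivEquiv hT hv : Vec d →L[ℝ] Vec d) = fderiv ℝ (M.Ψ T) v := by
  ext1 y; rfl

lemma isOpen_image_Psi (hT : 0 ≤ T) {s : Set (Vec d)} (hs : IsOpen s) (hsd : s ⊆ M.dom) :
    IsOpen (M.Ψ T '' s) := by
  rw [isOpen_iff_mem_nhds]
  rintro _ ⟨v, hv, rfl⟩
  have hst : HasStrictFDerivAt (M.Ψ T) (M.derivEquiv hT (hsd hv) : Vec d →L[ℝ] Vec d) v := by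
    rw [coe_derivEquiv]
    exact ((M.contDiffOn_Psi hT).contDiffAt (M.isOpen_dom.mem_nhds (hsd hv))).hasStrictFDerivAt
      three_ne_zero
  rw [← hst.map_nhds_eq_of_equiv]
  exact Filter.image_mem_map (hs.mem_nhds hv)

/-- The open trapping ball. -/
def openBall : Set (Vec d) := Metric.ball 0 M.R

lemma openBall_subset : M.openBall ⊆ M.ball := Metric.ball_subset_closedBall

lemma openBall_subset_dom : M.openBall ⊆ M.dom := M.openBall_subset.trans M.ball_subset_dom

lemma isOpen_image_openBall (hT : 0 ≤ T) : IsOpen (M.Ψ T '' M.openBall) :=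
  M.isOpen_image_Psi hT Metric.isOpen_ball M.openBall_subset_dom

lemma Psi_neg_Psi (hT : 0 < T) {v : Vec d} (hv : v ∈ M.ball) : M.Ψ (-T) (M.Ψ T v) = v := by
  rw [M.Psi_of_nonneg hT.le]; exact M.Psi_neg_forward hT hv

lemma continuousOn_Psi_neg (hT : 0 < T) : ContinuousOn (M.Ψ (-T)) (M.Ψ T '' M.ball) := by
  refine (LipschitzOnWith.of_dist_le_mul (K := (M.rate T)⁻¹.toNNReal)
    ?_).continuousOn
  rintro _ ⟨v, hv, rfl⟩ _ ⟨w, hw, rfl⟩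
  rw [M.Psi_neg_Psi hT hv, M.Psi_neg_Psi hT hw, dist_eq_norm, dist_eq_norm,
    Real.coe_toNNReal _ (inv_nonneg.2 M.rate_pos.le), le_inv_mul_iff₀ M.rate_pos]
  exact M.rate_mul_norm_le hT.le (M.ball_subset_dom hv) (M.ball_subset_dom hw)

lemma image_mem_nhds (hT : 0 ≤ T) {v : Vec d} (hv : v ∈ M.openBall) :
    M.Ψ T '' M.ball ∈ nhds (M.Ψ T v) :=
  Filter.mem_of_superset ((M.isOpen_image_openBall hT).mem_nhds ⟨v, hv, rfl⟩)
    (Set.image_mono M.openBall_subset)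

/-- At interior points the image of the ball is a neighbourhood, so the derivative within it is the
ordinary derivative of a local inverse. The bounding sphere is negligible later. -/
lemma det_fderivWithin_Psi_neg (hT : 0 < T) {v : Vec d} (hv : v ∈ M.openBall) :
    (fderivWithin ℝ (M.Ψ (-T)) (M.Ψ T '' M.ball) (M.Ψ T v)).det =
      (fderiv ℝ (M.Ψ T) v).det⁻¹ := by
  have hvd := M.openBall_subset_dom hv
  have hnh := M.image_mem_nhds hT.le hv
  have hinv : M.Ψ (-T) (M.Ψ T v) = v := M.Psi_neg_Psi hT (M.openBall_subset hv)
  have h1 : HasFDerivAt (M.Ψ T) (M.derivEquiv hT.le hvd : Vec d →L[ℝ] Vec d)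
      (M.Ψ (-T) (M.Ψ T v)) := by
    rw [hinv, coe_derivEquiv]; exact (M.differentiableAt_Psi hT.le hvd).hasFDerivAt
  have h2 : HasFDerivAt (M.Ψ (-T)) ((M.derivEquiv hT.le hvd).symm : Vec d →L[ℝ] Vec d)
      (M.Ψ T v) := by
    refine HasFDerivAt.of_local_left_inverse ((M.continuousOn_Psi_neg hT).continuousAt hnh) h1 ?_
    filter_upwards [hnh] with y hy
    obtain ⟨w, hw, rfl⟩ := hy
    rw [M.Psi_neg_Psi hT hw]
  rw [fderivWithin_of_mem_nhds hnh, h2.fderiv, ContinuousLinearEquiv.det_coe_symm, coe_derivEquiv]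

/-- The difference of the quadratic misfits at `v` and at the true initial point `u`. -/
def misfit (u : Vec d) (h : ℝ) (k : ℕ) (z : ℕ → Vec dₒ) (v : Vec d) : ℝ :=
  ∑ i ∈ Finset.range (k + 1), (‖M.Φ (i * h) v - M.Φ (i * h) u‖ ^ 2 -
    2 * inner ℝ (z i) (M.Φ (i * h) v - M.Φ (i * h) u))

/-- The prior density transported by the flow. -/
def priorDensity (q : Vec d → ℝ) (T : ℝ) (v : Vec d) : ℝ := q v / |(fderiv ℝ (M.Ψ T) v).det|

variable {u : Vec d} {q : Vec d → ℝ} {σ h : ℝ} {k : ℕ} {z : ℕ → Vec dₒ}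

/-- Flowing back from `Ψ_T v` to time `t_i` lands on `Ψ_{t_i} v`, so in the coordinate `v` no
backward flow remains. -/
lemma filterUnnormalized_apply (hT : 0 < T) (hh : 0 < h) (hk : T = k * h)
    {v : Vec d} (hv : v ∈ M.openBall) :
    M.filterUnnormalized q σ h k (M.obs u h z) (M.Ψ T v) =
      (∏ i ∈ Finset.range (k + 1), noiseDensity σ (z i)) *
        (Real.exp (-(M.misfit u h k z v) / (2 * σ ^ 2)) * M.priorDensity q T v) := by
  have hvb := M.openBall_subset hv
  rw [filterUnnormalized, ← hk, if_pos ⟨v, hvb, rfl⟩, M.det_fderivWithin_Psi_neg hT hv,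
    M.Psi_neg_Psi hT hvb, priorDensity]
  have hprod : ∏ i ∈ Finset.range (k + 1),
      noiseDensity σ (M.obs u h z i - M.Φ (i * h - T) (M.Ψ T v)) =
      (∏ i ∈ Finset.range (k + 1), noiseDensity σ (z i)) *
        Real.exp (-(M.misfit u h k z v) / (2 * σ ^ 2)) := by
    rw [misfit, ← Finset.sum_neg_distrib, Finset.sum_div, Real.exp_sum, ← Finset.prod_mul_distrib]
    refine Finset.prod_congr rfl fun i hi => ?_
    obtain ⟨ht0, htT⟩ := grid_mem hh hk hi
    have h1 : M.Φ (i * h - T) (M.Ψ T v) = M.Φ (i * h) v := by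
      rw [Φ, Φ, M.Psi_of_nonneg hT.le, M.Psi_sub_forward ht0 htT hvb, M.Psi_of_nonneg ht0]
    rw [h1, ← noiseDensity_sub, obs]
    congr 1
    abel
  rw [hprod, abs_inv]
  ring

/-- The differentiable image of the sphere is a null set; it is discarded because the Jacobian of
the inverse is computed at interior points only. -/
lemma filterUnnormalized_ae (hd : 0 < d) (hT : 0 < T) (hh : 0 < h) (hk : T = k * h) :
    ∀ᵐ x, (x ∉ M.Ψ T '' M.ball ∧ M.filterUnnormalized q σ h k (M.obs u h z) x = 0) ∨
      ∃ v ∈ M.openBall, x = M.Ψ T v ∧ M.filterUnnormalized q σ h k (M.obs u h z) x =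
        (∏ i ∈ Finset.range (k + 1), noiseDensity σ (z i)) *
          (Real.exp (-(M.misfit u h k z v) / (2 * σ ^ 2)) * M.priorDensity q T v) := by
  have : Nonempty (Fin d) := ⟨⟨0, hd⟩⟩
  have hnull : volume (M.Ψ T '' Metric.sphere 0 M.R) = 0 := by
    refine addHaar_image_eq_zero_of_differentiableOn_of_addHaar_eq_zero _ (fun v hv => ?_)
      (Measure.addHaar_sphere _ _ _)
    have hvd : v ∈ M.dom := M.ball_subset_dom (Metric.sphere_subset_closedBall hv)
    exact (M.differentiableAt_Psi hT.le hvd).differentiableWithinAt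
  filter_upwards [measure_eq_zero_iff_ae_notMem.1 hnull] with x hx
  by_cases hxi : x ∈ M.Ψ T '' M.ball
  · right
    obtain ⟨v, hv, rfl⟩ := hxi
    have hvo : v ∈ M.openBall := by
      rw [openBall, mem_ball_zero_iff]
      refine lt_of_le_of_ne (M.mem_ball.1 hv) fun h => hx ⟨v, by simpa using h, rfl⟩
    exact ⟨v, hvo, rfl, M.filterUnnormalized_apply hT hh hk hvo⟩
  · left
    refine ⟨hxi, ?_⟩
    rw [filterUnnormalized, ← hk, if_neg hxi]

variable {M}

lemma PriorAssumption.nonneg (hq : M.PriorAssumption q) (v : Vec d) : 0 ≤ q v := by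
  by_cases hv : v ∈ M.ball
  · exact (hq.pos v hv).le
  · rw [hq.zero_outside v hv]

variable (M)

lemma filterUnnormalized_nonneg (hq : M.PriorAssumption q) (hσ : 0 < σ) (y : ℕ → Vec dₒ)
    (x : Vec d) : 0 ≤ M.filterUnnormalized q σ h k y x := by
  rw [filterUnnormalized]
  split_ifs
  · exact mul_nonneg (mul_nonneg (Finset.prod_nonneg fun i _ => (noiseDensity_pos hσ _).le)
      (abs_nonneg _)) (hq.nonneg _)
  · exact le_rfl

lemma continuousOn_det (hT : 0 ≤ T) :
    ContinuousOn (fun v => (fderiv ℝ (M.Ψ T) v).det) M.dom :=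
  ContinuousLinearMap.continuous_det.comp_continuousOn
    ((M.contDiffOn_Psi hT).continuousOn_fderiv_of_isOpen M.isOpen_dom (by norm_num))

lemma continuousOn_priorDensity (hT : 0 ≤ T) (hq : M.PriorAssumption q) :
    ContinuousOn (M.priorDensity q T) M.ball :=
  hq.continuousOn.div ((M.continuousOn_det hT).mono M.ball_subset_dom).abs fun _ hv =>
    abs_ne_zero.2 (M.det_fderiv_Psi_ne_zero hT (M.ball_subset_dom hv))

lemma priorDensity_pos (hT : 0 ≤ T) (hq : M.PriorAssumption q) {v : Vec d} (hv : v ∈ M.ball) :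
    0 < M.priorDensity q T v :=
  div_pos (hq.pos v hv) (abs_pos.2 (M.det_fderiv_Psi_ne_zero hT (M.ball_subset_dom hv)))

lemma continuousOn_Phi {t : ℝ} (ht : 0 ≤ t) : ContinuousOn (M.Φ t) M.dom := by
  have h1 : ContinuousOn (M.Ψ t) M.dom := fun v hv =>
    (M.differentiableAt_Psi ht hv).continuousAt.continuousWithinAt
  exact M.H.continuous.comp_continuousOn h1

lemma continuousOn_misfit (hh : 0 < h) : ContinuousOn (M.misfit u h k z) M.dom := by
  unfold misfit
  refine continuousOn_finsetSum _ fun i _ => ?_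
  have h1 : ContinuousOn (fun v => M.Φ (i * h) v - M.Φ (i * h) u) M.dom :=
    (M.continuousOn_Phi (by positivity)).sub continuousOn_const
  exact (h1.norm.pow 2).sub (continuousOn_const.mul (continuousOn_const.inner h1))

/-- Almost everywhere this is the indicator of an open set times a function continuous on it. -/
lemma aestronglyMeasurable_filterUnnormalized (hd : 0 < d) (hT : 0 < T) (hh : 0 < h)
    (hk : T = k * h) (hq : M.PriorAssumption q) :
    AEStronglyMeasurable (M.filterUnnormalized q σ h k (M.obs u h z)) := by
  set c₀ := ∏ i ∈ Finset.range (k + 1), noiseDensity σ (z i) with hc₀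
  set s := M.Ψ T '' M.openBall with hs
  set g : Vec d → ℝ := fun x => c₀ * (Real.exp (-(M.misfit u h k z (M.Ψ (-T) x)) / (2 * σ ^ 2)) *
    M.priorDensity q T (M.Ψ (-T) x)) with hg
  have hso : IsOpen s := M.isOpen_image_openBall hT.le
  have hcont : ContinuousOn g s := by
    have h1 : ContinuousOn (M.Ψ (-T)) s :=
      (M.continuousOn_Psi_neg hT).mono (Set.image_mono M.openBall_subset)
    have hmaps : Set.MapsTo (M.Ψ (-T)) s M.ball := by
      rintro _ ⟨v, hv, rfl⟩
      rw [M.Psi_neg_Psi hT (M.openBall_subset hv)]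
      exact M.openBall_subset hv
    have h2 : ContinuousOn (fun x => M.misfit u h k z (M.Ψ (-T) x)) s :=
      (M.continuousOn_misfit hh).comp h1 (hmaps.mono_right M.ball_subset_dom)
    have h3 : ContinuousOn (fun x => M.priorDensity q T (M.Ψ (-T) x)) s :=
      (M.continuousOn_priorDensity hT.le hq).comp h1 hmaps
    exact continuousOn_const.mul ((h2.neg.div_const _).rexp.mul h3)
  have hm : AEStronglyMeasurable (s.indicator g) :=
    (aestronglyMeasurable_indicator_iff hso.measurableSet).2
      (hcont.aestronglyMeasurable hso.measurableSet)
  refine hm.congr ?_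
  filter_upwards [M.filterUnnormalized_ae (q := q) (σ := σ) (u := u) (z := z) hd hT hh hk] with x hx
  rcases hx with ⟨hx1, hx2⟩ | ⟨v, hv, rfl, hx2⟩
  · rw [hx2, Set.indicator_of_notMem fun h => hx1 (Set.image_mono M.openBall_subset h)]
  · rw [hx2, Set.indicator_of_mem (Set.mem_image_of_mem _ hv)]
    simp only [hg, M.Psi_neg_Psi hT (M.openBall_subset hv)]
    rfl

end Model
end GaussFilter
end

/-! ### Uniform constants on the trapping ball. -/

noncomputable section
open MeasureTheory ProbabilityTheory
namespace GaussFilter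
namespace Model
variable {d dₒ : ℕ} (M : Model d dₒ) {T : ℝ}

/-- Uniform estimates on the flow, its derivatives and the transported prior on the trapping ball,
with one constant `C` and one radius `ρ`. -/
structure FlowBounds (u : Vec d) (q : Vec d → ℝ) (T hmax : ℝ) (hT : 0 ≤ T) (C ρ : ℝ) : Prop where
  one_le : 1 ≤ C
  rho_pos : 0 < ρ
  rho_lt : ‖u‖ + ρ < M.R
  time_le : T + hmax ≤ C
  noise_le : ‖M.H‖ * (1 + T) ≤ C
  obs_le : ∀ t, ‖M.obsAt hT t‖ ≤ C
  deriv_le : ‖fderiv ℝ (M.initVelocity T) u‖ ≤ C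
  deriv₂_le : ∀ a b, ‖fderiv ℝ (fderiv ℝ (M.initVelocity T)) u a b‖ ≤ C * ‖a‖ * ‖b‖
  lip : ∀ v ∈ M.ball, ‖M.initVelocity T v - M.initVelocity T u‖ ≤ C * ‖v - u‖
  taylor : ∀ v ∈ M.ball, ‖M.initVelocity T v - M.initVelocity T u -
    fderiv ℝ (M.initVelocity T) u (v - u)‖ ≤ C * ‖v - u‖ ^ 2
  taylor₂ : ∀ v ∈ M.ball, ‖M.initVelocity T v - M.initVelocity T u -
    fderiv ℝ (M.initVelocity T) u (v - u) -
    (1 / 2 : ℝ) • fderiv ℝ (fderiv ℝ (M.initVelocity T)) u (v - u) (v - u)‖ ≤ C * ‖v - u‖ ^ 3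
  flow_taylor : ∀ v ∈ M.ball, ∀ w ∈ M.ball,
    ‖M.Ψ T v - M.Ψ T w - fderiv ℝ (M.Ψ T) w (v - w)‖ ≤ C * ‖v - w‖ ^ 2
  prior_near : ∀ v w, ‖v‖ ≤ ‖u‖ + ρ → ‖w‖ ≤ ‖u‖ + ρ →
    |M.priorDensity q T v / M.priorDensity q T w - 1| ≤ C * ‖v - w‖
  prior_far : ∀ v ∈ M.ball, ∀ w, ‖w‖ ≤ ‖u‖ + ρ →
    M.priorDensity q T v / M.priorDensity q T w ≤ C
  exit : ∀ w, ‖w‖ ≤ ‖u‖ + ρ → ∀ x ∉ M.Ψ T '' M.ball, ρ ≤ ‖x - M.Ψ T w‖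

lemma exists_bilinear_le {E F : Type*} [NormedAddCommGroup E] [NormedSpace ℝ E]
    [NormedAddCommGroup F] [NormedSpace ℝ F] (B : E →L[ℝ] E →L[ℝ] F) :
    ∃ C, 0 ≤ C ∧ ∀ a b, ‖B a b‖ ≤ C * ‖a‖ * ‖b‖ :=
  ⟨‖B‖, norm_nonneg B, B.le_opNorm₂⟩

lemma isCompact_ball : IsCompact M.ball := isCompact_closedBall 0 M.R

lemma convex_ball : Convex ℝ M.ball := convex_closedBall 0 M.R

lemma exists_prior_near (hT : 0 ≤ T) {q : Vec d → ℝ} (hq : M.PriorAssumption q) {r : ℝ}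
    (hr0 : 0 ≤ r) (hr : r < M.R) :
    ∃ C, 0 ≤ C ∧ ∀ v w, ‖v‖ ≤ r → ‖w‖ ≤ r →
      |M.priorDensity q T v / M.priorDensity q T w - 1| ≤ C * ‖v - w‖ := by
  have hsub : Metric.closedBall (0 : Vec d) r ⊆ M.openBall := Metric.closedBall_subset_ball hr
  have hdet : ContDiffOn ℝ 1 (fun v => (fderiv ℝ (M.Ψ T) v).det) M.dom :=
    contDiff_det.comp_contDiffOn ((M.contDiffOn_Psi hT).fderiv_of_isOpen M.isOpen_dom (by norm_num))
  have hG : ContDiffOn ℝ 1 (fun v => q v / (fderiv ℝ (M.Ψ T) v).det) M.openBall :=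
    (hq.contDiffOn.of_le (by norm_num)).div (hdet.mono M.openBall_subset_dom)
      fun v hv => M.det_fderiv_Psi_ne_zero hT (M.openBall_subset_dom hv)
  obtain ⟨L, hL0, hL⟩ := exists_lipschitz Metric.isOpen_ball hG (isCompact_closedBall 0 r)
    (convex_closedBall 0 r) hsub
  -- The quotient without absolute value is `C¹`, hence Lipschitz on the compact ball; taking
  -- absolute values preserves the Lipschitz constant.
  have habs : ∀ v, M.priorDensity q T v = |q v / (fderiv ℝ (M.Ψ T) v).det| := by
    intro v; rw [priorDensity, abs_div, abs_of_nonneg (hq.nonneg v)]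
  obtain ⟨w₀, hw₀, hmin⟩ := (isCompact_closedBall (0 : Vec d) r).exists_isMinOn
    ⟨0, by simpa using hr0⟩
    ((M.continuousOn_priorDensity hT hq).mono (hsub.trans M.openBall_subset))
  have hm := M.priorDensity_pos hT hq (M.openBall_subset (hsub hw₀))
  refine ⟨L / M.priorDensity q T w₀, by positivity, fun v w hv hw => ?_⟩
  have hv' : v ∈ Metric.closedBall (0 : Vec d) r := by simpa using hv
  have hw' : w ∈ Metric.closedBall (0 : Vec d) r := by simpa using hw
  have hwpos := M.priorDensity_pos hT hq (M.openBall_subset (hsub hw'))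
  rw [div_sub_one hwpos.ne', abs_div, abs_of_pos hwpos, div_mul_eq_mul_div]
  have h1 : |M.priorDensity q T v - M.priorDensity q T w| ≤ L * ‖v - w‖ := by
    rw [habs, habs]
    exact (abs_abs_sub_abs_le _ _).trans (hL v hv' w hw')
  exact div_le_div₀ (by positivity) h1 hm (hmin hw')

lemma exists_prior_far (hT : 0 ≤ T) {q : Vec d → ℝ} (hq : M.PriorAssumption q) :
    ∃ C, 0 ≤ C ∧ ∀ v ∈ M.ball, ∀ w ∈ M.ball,
      M.priorDensity q T v / M.priorDensity q T w ≤ C := by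
  have hne : M.ball.Nonempty := ⟨0, by rw [mem_ball, norm_zero]; exact M.R_pos.le⟩
  obtain ⟨v₀, hv₀, hmax⟩ := M.isCompact_ball.exists_isMaxOn hne (M.continuousOn_priorDensity hT hq)
  obtain ⟨w₀, hw₀, hmin⟩ := M.isCompact_ball.exists_isMinOn hne (M.continuousOn_priorDensity hT hq)
  have h1 := M.priorDensity_pos hT hq hv₀
  have h2 := M.priorDensity_pos hT hq hw₀
  exact ⟨_, by positivity, fun v hv w hw => div_le_div₀ h1.le (hmax hv) h2 (hmin hw)⟩

/-- A compact set inside an open set has positive distance to the complement. Points where the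
filter density vanishes are thus far from the Gaussian's centre. -/
lemma exists_exit (hT : 0 ≤ T) {r : ℝ} (hr : r < M.R) :
    ∃ δ, 0 < δ ∧ ∀ w, ‖w‖ ≤ r → ∀ x ∉ M.Ψ T '' M.ball, δ ≤ ‖x - M.Ψ T w‖ := by
  have hsub : Metric.closedBall (0 : Vec d) r ⊆ M.openBall := Metric.closedBall_subset_ball hr
  have hcont : ContinuousOn (M.Ψ T) (Metric.closedBall 0 r) :=
    ((M.contDiffOn_Psi hT).continuousOn).mono (hsub.trans M.openBall_subset_dom)
  obtain ⟨δ, hδ, hδs⟩ := ((isCompact_closedBall (0 : Vec d) r).image_of_continuousOn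
    hcont).exists_thickening_subset_open (M.isOpen_image_openBall hT) (Set.image_mono hsub)
  refine ⟨δ, hδ, fun w hw x hx => ?_⟩
  by_contra! hlt
  refine hx (Set.image_mono M.openBall_subset (hδs ?_))
  exact Metric.mem_thickening_iff.2 ⟨M.Ψ T w, ⟨w, by simpa using hw, rfl⟩, by rwa [dist_eq_norm]⟩

lemma exists_flowBounds {u : Vec d} {q : Vec d → ℝ} {hmax : ℝ} (hT : 0 ≤ T)
    (hu : ‖u‖ < M.R) (hq : M.PriorAssumption q) :
    ∃ C ρ, M.FlowBounds u q T hmax hT C ρ := by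
  have hub : u ∈ M.ball := M.mem_ball.2 hu.le
  have hP := M.contDiffOn_initVelocity hT
  have hc := M.isCompact_ball
  have hcv := M.convex_ball
  have hsub := M.ball_subset_dom
  have ho := M.isOpen_dom
  obtain ⟨C₁, h₁0, h₁⟩ := exists_lipschitz ho (hP.of_le (by norm_num)) hc hcv hsub
  obtain ⟨C₂, h₂0, h₂⟩ := exists_taylor_one ho (hP.of_le (by norm_num)) hc hcv hsub
  obtain ⟨C₃, h₃0, h₃⟩ := exists_taylor_two ho hP hc hcv hsub
  obtain ⟨C₄, h₄0, h₄⟩ := exists_taylor_one ho ((M.contDiffOn_Psi hT).of_le (by norm_num))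
    hc hcv hsub
  -- The midpoint leaves room for the centre and its neighbourhood strictly inside the ball, where
  -- the prior is smooth.
  set r := (‖u‖ + M.R) / 2 with hr
  have hrR : r < M.R := by rw [hr]; linarith
  obtain ⟨C₅, h₅0, h₅⟩ := M.exists_prior_near hT hq (r := r)
    (by have := norm_nonneg u; rw [hr]; linarith) hrR
  obtain ⟨C₆, h₆0, h₆⟩ := M.exists_prior_far hT hq
  obtain ⟨δ, hδ, hexit⟩ := M.exists_exit hT hrR
  set ρ := min δ ((M.R - ‖u‖) / 2) with hρ
  have hρ1 : ρ ≤ δ := min_le_left _ _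
  have hρr : ‖u‖ + ρ ≤ r := by
    have := min_le_right δ ((M.R - ‖u‖) / 2); rw [hr]; linarith
  have a₁ : 0 ≤ ‖M.H‖ * (1 + T) := by positivity
  have a₂ : 0 ≤ ‖M.H‖ * ‖pathOfVelocity (E := Vec d) hT‖ := by positivity
  have a₃ := norm_nonneg (fderiv ℝ (M.initVelocity T) u)
  obtain ⟨C₇, h₇0, h₇⟩ := exists_bilinear_le (fderiv ℝ (fderiv ℝ (M.initVelocity T)) u)
  have a₅ := le_abs_self (T + hmax)
  have a₆ := abs_nonneg (T + hmax)
  set C := 1 + |T + hmax| + ‖M.H‖ * (1 + T) + ‖M.H‖ * ‖pathOfVelocity (E := Vec d) hT‖ +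
    ‖fderiv ℝ (M.initVelocity T) u‖ + C₇ +
    C₁ + C₂ + C₃ + C₄ + C₅ + C₆ with hC
  have up : ∀ {a b x : ℝ}, 0 ≤ x → a ≤ b * x → b ≤ C → a ≤ C * x := fun hx h hb =>
    h.trans (mul_le_mul_of_nonneg_right hb hx)
  refine ⟨C, ρ, ⟨by linarith, lt_min hδ (by linarith), by linarith, by linarith, by linarith,
    fun t => (M.norm_obsAt_le hT t).trans (by linarith), by linarith,
    fun a b => (h₇ a b).trans (by gcongr; linarith),
    fun v hv => up (by positivity) (h₁ v hv u hub) (by linarith),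
    fun v hv => up (by positivity) (h₂ v hv u hub) (by linarith),
    fun v hv => up (by positivity) (h₃ v hv u hub) (by linarith),
    fun v hv w hw => up (by positivity) (h₄ v hv w hw) (by linarith),
    fun v w hv hw => up (by positivity) (h₅ v w (hv.trans hρr) (hw.trans hρr)) (by linarith),
    fun v hv w hw => (h₆ v hv w ?_).trans (by linarith),
    fun w hw x hx => hρ1.trans (hexit w (hw.trans hρr) x hx)⟩⟩
  rw [mem_ball]
  linarith

end Model
end GaussFilter
end

/-! ### Quadratic forms, bounds on `A_k`, and expansion of the misfit. -/

noncomputable section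
open MeasureTheory ProbabilityTheory
namespace GaussFilter

section Bilinear
variable {n : ℕ} (A : Matrix (Fin n) (Fin n) ℝ)

/-- The bilinear form of a matrix. -/
def form (x y : Vec n) : ℝ := dotProduct x.ofLp (A.mulVec y.ofLp)

lemma form_sub_left (x x' y : Vec n) : form A (x - x') y = form A x y - form A x' y := by
  simp [form, sub_dotProduct]

lemma form_add_right (x y y' : Vec n) : form A x (y + y') = form A x y + form A x y' := by
  simp [form, Matrix.mulVec_add]

lemma form_sub_right (x y y' : Vec n) : form A x (y - y') = form A x y - form A x y' := by
  simp [form, Matrix.mulVec_sub]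

lemma form_smul_one (r : ℝ) (x : Vec n) : form (r • 1) x x = r * ‖x‖ ^ 2 := by
  rw [form, Matrix.smul_mulVec, Matrix.one_mulVec, dotProduct_smul, ← inner_eq_dotProduct,
    real_inner_self_eq_norm_sq, smul_eq_mul]

lemma posDef_of_form {A : Matrix (Fin n) (Fin n) ℝ} (hs : ∀ x y, form A x y = form A y x)
    (hp : ∀ x, x ≠ 0 → 0 < form A x x) : A.PosDef := by
  refine Matrix.PosDef.of_dotProduct_mulVec_pos ?_ fun x hx => ?_
  · ext i j
    have := hs (EuclideanSpace.single i 1) (EuclideanSpace.single j 1)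
    simp [form] at this
    simpa using this.symm
  · have := hp (WithLp.toLp 2 x) fun h => hx (by simpa using congrArg WithLp.ofLp h)
    simpa [form] using this

end Bilinear

namespace Model
variable {d dₒ : ℕ} (M : Model d dₒ) {T : ℝ}

/-- The sum of the squared observations on the time grid. -/
def obsEnergy (hT : 0 ≤ T) (h : ℝ) (k : ℕ) (p : Vec d × C(Set.Icc (0 : ℝ) T, Vec d)) : ℝ :=
  ∑ i ∈ Finset.range (k + 1), ‖M.obsAt hT (i * h) p‖ ^ 2

variable {u : Vec d} {q : Vec d → ℝ} {h hmax c C ρ η : ℝ} {k : ℕ} {z : ℕ → Vec dₒ}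

lemma continuous_obsEnergy (hT : 0 ≤ T) : Continuous (M.obsEnergy hT h k) := by
  unfold obsEnergy; fun_prop

lemma obsEnergy_smul (hT : 0 ≤ T) (r : ℝ) (p : Vec d × C(Set.Icc (0 : ℝ) T, Vec d)) :
    M.obsEnergy hT h k (r • p) = r ^ 2 * M.obsEnergy hT h k p := by
  simp only [obsEnergy, map_smul, norm_smul, mul_pow, Finset.mul_sum, Real.norm_eq_abs, sq_abs]

lemma obsEnergy_Phi (hT : 0 ≤ T) (hh : 0 < h) (hk : T = k * h) {v : Vec d} (hu : u ∈ M.dom)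
    (hv : v ∈ M.dom) :
    M.obsEnergy hT h k (M.initVelocity T v - M.initVelocity T u) =
      ∑ i ∈ Finset.range (k + 1), ‖M.Φ (i * h) v - M.Φ (i * h) u‖ ^ 2 := by
  refine Finset.sum_congr rfl fun i hi => ?_
  have ht := grid_mem hh hk hi
  rw [map_sub, M.Phi_eq_obsAt hT ht hv, M.Phi_eq_obsAt hT ht hu]

lemma misfit_eq (hT : 0 ≤ T) (hh : 0 < h) (hk : T = k * h) {v : Vec d} (hu : u ∈ M.dom)
    (hv : v ∈ M.dom) :
    M.misfit u h k z v = M.obsEnergy hT h k (M.initVelocity T v - M.initVelocity T u) -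
      2 * M.noiseFun hT h k z (M.initVelocity T v - M.initVelocity T u) := by
  rw [M.obsEnergy_Phi hT hh hk hu hv, noiseFun_apply, Finset.mul_sum, ← Finset.sum_sub_distrib]
  refine Finset.sum_congr rfl fun i hi => ?_
  have ht := grid_mem hh hk hi
  rw [map_sub, M.Phi_eq_obsAt hT ht hv, M.Phi_eq_obsAt hT ht hu]

lemma form_Ak (hT : 0 ≤ T) (hh : 0 < h) (hk : T = k * h) (hu : u ∈ M.dom) (x : Vec d) :
    form (M.Ak u h k z) x x = M.obsEnergy hT h k (fderiv ℝ (M.initVelocity T) u x) -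
      M.noiseFun hT h k z (fderiv ℝ (fderiv ℝ (M.initVelocity T)) u x x) := by
  rw [form, M.dotProduct_Ak_mulVec hT hh hk hu]
  simp only [real_inner_self_eq_norm_sq, obsEnergy]

lemma form_Ak_symm (hT : 0 ≤ T) (hh : 0 < h) (hk : T = k * h) (hu : u ∈ M.dom) (x y : Vec d) :
    form (M.Ak u h k z) x y = form (M.Ak u h k z) y x := by
  have hs : IsSymmSndFDerivAt ℝ (M.initVelocity T) u :=
    (M.contDiffAt_initVelocity hT hu).isSymmSndFDerivAt (by simp; norm_num)
  rw [form, form, M.dotProduct_Ak_mulVec hT hh hk hu, M.dotProduct_Ak_mulVec hT hh hk hu, hs x y]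
  simp only [real_inner_comm]

variable {M}

lemma InitialAssumption.mem_ball (hu : M.InitialAssumption u T hmax c) : u ∈ M.ball :=
  M.mem_ball.2 hu.norm_lt.le

lemma InitialAssumption.mem_dom (hu : M.InitialAssumption u T hmax c) : u ∈ M.dom :=
  M.ball_subset_dom hu.mem_ball

lemma InitialAssumption.obsEnergy_ge (hu : M.InitialAssumption u T hmax c) (hh : 0 < h)
    (hle : h ≤ hmax) (hk : T = k * h) {v : Vec d} (hv : v ∈ M.ball) :
    c / h * ‖v - u‖ ^ 2 ≤
      M.obsEnergy hu.T_pos.le h k (M.initVelocity T v - M.initVelocity T u) := by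
  rw [M.obsEnergy_Phi hu.T_pos.le hh hk hu.mem_dom (M.ball_subset_dom hv), norm_sub_rev]
  exact hu.lower k h hh hle hk v hv

/-- Linearised identifiability: divide the assumption at `v = u + t x` by `t²` and let `t` tend to
zero. -/
lemma InitialAssumption.obsEnergy_fderiv_ge (hu : M.InitialAssumption u T hmax c) (hh : 0 < h)
    (hle : h ≤ hmax) (hk : T = k * h) (x : Vec d) :
    c / h * ‖x‖ ^ 2 ≤ M.obsEnergy hu.T_pos.le h k (fderiv ℝ (M.initVelocity T) u x) := by
  have hdiff : DifferentiableAt ℝ (M.initVelocity T) u :=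
    (M.contDiffAt_initVelocity hu.T_pos.le hu.mem_dom).differentiableAt three_ne_zero
  have h1 := (hdiff.hasFDerivAt.hasLineDerivAt x).tendsto_slope_zero
  have h2 := ((M.continuous_obsEnergy (h := h) (k := k) hu.T_pos.le).tendsto _).comp h1
  refine ge_of_tendsto h2 ?_
  have hlim : Filter.Tendsto (fun t : ℝ => u + t • x) (nhds 0) (nhds u) := by
    have : Continuous fun t : ℝ => u + t • x := by fun_prop
    simpa using this.tendsto 0
  have hnh : M.openBall ∈ nhds u := Metric.isOpen_ball.mem_nhds (by simpa using hu.norm_lt)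
  filter_upwards [(hlim.mono_left nhdsWithin_le_nhds).eventually hnh, self_mem_nhdsWithin]
    with t ht ht0
  have ht0' : t ≠ 0 := ht0
  have := hu.obsEnergy_ge hh hle hk (M.openBall_subset ht)
  rw [add_sub_cancel_left, norm_smul, mul_pow, Real.norm_eq_abs, sq_abs] at this
  rw [Function.comp_apply, obsEnergy_smul, inv_pow, le_inv_mul_iff₀ (by positivity)]
  linarith

/-- From `‖a‖² - ‖b‖² = ⟨a - b, a + b⟩`: a Taylor remainder in one factor is multiplied by a
first-order quantity in the other. -/
lemma obsEnergy_sub_le (hT : 0 ≤ T) (hC : 0 ≤ C) (ho : ∀ t, ‖M.obsAt hT t‖ ≤ C)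
    (p p' : Vec d × C(Set.Icc (0 : ℝ) T, Vec d)) :
    |M.obsEnergy hT h k p - M.obsEnergy hT h k p'| ≤
      (k + 1) * C ^ 2 * (‖p - p'‖ * ‖p + p'‖) := by
  rw [obsEnergy, obsEnergy, ← Finset.sum_sub_distrib]
  refine (Finset.abs_sum_le_sum_abs _ _).trans ?_
  refine (Finset.sum_le_card_nsmul _ _ (C ^ 2 * (‖p - p'‖ * ‖p + p'‖)) fun i _ => ?_).trans_eq ?_
  · have : ‖M.obsAt hT (i * h) p‖ ^ 2 - ‖M.obsAt hT (i * h) p'‖ ^ 2 =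
        inner ℝ (M.obsAt hT (i * h) (p - p')) (M.obsAt hT (i * h) (p + p')) := by
      rw [map_sub, map_add, inner_sub_left, inner_add_right, inner_add_right,
        real_inner_self_eq_norm_sq, real_inner_self_eq_norm_sq,
        real_inner_comm (M.obsAt hT (i * h) p)]
      ring
    rw [this]
    refine (abs_real_inner_le_norm _ _).trans ?_
    have b := fun y => ContinuousLinearMap.le_of_opNorm_le _ (ho (i * h)) y
    calc _ ≤ (C * ‖p - p'‖) * (C * ‖p + p'‖) := by gcongr <;> exact b _
      _ = _ := by ring
  · simp; ring

namespace FlowBounds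
variable {hT : 0 ≤ T} (B : M.FlowBounds u q T hmax hT C ρ)
include B

lemma pos : 0 < C := one_pos.trans_le B.one_le

lemma succ_le (hh : 0 < h) (hle : h ≤ hmax) (hk : T = k * h) : (k + 1 : ℝ) ≤ C / h := by
  rw [le_div_iff₀ hh]
  have := B.time_le
  linarith

lemma mem_dom : u ∈ M.dom := M.ball_subset_dom (M.mem_ball.2 (by linarith [B.rho_pos, B.rho_lt]))

lemma norm_fderiv_le (x : Vec d) : ‖fderiv ℝ (M.initVelocity T) u x‖ ≤ C * ‖x‖ :=
  ContinuousLinearMap.le_of_opNorm_le _ B.deriv_le x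

lemma abs_form_le (hh : 0 < h) (hle : h ≤ hmax) (hk : T = k * h)
    (hη : ‖M.noiseFun hT h k z‖ ≤ η / h) (x y : Vec d) :
    |form (M.Ak u h k z) x y| ≤ (C ^ 5 + C * η) / h * (‖x‖ * ‖y‖) := by
  have hC := B.pos
  rw [form, M.dotProduct_Ak_mulVec hT hh hk B.mem_dom]
  have h1 : |∑ i ∈ Finset.range (k + 1),
      inner ℝ (M.obsAt hT (i * h) (fderiv ℝ (M.initVelocity T) u x))
        (M.obsAt hT (i * h) (fderiv ℝ (M.initVelocity T) u y))| ≤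
      (k + 1) * (C ^ 4 * (‖x‖ * ‖y‖)) := by
    refine (Finset.abs_sum_le_sum_abs _ _).trans ?_
    refine (Finset.sum_le_card_nsmul _ _ (C ^ 4 * (‖x‖ * ‖y‖)) fun i _ => ?_).trans_eq (by simp)
    refine (abs_real_inner_le_norm _ _).trans ?_
    have b : ∀ y, ‖M.obsAt hT (i * h) (fderiv ℝ (M.initVelocity T) u y)‖ ≤ C * (C * ‖y‖) :=
      fun y => (ContinuousLinearMap.le_of_opNorm_le _ (B.obs_le (i * h)) _).trans
        (by gcongr; exact B.norm_fderiv_le y)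
    calc _ ≤ (C * (C * ‖x‖)) * (C * (C * ‖y‖)) := by gcongr <;> exact b _
      _ = _ := by ring
  have h2 : |M.noiseFun hT h k z (fderiv ℝ (fderiv ℝ (M.initVelocity T)) u x y)| ≤
      η / h * (C * ‖x‖ * ‖y‖) := by
    have := ContinuousLinearMap.le_of_opNorm_le _ hη
      (fderiv ℝ (fderiv ℝ (M.initVelocity T)) u x y)
    have h0 : 0 ≤ η / h := (norm_nonneg (M.noiseFun hT h k z)).trans hη
    exact this.trans (by gcongr; exact B.deriv₂_le x y)
  refine (abs_sub _ _).trans ((add_le_add h1 h2).trans ?_)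
  calc _ ≤ C / h * (C ^ 4 * (‖x‖ * ‖y‖)) + η / h * (C * ‖x‖ * ‖y‖) := by
        gcongr; exact B.succ_le hh hle hk
    _ = _ := by ring

lemma abs_noise_le (hη : ‖M.noiseFun hT h k z‖ ≤ η / h) (x : Vec d) :
    |M.noiseFun hT h k z (fderiv ℝ (fderiv ℝ (M.initVelocity T)) u x x)| ≤
      C * η / h * ‖x‖ ^ 2 := by
  have := ContinuousLinearMap.le_of_opNorm_le _ hη (fderiv ℝ (fderiv ℝ (M.initVelocity T)) u x x)
  have h0 : 0 ≤ η / h := (norm_nonneg (M.noiseFun hT h k z)).trans hη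
  calc _ ≤ η / h * (C * ‖x‖ * ‖x‖) := this.trans (by gcongr; exact B.deriv₂_le x x)
    _ = _ := by ring

lemma form_ge (hu : M.InitialAssumption u T hmax c) (hh : 0 < h) (hle : h ≤ hmax) (hk : T = k * h)
    (hη : ‖M.noiseFun hT h k z‖ ≤ η / h) (x : Vec d) :
    (c - C * η) / h * ‖x‖ ^ 2 ≤ form (M.Ak u h k z) x x := by
  rw [M.form_Ak hT hh hk B.mem_dom]
  have h1 := hu.obsEnergy_fderiv_ge hh hle hk x
  have h2 := le_of_abs_le (B.abs_noise_le hη x)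
  rw [sub_div, sub_mul]
  linarith

lemma norm_fderiv_Phi_le_Mhat {t : ℝ} (ht : t ∈ Set.Icc 0 T) :
    ‖fderiv ℝ (M.Φ t) u‖ ≤ M.Mhat₁ T := by
  have hC := B.pos
  obtain ⟨D, hD0, hD⟩ := exists_norm_fderiv_le M.isOpen_dom
    ((M.contDiffOn_initVelocity hT).of_le (by norm_num)) M.isCompact_ball M.ball_subset_dom
  -- The set must be shown bounded, since otherwise its `sSup` would be the default value `0`.
  refine le_csSup ⟨C * D, ?_⟩ ⟨u, M.mem_ball.2 (by linarith [B.rho_pos, B.rho_lt]), t, ht, rfl⟩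
  rintro _ ⟨v, hv, t, ht, rfl⟩
  rw [M.fderiv_Phi hT ht (M.ball_subset_dom hv)]
  refine (ContinuousLinearMap.opNorm_comp_le _ _).trans ?_
  gcongr
  · exact B.obs_le t
  · exact hD v hv

lemma form_le (hh : 0 < h) (hle : h ≤ hmax) (hk : T = k * h)
    (hη : ‖M.noiseFun hT h k z‖ ≤ η / h) (x : Vec d) :
    form (M.Ak u h k z) x x ≤ (M.Mhat₁ T ^ 2 * (T + hmax) + C * η) / h * ‖x‖ ^ 2 := by
  rw [M.form_Ak hT hh hk B.mem_dom]
  have h2 := neg_le_of_abs_le (B.abs_noise_le hη x)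
  have h1 : M.obsEnergy hT h k (fderiv ℝ (M.initVelocity T) u x) ≤
      (k + 1) * (M.Mhat₁ T ^ 2 * ‖x‖ ^ 2) := by
    refine (Finset.sum_le_card_nsmul _ _ (M.Mhat₁ T ^ 2 * ‖x‖ ^ 2) fun i hi => ?_).trans_eq
      (by simp)
    have ht := grid_mem hh hk hi
    have := ContinuousLinearMap.le_of_opNorm_le _ (B.norm_fderiv_Phi_le_Mhat ht) x
    rw [M.fderiv_Phi hT ht B.mem_dom] at this
    rw [← mul_pow]
    gcongr
    exact this
  have h3 : (k + 1 : ℝ) ≤ (T + hmax) / h := by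
    rw [le_div_iff₀ hh]; linarith
  have h4 : (k + 1) * (M.Mhat₁ T ^ 2 * ‖x‖ ^ 2) ≤ (T + hmax) / h * (M.Mhat₁ T ^ 2 * ‖x‖ ^ 2) := by
    gcongr
  rw [add_div, add_mul]
  have e : M.Mhat₁ T ^ 2 * (T + hmax) / h * ‖x‖ ^ 2 =
    (T + hmax) / h * (M.Mhat₁ T ^ 2 * ‖x‖ ^ 2) := by ring
  rw [e]
  linarith

/-- The energy is quadratic, so a first-order expansion of the trajectory already gives a cubic
error. The noise term is linear and needs the second-order expansion, whose quadratic part is the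
random part of `Ak`. -/
lemma abs_misfit_sub_le (hh : 0 < h) (hle : h ≤ hmax) (hk : T = k * h)
    (hη : ‖M.noiseFun hT h k z‖ ≤ η / h) {v : Vec d} (hv : v ∈ M.ball) :
    |M.misfit u h k z v - (form (M.Ak u h k z) (v - u) (v - u) -
      2 * dotProduct (v - u).ofLp (M.Bk u h k z))| ≤
      (2 * C ^ 5 + 2 * C * η) / h * ‖v - u‖ ^ 3 := by
  have hC := B.pos
  have h0 : 0 ≤ η / h := (norm_nonneg (M.noiseFun hT h k z)).trans hη
  rw [M.misfit_eq hT hh hk B.mem_dom (M.ball_subset_dom hv), M.form_Ak hT hh hk B.mem_dom,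
    M.dotProduct_Bk hT hh hk B.mem_dom]
  set Δ := M.initVelocity T v - M.initVelocity T u with hΔ
  set D := fderiv ℝ (M.initVelocity T) u (v - u) with hD
  set D₂ := fderiv ℝ (fderiv ℝ (M.initVelocity T)) u (v - u) (v - u) with hD₂
  have h1 := obsEnergy_sub_le (h := h) (k := k) hT hC.le B.obs_le Δ D
  have h2 : ‖Δ + D‖ ≤ 2 * C * ‖v - u‖ := by
    refine (norm_add_le _ _).trans ?_
    linarith [B.lip v hv, B.norm_fderiv_le (v - u)]
  have h3 : |M.obsEnergy hT h k Δ - M.obsEnergy hT h k D| ≤ 2 * C ^ 5 / h * ‖v - u‖ ^ 3 := by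
    refine h1.trans ?_
    calc _ ≤ C / h * C ^ 2 * ((C * ‖v - u‖ ^ 2) * (2 * C * ‖v - u‖)) := by
          gcongr
          · exact B.succ_le hh hle hk
          · exact B.taylor v hv
      _ = 2 * C ^ 5 / h * ‖v - u‖ ^ 3 := by ring
  have h4 : |M.noiseFun hT h k z (Δ - D - (1 / 2 : ℝ) • D₂)| ≤ C * η / h * ‖v - u‖ ^ 3 := by
    have := ContinuousLinearMap.le_of_opNorm_le _ hη (Δ - D - (1 / 2 : ℝ) • D₂)
    calc _ ≤ η / h * (C * ‖v - u‖ ^ 3) := this.trans (by gcongr; exact B.taylor₂ v hv)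
      _ = _ := by ring
  rw [map_sub, map_sub, map_smul, smul_eq_mul] at h4
  rw [add_div, add_mul, show 2 * C * η / h * ‖v - u‖ ^ 3 = 2 * (C * η / h * ‖v - u‖ ^ 3) by ring]
  rw [abs_le] at h3 h4 ⊢
  constructor <;> linarith

/-- Identifiability against the Lipschitz bound on the noise term; valid on the whole ball, and used
where the Taylor expansion is useless. -/
lemma misfit_ge (hu : M.InitialAssumption u T hmax c) (hh : 0 < h) (hle : h ≤ hmax)
    (hk : T = k * h) (hη : ‖M.noiseFun hT h k z‖ ≤ η / h) {v : Vec d} (hv : v ∈ M.ball) :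
    (c * ‖v - u‖ ^ 2 - 2 * C * η * ‖v - u‖) / h ≤ M.misfit u h k z v := by
  have h0 : 0 ≤ η / h := (norm_nonneg (M.noiseFun hT h k z)).trans hη
  rw [M.misfit_eq hT hh hk B.mem_dom (M.ball_subset_dom hv)]
  have h1 := hu.obsEnergy_ge hh hle hk hv
  have h2 : |M.noiseFun hT h k z (M.initVelocity T v - M.initVelocity T u)| ≤
      C * η / h * ‖v - u‖ := by
    have := ContinuousLinearMap.le_of_opNorm_le _ hη (M.initVelocity T v - M.initVelocity T u)
    calc _ ≤ η / h * (C * ‖v - u‖) := this.trans (by gcongr; exact B.lip v hv)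
      _ = _ := by ring
  have h3 := le_of_abs_le h2
  rw [sub_div, show c * ‖v - u‖ ^ 2 / h = c / h * ‖v - u‖ ^ 2 by ring,
    show 2 * C * η * ‖v - u‖ / h = 2 * (C * η / h * ‖v - u‖) by ring]
  linarith

end FlowBounds
end Model
end GaussFilter
end

/-! ### The centre, completion of the square, and the Gaussian at time `T`. -/

noncomputable section
open MeasureTheory ProbabilityTheory
namespace GaussFilter

lemma form_transpose_mul_mul {n : ℕ} (A K : Matrix (Fin n) (Fin n) ℝ) (x y : Vec n)
    (h : K.mulVec x.ofLp = y.ofLp) : form (K.transpose * A * K) x x = form A y y := by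
  rw [form, form, ← h, ← Matrix.mulVec_mulVec, ← Matrix.mulVec_mulVec, Matrix.dotProduct_mulVec,
    Matrix.vecMul_transpose]

lemma abs_form_sub_le {n : ℕ} {A : Matrix (Fin n) (Fin n) ℝ}
    (hs : ∀ x y, form A x y = form A y x) {L : ℝ} (hL : ∀ x y, |form A x y| ≤ L * (‖x‖ * ‖y‖))
    (x y : Vec n) : |form A x x - form A y y| ≤ L * (‖x - y‖ * ‖x + y‖) := by
  have : form A x x - form A y y = form A (x - y) (x + y) := by
    rw [form_sub_left, form_add_right, form_add_right, hs y x]; ring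
  rw [this]
  exact hL _ _

namespace Model
variable {d dₒ : ℕ} (M : Model d dₒ) {T : ℝ}
variable {u : Vec d} {q : Vec d → ℝ} {σ h hmax c C ρ η : ℝ} {k : ℕ} {z : ℕ → Vec dₒ}

/-- The displacement `A_k⁻¹ B_k` of the centre. -/
def shift (u : Vec d) (h : ℝ) (k : ℕ) (z : ℕ → Vec dₒ) : Vec d :=
  WithLp.toLp 2 ((M.Ak u h k z)⁻¹.mulVec (M.Bk u h k z))

variable {M} in
lemma center_eq (hA : (M.Ak u h k z).PosDef) : M.center u h k z = u + M.shift u h k z :=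
  if_pos hA

variable {M} in
lemma dotProduct_Bk_eq (hA : (M.Ak u h k z).PosDef) (x : Vec d) :
    dotProduct x.ofLp (M.Bk u h k z) = form (M.Ak u h k z) x (M.shift u h k z) := by
  rw [form, shift, Matrix.mulVec_mulVec,
    Matrix.mul_nonsing_inv _ (isUnit_iff_ne_zero.2 hA.det_pos.ne'), Matrix.one_mulVec]

lemma rate_le_one (hT : 0 ≤ T) : M.rate T ≤ 1 :=
  Real.exp_le_one_iff.2 (neg_nonpos.2 (mul_nonneg M.lip_nonneg hT))

lemma rate_mul_norm_symm_le (hT : 0 ≤ T) {v : Vec d} (hv : v ∈ M.dom) (x : Vec d) :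
    M.rate T * ‖(M.derivEquiv hT hv).symm x‖ ≤ ‖x‖ := by
  have h := M.rate_mul_norm_le_fderiv hT hv ((M.derivEquiv hT hv).symm x)
  rwa [← M.coe_derivEquiv hT hv, ContinuousLinearEquiv.coe_coe,
    ContinuousLinearEquiv.apply_symm_apply] at h

lemma rate_mul_norm_le_symm (hT : 0 ≤ T) {v : Vec d} (hv : v ∈ M.dom) (x : Vec d) :
    M.rate T * ‖x‖ ≤ ‖(M.derivEquiv hT hv).symm x‖ := by
  have h := M.rate_mul_norm_fderiv_le hT hv ((M.derivEquiv hT hv).symm x)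
  rwa [← M.coe_derivEquiv hT hv, ContinuousLinearEquiv.coe_coe,
    ContinuousLinearEquiv.apply_symm_apply] at h

lemma jac_Psi_inv_mulVec (hT : 0 ≤ T) {v : Vec d} (hv : v ∈ M.dom) (x : Vec d) :
    (jac (M.Ψ T) v)⁻¹.mulVec x.ofLp = ((M.derivEquiv hT hv).symm x).ofLp := by
  have h1 : (jac (M.Ψ T) v).mulVec ((M.derivEquiv hT hv).symm x).ofLp = x.ofLp := by
    rw [jac_mulVec, ← M.coe_derivEquiv hT hv, ContinuousLinearEquiv.coe_coe,
      ContinuousLinearEquiv.apply_symm_apply]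
  have h2 : (jac (M.Ψ T) v).det ≠ 0 := by
    have := M.det_fderiv_Psi_ne_zero hT hv
    rwa [det_eq_det_of] at this
  rw [← h1, Matrix.mulVec_mulVec, Matrix.nonsing_inv_mul _ (isUnit_iff_ne_zero.2 h2),
    Matrix.one_mulVec]

/-- The Gaussian density at time `T`, up to its normalising constant, with centre the image of
`v`. -/
def gaussFactor (hT : 0 ≤ T) {v : Vec d} (hv : v ∈ M.dom) (A : Matrix (Fin d) (Fin d) ℝ) (σ : ℝ)
    (x : Vec d) : ℝ :=
  Real.exp (-(form A ((M.derivEquiv hT hv).symm (x - M.Ψ T v))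
    ((M.derivEquiv hT hv).symm (x - M.Ψ T v)) / (2 * σ ^ 2)))

lemma gaussFactor_eq (hT : 0 ≤ T) {v : Vec d} (hv : v ∈ M.dom) (A : Matrix (Fin d) (Fin d) ℝ)
    (σ : ℝ) (x : Vec d) :
    M.gaussFactor hT hv A σ x = Real.exp (-(dotProduct (x - M.Ψ T v).ofLp
      ((((jac (M.Ψ T) v)⁻¹).transpose * A * (jac (M.Ψ T) v)⁻¹).mulVec (x - M.Ψ T v).ofLp)) /
      (2 * σ ^ 2)) := by
  rw [gaussFactor, ← form_transpose_mul_mul A _ _ _ (M.jac_Psi_inv_mulVec hT hv (x - M.Ψ T v)), form,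
    neg_div]

lemma continuous_gaussFactor (hT : 0 ≤ T) {v : Vec d} (hv : v ∈ M.dom)
    (A : Matrix (Fin d) (Fin d) ℝ) (σ : ℝ) : Continuous (M.gaussFactor hT hv A σ) := by
  have hc : Continuous fun x => (M.derivEquiv hT hv).symm (x - M.Ψ T v) := by fun_prop
  unfold gaussFactor form
  have h1 : Continuous fun x => ((M.derivEquiv hT hv).symm (x - M.Ψ T v)).ofLp :=
    (PiLp.continuous_ofLp 2 _).comp hc
  exact ((h1.dotProduct (Continuous.matrix_mulVec continuous_const h1)).div_const _).neg.rexp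

/-- The explicit prefactor is the reciprocal of the integral, so both laws have the normalised form
required by `exists_normalized_bounds`. -/
lemma filterGaussDensity_eq (hT : 0 ≤ T) (hk : T = k * h) (hσ : 0 < σ)
    (hA : (M.Ak u h k z).PosDef) (hc : M.center u h k z ∈ M.ball) (hcd : M.center u h k z ∈ M.dom) :
    M.filterGaussDensity u σ h k z = fun x => M.gaussFactor hT hcd (M.Ak u h k z) σ x /
      ∫ w, M.gaussFactor hT hcd (M.Ak u h k z) σ w := by
  set J := jac (M.Ψ T) (M.center u h k z) with hJ
  have hJ0 : J.det ≠ 0 := by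
    have := M.det_fderiv_Psi_ne_zero hT hcd
    rwa [det_eq_det_of] at this
  have hJu : IsUnit J.det := isUnit_iff_ne_zero.2 hJ0
  set N := (J⁻¹).transpose * M.Ak u h k z * J⁻¹ with hN
  have hNp : N.PosDef := by
    have hinj : Function.Injective (J⁻¹).mulVec := Matrix.mulVec_injective_of_isUnit
      ((Matrix.isUnit_iff_isUnit_det _).2 (Matrix.isUnit_nonsing_inv_det _ hJu))
    simpa [hN, Matrix.conjTranspose_eq_transpose_of_trivial] using
      hA.conjTranspose_mul_mul_same hinj
  have hdet : √N.det = √(M.Ak u h k z).det / |J.det| := by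
    have : N.det = (M.Ak u h k z).det / J.det ^ 2 := by
      rw [hN, Matrix.det_mul, Matrix.det_mul, Matrix.det_transpose, Matrix.det_nonsing_inv,
        Ring.inverse_eq_inv']
      field_simp
    rw [this, Real.sqrt_div hA.det_pos.le, Real.sqrt_sq_eq_abs]
  have hint : ∫ w, M.gaussFactor hT hcd (M.Ak u h k z) σ w =
      (2 * Real.pi) ^ ((d : ℝ) / 2) * σ ^ d / √N.det := by
    simp_rw [gaussFactor_eq]
    exact integral_exp_neg_posDef hNp hσ _
  funext x
  rw [hint, gaussFactor_eq, hdet, filterGaussDensity, ← hk, if_pos ⟨hA, hc⟩]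
  have h1 : √(M.Ak u h k z).det ≠ 0 := (Real.sqrt_pos.2 hA.det_pos).ne'
  have h2 : |J.det| ≠ 0 := abs_ne_zero.2 hJ0
  field_simp
  exact div_self h2

namespace FlowBounds
variable {M} {hT : 0 ≤ T} (B : M.FlowBounds u q T hmax hT C ρ)
include B

lemma posDef_Ak (hu : M.InitialAssumption u T hmax c) (hh : 0 < h) (hle : h ≤ hmax) (hk : T = k * h)
    (hη : ‖M.noiseFun hT h k z‖ ≤ η / h) (hηc : C * η ≤ c / 4) : (M.Ak u h k z).PosDef := by
  refine posDef_of_form (M.form_Ak_symm hT hh hk B.mem_dom) fun x hx => ?_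
  have hc := hu.c_pos
  have hx' : 0 < ‖x‖ := norm_pos_iff.2 hx
  refine lt_of_lt_of_le ?_ (B.form_ge hu hh hle hk hη x)
  have : 0 < c - C * η := by linarith
  positivity

lemma posDefLT_left (hu : M.InitialAssumption u T hmax c) (hh : 0 < h) (hle : h ≤ hmax)
    (hk : T = k * h) (hη : ‖M.noiseFun hT h k z‖ ≤ η / h) (hηc : C * η ≤ c / 4) :
    PosDefLT ((c / (2 * h)) • 1) (M.Ak u h k z) := by
  have e : ∀ x y, form (M.Ak u h k z - (c / (2 * h)) • 1) x y =
      form (M.Ak u h k z) x y - form ((c / (2 * h)) • 1) x y := fun x y => by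
    simp [form, Matrix.sub_mulVec]
  refine posDef_of_form (fun x y => ?_) fun x hx => ?_
  · rw [e, e, M.form_Ak_symm hT hh hk B.mem_dom x y]
    simp [form, Matrix.smul_mulVec, dotProduct_comm]
  · have hc := hu.c_pos
    have hx' : 0 < ‖x‖ := norm_pos_iff.2 hx
    have h1 := B.form_ge hu hh hle hk hη x
    rw [e, form_smul_one]
    have h2 : 0 < (c / 2 - C * η) / h * ‖x‖ ^ 2 := by
      have : 0 < c / 2 - C * η := by linarith
      positivity
    have h3 : (c / 2 - C * η) / h * ‖x‖ ^ 2 =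
      (c - C * η) / h * ‖x‖ ^ 2 - c / (2 * h) * ‖x‖ ^ 2 := by field_simp; ring
    linarith

lemma posDefLT_right (hu : M.InitialAssumption u T hmax c) (hh : 0 < h) (hle : h ≤ hmax)
    (hk : T = k * h) (hη : ‖M.noiseFun hT h k z‖ ≤ η / h) (hηc : C * η ≤ c / 4) :
    PosDefLT (M.Ak u h k z) ((M.CA T hmax c / h) • 1) := by
  have e : ∀ x y, form ((M.CA T hmax c / h) • 1 - M.Ak u h k z) x y =
      form ((M.CA T hmax c / h) • 1) x y - form (M.Ak u h k z) x y := fun x y => by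
    simp [form, Matrix.sub_mulVec]
  refine posDef_of_form (fun x y => ?_) fun x hx => ?_
  · rw [e, e, M.form_Ak_symm hT hh hk B.mem_dom x y]
    simp [form, Matrix.smul_mulVec, dotProduct_comm]
  · have hc := hu.c_pos
    have hx' : 0 < ‖x‖ := norm_pos_iff.2 hx
    have h1 := B.form_le hh hle hk hη x
    rw [e, form_smul_one, CA]
    have h2 : 0 < (c / 2 - C * η) / h * ‖x‖ ^ 2 := by
      have : 0 < c / 2 - C * η := by linarith
      positivity
    have h3 : (c / 2 - C * η) / h * ‖x‖ ^ 2 =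
      (M.Mhat₁ T ^ 2 * (T + hmax) + c / 2) / h * ‖x‖ ^ 2 -
      (M.Mhat₁ T ^ 2 * (T + hmax) + C * η) / h * ‖x‖ ^ 2 := by ring
    linarith

/-- With `b` the shift, `⟨A_k b, b⟩ = ⟨B_k, b⟩` is a value of the noise functional, hence linear in
`‖b‖`, while coercivity bounds it below by `(c/2) ‖b‖² / h`. -/
lemma norm_shift_le (hu : M.InitialAssumption u T hmax c) (hh : 0 < h) (hle : h ≤ hmax)
    (hk : T = k * h) (hη : ‖M.noiseFun hT h k z‖ ≤ η / h) (hηc : C * η ≤ c / 4) :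
    ‖M.shift u h k z‖ ≤ 2 * C * η / c := by
  have hc := hu.c_pos
  have hC := B.pos
  have h0 : 0 ≤ η / h := (norm_nonneg (M.noiseFun hT h k z)).trans hη
  have hη0 : 0 ≤ η := by
    have := mul_nonneg h0 hh.le
    rwa [div_mul_cancel₀ _ hh.ne'] at this
  have hA := B.posDef_Ak hu hh hle hk hη hηc
  set b := M.shift u h k z with hb
  rcases (norm_nonneg b).eq_or_lt with hb0 | hb0
  · rw [← hb0]; positivity
  have h1 := B.form_ge hu hh hle hk hη b
  have h2 : form (M.Ak u h k z) b b ≤ η / h * (C * ‖b‖) := by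
    rw [← dotProduct_Bk_eq hA, M.dotProduct_Bk hT hh hk B.mem_dom]
    refine (le_abs_self _).trans ((ContinuousLinearMap.le_of_opNorm_le _ hη _).trans ?_)
    gcongr
    exact B.norm_fderiv_le b
  have h3 : (c - C * η) / h * ‖b‖ ^ 2 ≤ η / h * (C * ‖b‖) := h1.trans h2
  rw [div_mul_eq_mul_div, div_mul_eq_mul_div, div_le_div_iff_of_pos_right hh] at h3
  have h4 : (c - C * η) * ‖b‖ ≤ η * C := le_of_mul_le_mul_right (by nlinarith) hb0
  rw [le_div_iff₀ hc]
  nlinarith [mul_le_mul_of_nonneg_right (show c / 2 ≤ c - C * η by linarith) hb0.le]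

/-- Completing the square: since `B_k = A_k b` for the shift `b`, adding `⟨A_k b, b⟩` recentres the
quadratic at `u + b`. -/
lemma abs_misfit_add_sub_le (hh : 0 < h) (hle : h ≤ hmax) (hk : T = k * h)
    (hη : ‖M.noiseFun hT h k z‖ ≤ η / h) (hA : (M.Ak u h k z).PosDef) {v : Vec d}
    (hv : v ∈ M.ball) :
    |M.misfit u h k z v + form (M.Ak u h k z) (M.shift u h k z) (M.shift u h k z) -
      form (M.Ak u h k z) (v - M.center u h k z) (v - M.center u h k z)| ≤
      (2 * C ^ 5 + 2 * C * η) / h * ‖v - u‖ ^ 3 := by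
  have h1 := B.abs_misfit_sub_le hh hle hk hη hv
  rw [dotProduct_Bk_eq hA] at h1
  convert h1 using 2
  rw [center_eq hA, ← sub_sub]
  generalize v - u = w
  rw [form_sub_left, form_sub_right, form_sub_right,
    M.form_Ak_symm hT hh hk B.mem_dom (M.shift u h k z) w]
  ring

/-- Pulling the displacement of the images back by the derivative at `w` recovers `v - w` up to a
quadratic error. In a quadratic form this costs a cubic one. -/
lemma abs_form_symm_sub_le (hh : 0 < h) (hle : h ≤ hmax) (hk : T = k * h)
    (hη : ‖M.noiseFun hT h k z‖ ≤ η / h) {v w : Vec d} (hv : v ∈ M.ball) (hw : w ∈ M.ball)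
    (hwd : w ∈ M.dom) :
    |form (M.Ak u h k z) (v - w) (v - w) -
      form (M.Ak u h k z) ((M.derivEquiv hT hwd).symm (M.Ψ T v - M.Ψ T w))
        ((M.derivEquiv hT hwd).symm (M.Ψ T v - M.Ψ T w))| ≤
      (C ^ 5 + C * η) / h * (C / M.rate T * (1 + 1 / M.rate T ^ 2)) * ‖v - w‖ ^ 3 := by
  have hκ := M.rate_pos (T := T)
  have hC := B.pos
  set κ := M.rate T with hκd
  set g := (M.derivEquiv hT hwd).symm (M.Ψ T v - M.Ψ T w) with hg
  have h0 : 0 ≤ η / h := (norm_nonneg (M.noiseFun hT h k z)).trans hη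
  have h1 : ‖v - w - g‖ ≤ C / κ * ‖v - w‖ ^ 2 := by
    have h2 := M.rate_mul_norm_symm_le hT hwd
      (M.Ψ T v - M.Ψ T w - fderiv ℝ (M.Ψ T) w (v - w))
    have h3 : (M.derivEquiv hT hwd).symm (M.Ψ T v - M.Ψ T w - fderiv ℝ (M.Ψ T) w (v - w)) =
        g - (v - w) := by
      rw [map_sub, ← M.coe_derivEquiv hT hwd, ContinuousLinearEquiv.coe_coe,
        ContinuousLinearEquiv.symm_apply_apply]
    rw [h3, norm_sub_rev] at h2
    have h4 := h2.trans (B.flow_taylor v hv w hw)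
    rw [div_mul_eq_mul_div, le_div_iff₀ hκ]
    linarith
  have h2 : ‖g‖ ≤ 1 / κ ^ 2 * ‖v - w‖ := by
    have a := M.rate_mul_norm_symm_le hT hwd (M.Ψ T v - M.Ψ T w)
    have b := M.rate_mul_norm_Psi_sub_le hT (M.ball_subset_dom hv) hwd
    rw [one_div, le_inv_mul_iff₀ (by positivity), pow_two, mul_assoc]
    exact (mul_le_mul_of_nonneg_left a hκ.le).trans b
  have h3 : ‖v - w + g‖ ≤ (1 + 1 / κ ^ 2) * ‖v - w‖ := by
    refine (norm_add_le _ _).trans ?_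
    linarith
  refine (abs_form_sub_le (M.form_Ak_symm hT hh hk B.mem_dom)
    (B.abs_form_le hh hle hk hη) (v - w) g).trans ?_
  have hL : 0 ≤ (C ^ 5 + C * η) / h := by
    rw [add_div, mul_div_assoc]; positivity
  calc _ ≤ (C ^ 5 + C * η) / h * ((C / κ * ‖v - w‖ ^ 2) * ((1 + 1 / κ ^ 2) * ‖v - w‖)) := by
        gcongr
    _ = _ := by ring

end FlowBounds
end Model
end GaussFilter
end

/-! ### Pointwise comparison of the filter with the Gaussian. -/

noncomputable section
open MeasureTheory ProbabilityTheory
namespace GaussFilter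

/-- A cubic error `r³/h` divided by `σ²` is `r³/s²`. The misfit error is centred at `u` instead of
the Gaussian's centre; the shift, of size `s m`, contributes `(s m)³/s² = s m³`. -/
lemma abs_exponent_le {σ h s m K E β r V b x y : ℝ} (hσ : 0 < σ) (hh : 0 < h) (hs : 0 < s)
    (hsσ : s ^ 2 = σ ^ 2 * h) (hm : 0 ≤ m) (hK : 0 ≤ K) (hE : 0 ≤ E) (hβ : 0 ≤ β) (hr : 0 ≤ r)
    (hV : 0 ≤ V) (hVr : V ≤ r + b) (hb0 : 0 ≤ b) (hb : b ≤ β * (s * m))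
    (hx : |x| ≤ K / h * r ^ 3) (hy : |y| ≤ E / h * V ^ 3) :
    |(x + y) / (2 * σ ^ 2)| ≤ (K + 4 * E + 4 * E * β ^ 3) * (r ^ 3 / s ^ 2 + s * m ^ 3) := by
  have h1 : V ^ 3 ≤ 4 * (r ^ 3 + β ^ 3 * (s ^ 3 * m ^ 3)) := by
    have h2 := add_pow_le hr hb0 3
    have h3 : b ^ 3 ≤ (β * (s * m)) ^ 3 := by gcongr
    have h4 : V ^ 3 ≤ (r + b) ^ 3 := by gcongr
    norm_num at h2
    nlinarith
  have h2 : |x + y| ≤ (K * r ^ 3 + E * (4 * (r ^ 3 + β ^ 3 * (s ^ 3 * m ^ 3)))) / h := by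
    refine (abs_add_le _ _).trans ((add_le_add hx hy).trans ?_)
    rw [add_div, div_mul_eq_mul_div, div_mul_eq_mul_div]
    gcongr
  rw [abs_div, abs_of_pos (show 0 < 2 * σ ^ 2 by positivity), div_le_iff₀ (by positivity)]
  refine h2.trans ?_
  have h5 : (K + 4 * E + 4 * E * β ^ 3) * (r ^ 3 / s ^ 2 + s * m ^ 3) * (2 * σ ^ 2) =
      (K + 4 * E + 4 * E * β ^ 3) * (2 * (r ^ 3 + s ^ 3 * m ^ 3)) / h := by
    have : σ ^ 2 = s ^ 2 / h := by rw [hsσ]; field_simp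
    rw [this]
    field_simp
  rw [h5]
  gcongr
  have p1 : 0 ≤ r ^ 3 := by positivity
  have p2 : 0 ≤ s ^ 3 * m ^ 3 := by positivity
  have p3 : 0 ≤ E * β ^ 3 := by positivity
  nlinarith [mul_nonneg hK p1, mul_nonneg hE p1, mul_nonneg p3 p1, mul_nonneg hK p2,
    mul_nonneg hE p2, mul_nonneg p3 p2]

/-- Half of the quadratic lower bound absorbs the linear noise term; the other half is expressed
through the distance to the centre. -/
lemma le_exponent_of_far {σ h s c γ r V y : ℝ} (hσ : 0 < σ) (hh : 0 < h)
    (hsσ : s ^ 2 = σ ^ 2 * h) (hc : 0 ≤ c) (hr : 0 ≤ r) (hV : r / 2 ≤ V) (hγ : γ ≤ c / 2 * V)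
    (hy : (c * V ^ 2 - γ * V) / h ≤ y) : c / 16 * (r / s) ^ 2 ≤ y / (2 * σ ^ 2) := by
  have h1 : c / 8 * r ^ 2 ≤ c * V ^ 2 - γ * V := by
    have a : γ * V ≤ c / 2 * V * V := by gcongr; linarith
    have b : (r / 2) ^ 2 ≤ V ^ 2 := by gcongr
    nlinarith
  rw [div_pow, hsσ]
  calc c / 16 * (r ^ 2 / (σ ^ 2 * h)) = c / 8 * r ^ 2 / h / (2 * σ ^ 2) := by field_simp; ring
    _ ≤ y / (2 * σ ^ 2) := by gcongr; exact le_trans (by gcongr) hy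

namespace Model
namespace FlowBounds
variable {d dₒ : ℕ} {M : Model d dₒ} {T : ℝ}
variable {u : Vec d} {q : Vec d → ℝ} {hmax c C ρ : ℝ}

set_option maxHeartbeats 1600000 in
lemma exists_pointwise_bound (hd : 0 < d) (hu : M.InitialAssumption u T hmax c)
    (hq : M.PriorAssumption q) (B : M.FlowBounds u q T hmax hu.T_pos.le C ρ) :
    ∃ D α θ₁, 0 < D ∧ 0 < α ∧ 0 < θ₁ ∧ θ₁ ≤ 1 ∧ C * (C * θ₁) ≤ c / 4 ∧
      ∀ (σ h s m : ℝ) (k : ℕ) (z : ℕ → Vec dₒ), 0 < σ → 0 < h → h ≤ hmax → T = k * h → 0 < s →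
      s ^ 2 = σ ^ 2 * h → 1 ≤ m → ‖M.noiseFun hu.T_pos.le h k z‖ ≤ C * (s * m) / h →
      s * m ^ 3 ≤ θ₁ → ∃ (hcd : M.center u h k z ∈ M.dom) (_ : M.center u h k z ∈ M.ball) (κ : ℝ),
        0 < κ ∧
        (∀ x, M.gaussFactor hu.T_pos.le hcd (M.Ak u h k z) σ x ≤
          bell α s (M.Ψ T (M.center u h k z)) x) ∧
        ∀ᵐ x, |M.filterUnnormalized q σ h k (M.obs u h z) x / κ -
          M.gaussFactor hu.T_pos.le hcd (M.Ak u h k z) σ x| ≤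
          D * (s * m ^ 3) * bell α s (M.Ψ T (M.center u h k z)) x := by
  have hT := hu.T_pos.le
  have hc := hu.c_pos
  have hC := B.pos
  have hκ0 := M.rate_pos (T := T)
  have hκ1 := M.rate_le_one hT
  set κ := M.rate T with hκd
  -- One factor `κ²` is lost in inverting the derivative and one in passing between `‖v - uG‖` and
  -- the distance of the images; `c / 16` is the rate from `le_exponent_of_far`.
  set α := c / 16 * κ ^ 4 with hα
  have hα0 : 0 < α := by positivity
  set K := (C ^ 5 + C * C) * (C / κ * (1 + 1 / κ ^ 2)) with hK
  set E := 2 * C ^ 5 + 2 * C * C with hE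
  set β := 2 * C ^ 2 / c with hβ
  set C₁ := C + (K + 4 * E + 4 * E * β ^ 3) with hC₁
  have hK0 : 0 < K := by positivity
  have hE0 : 0 < E := by positivity
  have hβ0 : 0 < β := by positivity
  have hC₁0 : 0 < C₁ := by positivity
  have hCC₁ : C ≤ C₁ := by rw [hC₁]; exact le_add_of_nonneg_right (by positivity)
  have hρ := B.rho_pos
  -- Small enough for the prior estimates near `u` and for the condition `C₁ * ρ₀ ≤ α / 2` of the
  -- perturbation lemma.
  set ρ₀ := min (ρ / 2) (α / (2 * C₁)) with hρ₀
  have hρ₀0 : 0 < ρ₀ := by positivity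
  have hρ₀ρ : ρ₀ ≤ ρ / 2 := min_le_left _ _
  have hCρ₀ : C₁ * ρ₀ ≤ α / 2 := by
    have := mul_le_mul_of_nonneg_left (min_le_right (ρ / 2) (α / (2 * C₁))) hC₁0.le
    refine this.trans_eq ?_
    field_simp
  obtain ⟨D₁, hD₁, hpert⟩ := exists_perturbation_bound hα0 hC₁0 hρ₀0 hCρ₀
  -- The second entry keeps `A_k` coercive, the third keeps the shift below `ρ₀ / 4`.
  set θ₁ := min 1 (min (c / (4 * C ^ 2)) (ρ₀ / (4 * β))) with hθ₁
  have hθ₁0 : 0 < θ₁ := by positivity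
  have hθ₁1 : θ₁ ≤ 1 := min_le_left _ _
  have hθ₁c : C * (C * θ₁) ≤ c / 4 := by
    have h1 : θ₁ ≤ c / (4 * C ^ 2) := (min_le_right _ _).trans (min_le_left _ _)
    rw [le_div_iff₀ (by positivity)] at h1
    linarith
  have hθ₁ρ : β * θ₁ ≤ ρ₀ / 4 := by
    have h1 : θ₁ ≤ ρ₀ / (4 * β) := (min_le_right _ _).trans (min_le_right _ _)
    rw [le_div_iff₀ (by positivity)] at h1
    linarith
  clear_value θ₁ ρ₀ C₁ K E β α
  refine ⟨2 * D₁, α / 4 * κ ^ 2, θ₁, by positivity, by positivity, hθ₁0, hθ₁1, hθ₁c, ?_⟩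
  intro σ h s m k z hσ hh hle hk hs hsσ hm hη hθ
  have hm0 : 0 ≤ m := by linarith
  have hsm : s * m ≤ s * m ^ 3 := by gcongr; exact le_self_pow₀ hm three_ne_zero
  have hsθ : s ≤ s * m ^ 3 := le_mul_of_one_le_right hs.le (one_le_pow₀ hm)
  have hsm1 : s * m ≤ θ₁ := hsm.trans hθ
  have hηc : C * (C * (s * m)) ≤ c / 4 := le_trans (by gcongr) hθ₁c
  have hηC : C * (s * m) ≤ C := mul_le_of_le_one_right hC.le (hsm1.trans hθ₁1)
  have hA := B.posDef_Ak hu hh hle hk hη hηc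
  have hb : ‖M.shift u h k z‖ ≤ β * (s * m) := by
    refine (B.norm_shift_le hu hh hle hk hη hηc).trans_eq ?_
    rw [hβ]; ring
  have hbρ : ‖M.shift u h k z‖ ≤ ρ₀ / 4 := hb.trans (le_trans (by gcongr) hθ₁ρ)
  have hcn : ‖M.center u h k z‖ ≤ ‖u‖ + ρ / 8 := by
    rw [center_eq hA]
    exact (norm_add_le _ _).trans (by linarith)
  have hcb : M.center u h k z ∈ M.ball := M.mem_ball.2 (by linarith [B.rho_lt])
  have hcd := M.ball_subset_dom hcb
  set uG := M.center u h k z with huG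
  set A := M.Ak u h k z with hAd
  set x₀ := M.Ψ T uG with hx₀
  set b := M.shift u h k z with hbd
  set c₀ := ∏ i ∈ Finset.range (k + 1), noiseDensity σ (z i) with hc₀
  have hc₀0 : 0 < c₀ := Finset.prod_pos fun i _ => noiseDensity_pos hσ _
  have hp0 : 0 < M.priorDensity q T uG := M.priorDensity_pos hT hq hcb
  have hform : ∀ g, 3 * c / 4 / h * ‖g‖ ^ 2 ≤ form A g g := fun g => by
    refine le_trans ?_ (B.form_ge hu hh hle hk hη g)
    gcongr
    linarith
  set G : Vec d → ℝ := fun x => form A ((M.derivEquiv hT hcd).symm (x - x₀))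
    ((M.derivEquiv hT hcd).symm (x - x₀)) / (2 * σ ^ 2) with hG
  have hGx : ∀ x, c / 4 * κ ^ 2 * (‖x - x₀‖ / s) ^ 2 ≤ G x := by
    intro x
    have h1 := M.rate_mul_norm_le_symm hT hcd (x - x₀)
    set g := (M.derivEquiv hT hcd).symm (x - x₀) with hg
    have h2 : (κ * ‖x - x₀‖) ^ 2 ≤ ‖g‖ ^ 2 := by gcongr
    rw [div_pow, hsσ]
    calc c / 4 * κ ^ 2 * (‖x - x₀‖ ^ 2 / (σ ^ 2 * h)) =
        c / 2 / h * (κ * ‖x - x₀‖) ^ 2 / (2 * σ ^ 2) := by field_simp; ring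
      _ ≤ 3 * c / 4 / h * ‖g‖ ^ 2 / (2 * σ ^ 2) := by
          refine div_le_div_of_nonneg_right (mul_le_mul ?_ h2 (sq_nonneg _) (by positivity))
            (by positivity)
          exact div_le_div_of_nonneg_right (by linarith) hh.le
      _ ≤ G x := by simp only [hG]; gcongr; exact hform g
  have hQb : 0 ≤ form A b b := le_trans (by positivity) (hform b)
  -- Everything independent of the point is collected here: the noise densities, the prior at the
  -- centre, and the constant from completing the square.
  refine ⟨hcd, hcb, c₀ * (M.priorDensity q T uG * Real.exp (form A b b / (2 * σ ^ 2))),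
    by positivity, fun x => ?_, ?_⟩
  · refine Real.exp_le_exp.2 (neg_le_neg ((mul_le_mul_of_nonneg_right ?_ (sq_nonneg _)).trans
      (hGx x)))
    rw [hα]
    have : κ ^ 4 ≤ 1 := pow_le_one₀ hκ0.le hκ1
    have : c / 16 * κ ^ 4 ≤ c / 16 * 1 := by gcongr
    gcongr
    linarith
  have key : ∀ r x X : ℝ, 0 ≤ r → ∀ a, κ * x ≤ r → 0 ≤ x →
      |X - Real.exp (-a)| ≤ D₁ * (s + s * m ^ 3) * Real.exp (-(α / 4 * (r / s) ^ 2)) →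
      |X - Real.exp (-a)| ≤ 2 * D₁ * (s * m ^ 3) * Real.exp (-(α / 4 * κ ^ 2 * (x / s) ^ 2)) := by
    intro r x X hr a hx hx0 h
    refine h.trans ?_
    have h1 : (κ * x / s) ^ 2 ≤ (r / s) ^ 2 := by gcongr
    have h2 : α / 4 * κ ^ 2 * (x / s) ^ 2 = α / 4 * (κ * x / s) ^ 2 := by ring
    rw [h2]
    have h3 : D₁ * (s + s * m ^ 3) ≤ 2 * D₁ * (s * m ^ 3) := by
      have := mul_le_mul_of_nonneg_left (show s + s * m ^ 3 ≤ 2 * (s * m ^ 3) by linarith) hD₁.le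
      linarith
    gcongr
  have hθ1 : s * m ^ 3 ≤ 1 := hθ.trans hθ₁1
  have hθ0 : 0 ≤ s * m ^ 3 := by positivity
  filter_upwards [M.filterUnnormalized_ae (q := q) (σ := σ) (u := u) (z := z) hd hu.T_pos hh hk]
    with x hx
  rcases hx with ⟨hx1, hx2⟩ | ⟨v, hvo, rfl, hx2⟩
  -- Outside the image of the ball the filter density is zero and the point is at distance at least
  -- `ρ > ρ₀` from the centre, so only the far case occurs.
  · have hr := B.exit uG (by linarith) x hx1
    refine key ‖x - x₀‖ _ _ (norm_nonneg _) _
      (mul_le_of_le_one_left (norm_nonneg _) hκ1) (norm_nonneg _) ?_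
    refine hpert s _ _ _ _ hs hθ0 hθ1 (norm_nonneg _) ?_ (by rw [hx2, zero_div]) ?_ ?_
    · refine le_trans ?_ (hGx x)
      gcongr
      rw [hα]
      have : κ ^ 4 ≤ κ ^ 2 := pow_le_pow_of_le_one hκ0.le hκ1 (by norm_num)
      have : c / 16 * κ ^ 4 ≤ c / 16 * κ ^ 2 := by gcongr
      have := mul_pos hc (pow_pos hκ0 2)
      linarith
    · intro h; linarith
    · intro _; rw [hx2, zero_div]; positivity
  · have hv := M.openBall_subset hvo
    have hvd := M.ball_subset_dom hv
    set r := ‖v - uG‖ with hr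
    have hr0 : 0 ≤ r := norm_nonneg _
    have hXeq : M.filterUnnormalized q σ h k (M.obs u h z) (M.Ψ T v) /
        (c₀ * (M.priorDensity q T uG * Real.exp (form A b b / (2 * σ ^ 2)))) =
        M.priorDensity q T v / M.priorDensity q T uG *
          Real.exp (-((M.misfit u h k z v + form A b b) / (2 * σ ^ 2))) := by
      rw [hx2, ← hc₀, add_div, neg_add, Real.exp_add, Real.exp_neg (form A b b / _), ← neg_div]
      field_simp
    rw [hXeq]
    refine key r _ _ hr0 _ (M.rate_mul_norm_Psi_sub_le hT hvd hcd) (norm_nonneg _) ?_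
    have hpq : 0 ≤ M.priorDensity q T v := (M.priorDensity_pos hT hq hv).le
    refine hpert s _ r _ _ hs hθ0 hθ1 hr0 ?_ (by positivity) ?_ ?_
    · refine le_trans ?_ (hGx (M.Ψ T v))
      have h1 : (κ * r / s) ^ 2 ≤ (‖M.Ψ T v - x₀‖ / s) ^ 2 := by
        have := M.rate_mul_norm_le hT hvd hcd
        gcongr
      calc α * (r / s) ^ 2 = c / 16 * κ ^ 2 * (κ * r / s) ^ 2 := by rw [hα]; ring
        _ ≤ c / 4 * κ ^ 2 * (‖M.Ψ T v - x₀‖ / s) ^ 2 := by gcongr; norm_num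
    · intro hrρ
      -- The multiplicative perturbation is the ratio of transported priors; the exponent error
      -- combines the Taylor remainder of the misfit with the nonlinearity of the flow.
      refine ⟨M.priorDensity q T v / M.priorDensity q T uG,
        (M.misfit u h k z v + form A b b) / (2 * σ ^ 2) - G (M.Ψ T v), ?_, ?_, ?_⟩
      · rw [show ∀ a b : ℝ, a + (b - a) = b by intros; ring]
      · refine (B.prior_near v uG ?_ (by linarith)).trans (by gcongr)
        have : ‖v‖ ≤ ‖uG‖ + r := by
          have := norm_add_le uG (v - uG)
          rwa [add_sub_cancel] at this
        linarith
      · have e1 := B.abs_misfit_add_sub_le hh hle hk hη hA hv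
        have e2 := B.abs_form_symm_sub_le hh hle hk hη hv hcb hcd
        have e3 : (M.misfit u h k z v + form A b b) / (2 * σ ^ 2) - G (M.Ψ T v) =
          ((form A (v - uG) (v - uG) -
            form A ((M.derivEquiv hT hcd).symm (M.Ψ T v - x₀))
              ((M.derivEquiv hT hcd).symm (M.Ψ T v - x₀))) +
           (M.misfit u h k z v + form A b b - form A (v - uG) (v - uG))) / (2 * σ ^ 2) := by
          simp only [hG]; ring
        rw [e3]
        have hV : ‖v - u‖ ≤ r + ‖b‖ := by
          have : v - u = v - uG + b := by rw [huG, center_eq hA]; abel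
          rw [this]; exact norm_add_le _ _
        refine (abs_exponent_le (K := K) (E := E) hσ hh hs hsσ hm0 hK0.le hE0.le hβ0.le hr0
          (norm_nonneg _) hV (norm_nonneg _) hb (e2.trans ?_) (e1.trans ?_)).trans ?_
        · rw [hK, mul_div_right_comm]
          gcongr
        · rw [hE]
          gcongr
        · gcongr
          rw [hC₁]
          linarith
    · intro hrρ
      have hpr := B.prior_far v hv uG (by linarith)
      have hV : r - ‖b‖ ≤ ‖v - u‖ := by
        have h1 : v - uG = v - u - b := by rw [huG, center_eq hA]; abel
        have := norm_sub_le (v - u) b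
        rw [← h1] at this
        linarith
      have hγ : 2 * C * (C * (s * m)) ≤ c / 2 * ‖v - u‖ := by
        have h1 : 2 * C * (C * (s * m)) = c * (β * (s * m)) := by rw [hβ]; field_simp
        have h2 : β * (s * m) ≤ ρ₀ / 4 := le_trans (by gcongr) hθ₁ρ
        have h3 : c * (β * (s * m)) ≤ c * (‖v - u‖ / 2) :=
          mul_le_mul_of_nonneg_left (by linarith) hc.le
        linarith
      have hmf := le_exponent_of_far hσ hh hsσ hc.le hr0 (by linarith) hγ
        (B.misfit_ge hu hh hle hk hη hv)
      have hα16 : α ≤ c / 16 := by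
        rw [hα]; exact mul_le_of_le_one_right (by positivity) (pow_le_one₀ hκ0.le hκ1)
      have h3 : α * (r / s) ^ 2 ≤ (M.misfit u h k z v + form A b b) / (2 * σ ^ 2) := by
        have h4 : 0 ≤ form A b b / (2 * σ ^ 2) := by positivity
        have h5 : α * (r / s) ^ 2 ≤ c / 16 * (r / s) ^ 2 := by gcongr
        rw [add_div]
        linarith
      gcongr
      exact hpr.trans hCC₁

end FlowBounds
end Model
end GaussFilter
end

/-! ### The approximation for a fixed noise realisation. -/

noncomputable section
open MeasureTheory ProbabilityTheory
namespace GaussFilter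
namespace Model
variable {d dₒ : ℕ} {M : Model d dₒ} {T : ℝ}
variable {u : Vec d} {q : Vec d → ℝ} {hmax c C ρ : ℝ}

/-- The upper bound on the form yields a narrower bell below the Gaussian, hence a lower bound of
order `s ^ d` for the normalising integral. -/
lemma bell_le_gaussFactor (hT : 0 ≤ T) {v : Vec d} (hv : v ∈ M.dom)
    {A : Matrix (Fin d) (Fin d) ℝ} {σ s h L : ℝ} (hσ : 0 < σ) (hh : 0 < h)
    (hsσ : s ^ 2 = σ ^ 2 * h) (hL0 : 0 ≤ L) (hL : ∀ g, form A g g ≤ L / h * ‖g‖ ^ 2) (x : Vec d) :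
    bell (L / (2 * M.rate T ^ 2)) s (M.Ψ T v) x ≤ M.gaussFactor hT hv A σ x := by
  have hκ := M.rate_pos (T := T)
  refine Real.exp_le_exp.2 (neg_le_neg ?_)
  have h1 := M.rate_mul_norm_symm_le hT hv (x - M.Ψ T v)
  set g := (M.derivEquiv hT hv).symm (x - M.Ψ T v)
  have h2 : (M.rate T * ‖g‖) ^ 2 ≤ ‖x - M.Ψ T v‖ ^ 2 := by gcongr
  rw [div_pow, hsσ]
  calc form A g g / (2 * σ ^ 2) ≤ L / h * ‖g‖ ^ 2 / (2 * σ ^ 2) := by gcongr; exact hL g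
    _ = L / (2 * M.rate T ^ 2) * ((M.rate T * ‖g‖) ^ 2 / (σ ^ 2 * h)) := by field_simp
    _ ≤ _ := by gcongr

/-- The approximation of the filter for a fixed realisation of the noise. -/
lemma exists_filter_approximation (hd : 0 < d) (hu : M.InitialAssumption u T hmax c)
    (hq : M.PriorAssumption q) :
    ∃ D θ₀, 0 < D ∧ 0 < θ₀ ∧ ∀ (σ h s m : ℝ) (k : ℕ) (z : ℕ → Vec dₒ), 0 < σ → 0 < h → h ≤ hmax →
      T = k * h → 0 < s → s ^ 2 = σ ^ 2 * h → 1 ≤ m → noiseSize k z ≤ s * m / h →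
      s * m ^ 3 ≤ θ₀ →
      PosDefLT ((c / (2 * h)) • 1) (M.Ak u h k z) ∧
      PosDefLT (M.Ak u h k z) ((M.CA T hmax c / h) • 1) ∧
      M.center u h k z ∈ M.ball ∧
      dTV (M.filterDensity q σ h k (M.obs u h z)) (M.filterGaussDensity u σ h k z) ≤
        ENNReal.ofReal (D * (s * m ^ 3)) ∧
      dW (ofDensity (M.filterDensity q σ h k (M.obs u h z)))
        (ofDensity (M.filterGaussDensity u σ h k z)) ≤ ENNReal.ofReal (D * (s * m ^ 3) * s) := by
  have hT := hu.T_pos.le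
  have hκ := M.rate_pos (T := T)
  obtain ⟨C, ρ, B⟩ := M.exists_flowBounds (hmax := hmax) hT hu.norm_lt hq
  have hC := B.pos
  obtain ⟨D₁, α, θ₁, hD₁, hα, hθ₁, hθ₁1, hθ₁c, hpt⟩ := B.exists_pointwise_bound hd hu hq
  set αL := (C ^ 5 + C * C) / (2 * M.rate T ^ 2) with hαL
  have hαL0 : 0 < αL := by positivity
  -- A single constant must bound both the Gaussian factor, by `1`, and the pointwise difference, by
  -- `D₁`; hence `1 + D₁`.
  obtain ⟨D, θ₀, hD, hθ₀, hnorm⟩ := exists_normalized_bounds d hα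
    (show 0 < 1 + D₁ by positivity)
    (show 0 < (Real.pi / αL) ^ ((d : ℝ) / 2) by positivity)
  refine ⟨D, min θ₁ θ₀, hD, lt_min hθ₁ hθ₀, ?_⟩
  intro σ h s m k z hσ hh hle hk hs hsσ hm hns hθ
  have hθ' := hθ.trans (min_le_left _ _)
  have hη : ‖M.noiseFun hT h k z‖ ≤ C * (s * m) / h := by
    refine (M.norm_noiseFun_le hT hh hk).trans ?_
    rw [mul_div_assoc]
    have := noiseSize_nonneg (k := k) (z := z)
    gcongr
    exact B.noise_le
  have hm0 : 0 ≤ m := by linarith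
  have hsm : s * m ≤ θ₁ := le_trans (by gcongr; exact le_self_pow₀ hm three_ne_zero) hθ'
  have hηc : C * (C * (s * m)) ≤ c / 4 := le_trans (by gcongr) hθ₁c
  have hA := B.posDef_Ak hu hh hle hk hη hηc
  obtain ⟨hcd, hcb, κ, hκ0, hΓ, hX⟩ := hpt σ h s m k z hσ hh hle hk hs hsσ hm hη hθ'
  refine ⟨B.posDefLT_left hu hh hle hk hη hηc, B.posDefLT_right hu hh hle hk hη hηc, hcb, ?_⟩
  rw [M.filterGaussDensity_eq hT hk hσ hA hcb hcd]
  set Γ := M.gaussFactor hT hcd (M.Ak u h k z) σ with hΓd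
  have hΓc : Continuous Γ := M.continuous_gaussFactor hT hcd _ σ
  have hΓ0 : ∀ x, 0 ≤ Γ x := fun x => (Real.exp_pos _).le
  set x₀ := M.Ψ T (M.center u h k z)
  have hb := integral_bell hα hs x₀
  have hΓi : Integrable Γ := hb.1.mono' hΓc.aestronglyMeasurable (Filter.Eventually.of_forall
    fun x => by rw [Real.norm_of_nonneg (hΓ0 x)]; exact hΓ x)
  have hlow : (Real.pi / αL) ^ ((d : ℝ) / 2) * s ^ d ≤ ∫ x, Γ x := by
    have hb' := integral_bell hαL0 hs x₀
    rw [← hb'.2]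
    refine integral_mono hb'.1 hΓi fun x => ?_
    refine bell_le_gaussFactor hT hcd hσ hh hsσ (by positivity) (fun g => ?_) x
    have h1 := le_of_abs_le (B.abs_form_le hh hle hk hη g g)
    refine h1.trans ?_
    rw [← pow_two]
    have : C * (s * m) ≤ C := mul_le_of_le_one_right hC.le (hsm.trans hθ₁1)
    gcongr
  refine hnorm s (s * m ^ 3) κ x₀ _ Γ hs (by positivity) (hθ.trans (min_le_right _ _)) hκ0
    (M.aestronglyMeasurable_filterUnnormalized hd hu.T_pos hh hk hq)
    (M.filterUnnormalized_nonneg hq hσ _) hΓc hΓ0 (fun x => (hΓ x).trans ?_) hlow ?_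
  · have := bell_pos α s x₀ x
    nlinarith
  · filter_upwards [hX] with x hx
    refine hx.trans ?_
    have := bell_pos α s x₀ x
    gcongr
    linarith

end Model
end GaussFilter
end

/-! ### Choice of constants and conclusion. -/

noncomputable section
open MeasureTheory ProbabilityTheory
namespace GaussFilter

/-- Since `m ≥ 1`, the cube is at most the fourth power, in which the square roots become a square
of `l + l'`. -/
lemma cube_le_add_sq_mul {a b l l' m : ℝ} (ha : 0 ≤ a) (hb : 0 ≤ b) (hl : 0 ≤ l + l')
    (hm : m = 1 + a * √b * √(8 * (l + l'))) :
    m ^ 3 ≤ (8 + 1024 * a ^ 4 * b ^ 2 * l ^ 2) + 1024 * a ^ 4 * b ^ 2 * l' ^ 2 := by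
  have hx : 0 ≤ a * √b * √(8 * (l + l')) := by positivity
  have hm1 : 1 ≤ m := by linarith
  have h1 : m ^ 3 ≤ m ^ 4 := pow_le_pow_right₀ hm1 (by norm_num)
  have h2 := add_pow_le zero_le_one hx 4
  rw [← hm] at h2
  have h3 : (a * √b * √(8 * (l + l'))) ^ 4 = 64 * (a ^ 4 * b ^ 2) * (l + l') ^ 2 := by
    have e1 : √b ^ 4 = b ^ 2 := by rw [show 4 = 2 * 2 from rfl, pow_mul, Real.sq_sqrt hb]
    have e2 : √(8 * (l + l')) ^ 4 = (8 * (l + l')) ^ 2 := by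
      rw [show 4 = 2 * 2 from rfl, pow_mul, Real.sq_sqrt (by positivity)]
    rw [mul_pow, mul_pow, e1, e2]
    ring
  rw [h3] at h2
  have h4 : (l + l') ^ 2 ≤ 2 * (l ^ 2 + l' ^ 2) := add_sq_le
  have h5 : 0 ≤ a ^ 4 * b ^ 2 := by positivity
  norm_num at h2
  nlinarith [mul_le_mul_of_nonneg_left h4 h5]

end GaussFilter
end

open MeasureTheory ProbabilityTheory GaussFilter in
/-- The last conclusion bounds the probability of the complement of the event (an upper bound on its
outer measure), which is the assertion that the event has probability at least `1 - ε`. -/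
theorem mainTheorem2 {d dₒ : ℕ} (hd : 0 < d) (M : Model d dₒ)
    (u : Vec d) (q : Vec d → ℝ) (T hmax c : ℝ)
    (hu : M.InitialAssumption u T hmax c) (hq : M.PriorAssumption q) :
    ∃ DTV₁ DTV₂ DW₁ DW₂ : ℝ, 0 < DTV₁ ∧ 0 < DTV₂ ∧ 0 < DW₁ ∧ 0 < DW₂ ∧
      ∀ (ε σ h : ℝ) (k : ℕ), 0 < ε → ε ≤ 1 → 0 < σ → 0 < h → h ≤ hmax → T = k * h →
      ∀ DTV DW : ℝ, DTV = DTV₁ + DTV₂ * Real.log (1 / ε) ^ 2 →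
        DW = DW₁ + DW₂ * Real.log (1 / ε) ^ 2 →
      σ * Real.sqrt h ≤ 1 / 2 * DTV⁻¹ →
      ∀ (Ω : Type*) [MeasurableSpace Ω] (P : Measure Ω) [IsProbabilityMeasure P]
        (Z : ℕ → Ω → Vec dₒ), iIndepFun Z P → (∀ i, HasLaw (Z i) (noiseLaw dₒ σ) P) →
      P {ω | ¬ (
          PosDefLT ((c / (2 * h)) • 1) (M.Ak u h k fun i => Z i ω) ∧
          PosDefLT (M.Ak u h k fun i => Z i ω) ((M.CA T hmax c / h) • 1) ∧
          M.center u h k (fun i => Z i ω) ∈ M.ball ∧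
          dTV (M.filterDensity q σ h k (M.obs u h fun i => Z i ω))
              (M.filterGaussDensity u σ h k fun i => Z i ω)
            ≤ ENNReal.ofReal (DTV * σ * Real.sqrt h) ∧
          dW (ofDensity (M.filterDensity q σ h k (M.obs u h fun i => Z i ω)))
              (ofDensity (M.filterGaussDensity u σ h k fun i => Z i ω))
            ≤ ENNReal.ofReal (DW * σ ^ 2 * h))}
        ≤ ENNReal.ofReal ε := by
  obtain ⟨D, θ₀, hD, hθ₀, key⟩ := Model.exists_filter_approximation hd hu hq
  have hT := hu.T_pos
  have hmax0 := hu.hmax_pos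
  set E : ℝ := 1024 * ((dₒ : ℝ) + 1) ^ 4 * (T + hmax) ^ 2 with hE
  have hE0 : 0 < E := by positivity
  set l : ℝ := Real.log (2 + 4 * dₒ) with hl
  -- One constant makes `DTV` dominate both `D * m ^ 3`, for the error bounds, and `m ^ 3 / θ₀`, so
  -- that the smallness hypothesis implies `s * m ^ 3 ≤ θ₀`.
  set K := D + 1 / θ₀ with hK
  have hK0 : 0 < K := by positivity
  refine ⟨K * (8 + E * l ^ 2), K * E, K * (8 + E * l ^ 2), K * E, by positivity, by positivity,
    by positivity, by positivity, ?_⟩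
  intro ε σ h k hε hε1 hσ hh hle hk DTV DW hDTV hDW hsmall Ω _ P _ Z hZi hZl
  have hkpos : 0 < k := by
    rcases Nat.eq_zero_or_pos k with rfl | hk0
    · simp at hk; linarith
    · exact hk0
  set l' := Real.log (1 / ε) with hl'
  have hl0 : 0 ≤ l := Real.log_nonneg (by have := dₒ.cast_nonneg (α := ℝ); linarith)
  have hl'0 : 0 ≤ l' := Real.log_nonneg (by rw [le_div_iff₀ hε]; linarith)
  have hlog : Real.log ((2 + 4 * dₒ) / ε) = l + l' := by
    rw [hl, hl', ← Real.log_mul (by positivity) (by positivity), mul_one_div]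
  -- Chosen so that the threshold in `measure_noiseSize_ge_le` is at most `s * m / h`, using `(k +
  -- 1) * h ≤ T + hmax`; the summand `1` ensures `m ≥ 1`.
  set m := 1 + ((dₒ : ℝ) + 1) * √(T + hmax) * √(8 * (l + l')) with hm
  set s := σ * √h with hs
  have hs0 : 0 < s := by positivity
  have hsσ : s ^ 2 = σ ^ 2 * h := by rw [hs, mul_pow, Real.sq_sqrt hh.le]
  have hm1 : 1 ≤ m := le_add_of_nonneg_right (by positivity)
  have hm3 : m ^ 3 ≤ (8 + E * l ^ 2) + E * l' ^ 2 :=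
    cube_le_add_sq_mul (by positivity) (by positivity) (by positivity) hm
  have hDT : DTV = K * ((8 + E * l ^ 2) + E * l' ^ 2) := by rw [hDTV]; ring
  have hDW' : DW = DTV := by rw [hDTV, hDW]
  have hDT0 : 0 < DTV := by rw [hDT]; positivity
  have hKm : K * m ^ 3 ≤ DTV := by rw [hDT]; gcongr
  have hDm : D * m ^ 3 ≤ DTV := le_trans (by gcongr; rw [hK]; simp [hθ₀.le]) hKm
  have hsm : s * m ^ 3 ≤ θ₀ := by
    have h1 : 1 / θ₀ * m ^ 3 ≤ DTV := le_trans (by gcongr; rw [hK]; simp [hD.le]) hKm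
    have h2 : s * DTV ≤ 1 / 2 := by
      have := mul_le_mul_of_nonneg_right hsmall hDT0.le
      rwa [mul_assoc (1 / 2), inv_mul_cancel₀ hDT0.ne', mul_one] at this
    have h3 : s * (1 / θ₀ * m ^ 3) ≤ 1 / 2 := le_trans (by gcongr) h2
    have h4 : s * (1 / θ₀ * m ^ 3) = s * m ^ 3 / θ₀ := by ring
    rw [h4, div_le_iff₀ hθ₀] at h3
    linarith
  -- The approximation is deterministic once the noise size is below the threshold, so the bad event
  -- lies in the tail event; an inclusion suffices and no measurability is needed.
  refine le_trans (measure_mono fun ω hω => ?_)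
    (measure_noiseSize_ge_le hZi hZl hσ hkpos hε hε1)
  by_contra hlt
  rw [Set.mem_ofPred_eq, not_le] at hlt
  refine hω ?_
  have hns : Model.noiseSize k (fun i => Z i ω) ≤ s * m / h := by
    refine hlt.le.trans ?_
    rw [hlog, le_div_iff₀ hh]
    have h1 : √((k : ℝ) + 1) * h ≤ √h * √(T + hmax) := by
      have h2 : √((k : ℝ) + 1) * √h ≤ √(T + hmax) := by
        rw [← Real.sqrt_mul (by positivity)]
        exact Real.sqrt_le_sqrt (by linarith)
      calc √((k : ℝ) + 1) * h = √h * (√((k : ℝ) + 1) * √h) := by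
            linear_combination -√((k : ℝ) + 1) * Real.mul_self_sqrt hh.le
        _ ≤ √h * √(T + hmax) := by gcongr
    calc (dₒ + 1) * σ * √(k + 1) * √(8 * (l + l')) * h =
        (dₒ + 1) * σ * (√(k + 1) * h) * √(8 * (l + l')) := by ring
      _ ≤ (dₒ + 1) * σ * (√h * √(T + hmax)) * √(8 * (l + l')) := by gcongr
      _ = s * (m - 1) := by rw [hm, hs]; ring
      _ ≤ s * m := by gcongr; linarith
  obtain ⟨r1, r2, r3, r4, r5⟩ := key σ h s m k (fun i => Z i ω) hσ hh hle hk hs0 hsσ hm1 hns hsm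
  refine ⟨r1, r2, r3, r4.trans (ENNReal.ofReal_le_ofReal ?_),
    r5.trans (ENNReal.ofReal_le_ofReal ?_)⟩
  · calc D * (s * m ^ 3) = D * m ^ 3 * s := by ring
      _ ≤ DTV * s := by gcongr
      _ = DTV * σ * √h := by rw [hs]; ring
  · calc D * (s * m ^ 3) * s = D * m ^ 3 * s ^ 2 := by ring
      _ ≤ DTV * s ^ 2 := by gcongr
      _ = DW * σ ^ 2 * h := by rw [hDW', hsσ]; ring
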